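/- **Problem.** There are $m\ge 1$ clients. Client $i$ has sample functions $f_i(z;\xi)$, $\xi\sim\mathcal C_i$, and $g_i(z;\zeta)$, $\zeta\sim\mathcal D_i$, on $z=(x,y)\in\mathbb R^{d_1+d_2}$, and $f_i(z)=\mathbb E\,f_i(z;\xi)$, $g_i(z)=\mathbb E\,g_i(z;\zeta)$. Let $g=\frac1m\sum_i g_i$, $y^*(x)=\arg\min_y g(x,y)$, and $f(x)=\frac1m\sum_i f_i(x,y^*(x))$. **Assumptions.** For all $i$: (A) $f_i,\nabla f_i,\nabla g_i,\nabla^2 g_i$ are Lipschitz in $z$ with constants $\ell_{f,0}\ge0$, $\ell_{f,1}>0$, $\ell_{g,1}>0$, $\ell_{g,2}\ge0$, and $g_i(x,\cdot)$ is $\mu_g$-strongly convex ($\mu_g>0$) for every $x$; (B) $\nabla f_i(z;\xi)$, $\nabla g_i(z;\zeta)$, $\nabla^2 g_i(z;\zeta)$ are unbiased for $\nabla f_i(z)$, $\nabla g_i(z)$, $\nabla^2 g_i(z)$ with variances at most $\sigma_f^2,\sigma_{g,1}^2,\sigma_{g,2}^2$ (spectral norm for Hessians), and these bounds are not all $0$;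 (C) $f$ is bounded below: $f(x^0)-f(x)\le\Delta$ for all $x$, and $\|y^0-y^*(x^0)\|^2\le\Delta$. **Algorithm (FedNest).** Start at $(x^0,y^0)$; client $i$ makes $\tau_i\ge1$ local steps. In round $k=0,\dots,K-1$, with stepsizes $\alpha_k,\beta_k$: *FedInn*, run $T$ times from $y=y^k$ with $x=x^k$: set $q=\frac1m\sum_i\nabla_y g_i(x,y;\zeta_i)$, $y_{i,0}=y$, $y_{i,\nu+1}=y_{i,\nu}-\frac{\beta_k}{\tau_i}\big(\nabla_y g_i(x,y_{i,\nu};\zeta_{i,\nu})-\nabla_y g_i(x,y;\zeta_{i,\nu})+q\big)$ for $0\le\nu<\tau_i$, and replace $y$ by $\frac1m\sum_i y_{i,\tau_i}$. The final value is $y^{k+1}$. *FedIHGP*, at $(x,y)=(x^k,y^{k+1})$: draw $N'$ uniformly from $\{0,\dots,N-1\}$ and nonempty client subsets $S_0,S_1,\dots$ uniformly at random (subsets of equal size are equally likely); set $p_0=\frac{N}{\ell_{g,1}|S_0|}\sum_{i\in S_0}\nabla_y f_i(x,y;\xi_{i,0})$ and $p_n=\frac1{|S_n|}\sum_{i\in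 S_n}\big(I-\frac1{\ell_{g,1}}\nabla_y^2g_i(x,y;\zeta_{i,n})\big)p_{n-1}$; return $p_{N'}$. *FedOut*, at the same $(x,y)$: set $h=\frac1m\sum_i\big(\nabla_xf_i(x,y;\xi_i)-\nabla^2_{xy}g_i(x,y;\zeta_i)\,p_{N'}\big)$, $x_{i,0}=x$, $x_{i,\nu+1}=x_{i,\nu}-\frac{\alpha_k}{\tau_i}\big(\nabla_xf_i(x_{i,\nu},y;\xi_{i,\nu})-\nabla_xf_i(x,y;\xi_{i,\nu})+h\big)$ for $0\le\nu<\tau_i$, and $x^{k+1}=\frac1m\sum_i x_{i,\tau_i}$. All random draws are mutually independent. **Theorem.** There are positive constants $\bar\alpha_1,\bar\alpha_2,\bar\alpha_3,\bar\beta,C_b$, depending only on $\ell_{f,0},\ell_{f,1},\ell_{g,1},\ell_{g,2},\mu_g$, such that for all admissible $\sigma_f^2,\sigma_{g,1}^2,\sigma_{g,2}^2$, all $\bar\alpha>0$, $N\ge1$ and $\Delta$ there is a constant $C>0$, depending only on these quantities and the previous ones (in particular not on $K$, $T$, $m$, $d_1$, $d_2$, the $\tau_i$ or the problem instance), for which the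 following holds. For every problem satisfying the assumptions, all $T\ge1$ and $K\ge1$, and the stepsizes $$\alpha_k=\min\Big\{\bar\alpha_1,\bar\alpha_2,\bar\alpha_3,\frac{\bar\alpha}{\sqrt K}\Big\},\qquad \beta_k=\frac{\bar\beta\,\alpha_k}{T},$$ $f$ is differentiable, every $\mathbb E\|\nabla f(x^k)\|^2$ is finite, and $$\frac1K\sum_{k=1}^K\mathbb E\|\nabla f(x^k)\|^2\le C\Big(\frac{\bar\alpha\max(\sigma_{g,1}^2,\sigma_{g,2}^2,\sigma_f^2)}{\sqrt K}+\frac1{\min(\bar\alpha_1,\bar\alpha_2,\bar\alpha_3)\,K}\Big)+C_b\,b^2,$$ where $b=\kappa_g\ell_{f,1}\big((\kappa_g-1)/\kappa_g\big)^N$ and $\kappa_g=\ell_{g,1}/\mu_g$. -/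

import Mathlib

open MeasureTheory ProbabilityTheory

/-- `ℝ^d` with its Euclidean norm. -/
abbrev Vec (d : ℕ) : Type := EuclideanSpace ℝ (Fin d)

/-- `ℝ^{d₁+d₂}`, the space of pairs `z = (x, y)`, with its Euclidean norm. -/
abbrev Pt (d₁ d₂ : ℕ) : Type := EuclideanSpace ℝ (Fin d₁ ⊕ Fin d₂)

/-- The pair `(x, y)`. -/
def pt {d₁ d₂ : ℕ} (x : Vec d₁) (y : Vec d₂) : Pt d₁ d₂ := WithLp.toLp 2 (Sum.elim x y)

/-- The component `x` of `z = (x, y)`. -/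
def xPart {d₁ d₂ : ℕ} (z : Pt d₁ d₂) : Vec d₁ := WithLp.toLp 2 fun j => z (Sum.inl j)

/-- The component `y` of `z = (x, y)`. -/
def yPart {d₁ d₂ : ℕ} (z : Pt d₁ d₂) : Vec d₂ := WithLp.toLp 2 fun j => z (Sum.inr j)

noncomputable section

/-- `∇_x φ (z)`: the `x`-component of the gradient. -/
def gradX {d₁ d₂ : ℕ} (φ : Pt d₁ d₂ → ℝ) (z : Pt d₁ d₂) : Vec d₁ := xPart (gradient φ z)

/-- `∇_y φ (z)`: the `y`-component of the gradient. -/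
def gradY {d₁ d₂ : ℕ} (φ : Pt d₁ d₂ → ℝ) (z : Pt d₁ d₂) : Vec d₂ := yPart (gradient φ z)

/-- The full Hessian `∇² φ (z)`; its norm as a continuous linear map is the spectral norm. -/
def hess {d₁ d₂ : ℕ} (φ : Pt d₁ d₂ → ℝ) (z : Pt d₁ d₂) : Pt d₁ d₂ →L[ℝ] Pt d₁ d₂ :=
  fderiv ℝ (gradient φ) z

/-- The product of the block `∇²_{xy} φ (z)` (a `d₁ × d₂` matrix) with a vector. -/
def hessXY {d₁ d₂ : ℕ} (φ : Pt d₁ d₂ → ℝ) (z : Pt d₁ d₂) (v : Vec d₂) : Vec d₁ :=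
  xPart (hess φ z (pt 0 v))

/-- The product of the block `∇²_y φ (z)` (a `d₂ × d₂` matrix) with a vector. -/
def hessY {d₁ d₂ : ℕ} (φ : Pt d₁ d₂ → ℝ) (z : Pt d₁ d₂) (v : Vec d₂) : Vec d₂ :=
  yPart (hess φ z (pt 0 v))

/-- The data of a federated bilevel problem with `m` clients: the sampling distributions
`C i`, `D i` and the sample functions `f i ξ z = f_i(z; ξ)` and `g i ζ z = g_i(z; ζ)`. -/
structure FedProblem (m d₁ d₂ : ℕ) (Ξ Ζ : Type*) [MeasurableSpace Ξ] [MeasurableSpace Ζ] where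
  C : Fin m → Measure Ξ
  D : Fin m → Measure Ζ
  f : Fin m → Ξ → Pt d₁ d₂ → ℝ
  g : Fin m → Ζ → Pt d₁ d₂ → ℝ

/-- One realisation of all the random draws made by the algorithm. The index `k` is the outer
round, `t` the inner round, `i` the client, `ν` the local step, `n` the Neumann step. -/
structure Draws (m : ℕ) (Ξ Ζ : Type*) where
  /-- `ζ_i` in round `(k, t)` of the inner optimizer -/
  innerAnchor : (k t : ℕ) → (i : Fin m) → Ζ
  /-- `ζ_{i,ν}` in round `(k, t)` of the inner optimizer -/
  innerLocal : (k t : ℕ) → (i : Fin m) → (ν : ℕ) → Ζ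
  /-- `ξ_i` in the outer optimizer -/
  outerAnchor : (k : ℕ) → (i : Fin m) → Ξ
  /-- `ζ_i` in the outer optimizer, used for the Jacobian `∇²_{xy} g_i` -/
  outerJac : (k : ℕ) → (i : Fin m) → Ζ
  /-- `ξ_{i,ν}` in the outer optimizer -/
  outerLocal : (k : ℕ) → (i : Fin m) → (ν : ℕ) → Ξ
  /-- the number `N'` of Neumann steps -/
  len : (k : ℕ) → ℕ
  /-- the client subset `S_n` -/
  subset : (k n : ℕ) → Finset (Fin m)
  /-- `ξ_{i,0}` in the inverse-Hessian-gradient product -/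
  ihgpGrad : (k : ℕ) → (i : Fin m) → Ξ
  /-- `ζ_{i,n}` in the inverse-Hessian-gradient product -/
  ihgpHess : (k n : ℕ) → (i : Fin m) → Ζ

/-- The names of the individual draws. -/
inductive DrawIdx (m : ℕ) : Type
  | innerAnchor (k t : ℕ) (i : Fin m)
  | innerLocal (k t : ℕ) (i : Fin m) (ν : ℕ)
  | outerAnchor (k : ℕ) (i : Fin m)
  | outerJac (k : ℕ) (i : Fin m)
  | outerLocal (k : ℕ) (i : Fin m) (ν : ℕ)
  | len (k : ℕ)
  | subset (k n : ℕ)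
  | ihgpGrad (k : ℕ) (i : Fin m)
  | ihgpHess (k n : ℕ) (i : Fin m)

/-- The sigma-algebra on `Ω` generated by an individual draw. -/
abbrev DrawIdx.sigma {m : ℕ} {Ξ Ζ Ω : Type*} [MeasurableSpace Ξ] [MeasurableSpace Ζ]
    (W : Ω → Draws m Ξ Ζ) : DrawIdx m → MeasurableSpace Ω
  | .innerAnchor k t i => MeasurableSpace.comap (fun ω => (W ω).innerAnchor k t i) inferInstance
  | .innerLocal k t i ν =>
      MeasurableSpace.comap (fun ω => (W ω).innerLocal k t i ν) inferInstance
  | .outerAnchor k i => MeasurableSpace.comap (fun ω => (W ω).outerAnchor k i) inferInstance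
  | .outerJac k i => MeasurableSpace.comap (fun ω => (W ω).outerJac k i) inferInstance
  | .outerLocal k i ν => MeasurableSpace.comap (fun ω => (W ω).outerLocal k i ν) inferInstance
  | .len k => MeasurableSpace.comap (fun ω => (W ω).len k) ⊤
  | .subset k n => MeasurableSpace.comap (fun ω => (W ω).subset k n) ⊤
  | .ihgpGrad k i => MeasurableSpace.comap (fun ω => (W ω).ihgpGrad k i) inferInstance
  | .ihgpHess k n i => MeasurableSpace.comap (fun ω => (W ω).ihgpHess k n i) inferInstance

namespace FedProblem

variable {m d₁ d₂ : ℕ} {Ξ Ζ : Type*} [MeasurableSpace Ξ] [MeasurableSpace Ζ]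
variable (P : FedProblem m d₁ d₂ Ξ Ζ)

/-- The outer function of client `i`, `f_i(z) = E_{ξ ∼ C_i} f_i(z; ξ)`. -/
def outerFun (i : Fin m) (z : Pt d₁ d₂) : ℝ := ∫ ξ, P.f i ξ z ∂(P.C i)

/-- The inner function of client `i`, `g_i(z) = E_{ζ ∼ D_i} g_i(z; ζ)`. -/
def innerFun (i : Fin m) (z : Pt d₁ d₂) : ℝ := ∫ ζ, P.g i ζ z ∂(P.D i)

/-- The inner objective `g(x, y) = (1/m) ∑ᵢ g_i(x, y)`. -/
def innerObj (x : Vec d₁) (y : Vec d₂) : ℝ := (m : ℝ)⁻¹ * ∑ i, P.innerFun i (pt x y)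

/-- `y*(x)`, a minimizer of `g(x, ·)` over the whole space. -/
def yStar (x : Vec d₁) : Vec d₂ :=
  Classical.epsilon fun y => ∀ y' : Vec d₂, P.innerObj x y ≤ P.innerObj x y'

/-- The bilevel objective `f(x) = (1/m) ∑ᵢ f_i(x, y*(x))`. -/
def obj (x : Vec d₁) : ℝ := (m : ℝ)⁻¹ * ∑ i, P.outerFun i (pt x (P.yStar x))

/-- Well-behaved objectives: smoothness of `f_i` and `g_i`, strong convexity of `g_i(x, ·)`. -/
structure WellBehaved (lf0 lf1 lg1 lg2 mug : ℝ) : Prop where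
  f_diff : ∀ i, Differentiable ℝ (P.outerFun i)
  f_lip : ∀ i z z', |P.outerFun i z - P.outerFun i z'| ≤ lf0 * ‖z - z'‖
  f_grad_lip : ∀ i z z',
    ‖gradient (P.outerFun i) z - gradient (P.outerFun i) z'‖ ≤ lf1 * ‖z - z'‖
  g_diff : ∀ i, Differentiable ℝ (P.innerFun i)
  g_grad_diff : ∀ i, Differentiable ℝ (gradient (P.innerFun i))
  g_grad_lip : ∀ i z z',
    ‖gradient (P.innerFun i) z - gradient (P.innerFun i) z'‖ ≤ lg1 * ‖z - z'‖
  g_hess_lip : ∀ i z z', ‖hess (P.innerFun i) z - hess (P.innerFun i) z'‖ ≤ lg2 * ‖z - z'‖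
  g_strong : ∀ i x, StrongConvexOn Set.univ mug (fun y => P.innerFun i (pt x y))

/-- Stochastic samples: the sample gradients and Hessians are unbiased with variances bounded
by `vf = σ_f²`, `vg1 = σ_{g,1}²`, `vg2 = σ_{g,2}²`. The first fields make the expectations and
derivatives meaningful; square integrability goes with the existence of the variances. -/
structure StochasticSamples (vf vg1 vg2 : ℝ) : Prop where
  C_prob : ∀ i, IsProbabilityMeasure (P.C i)
  D_prob : ∀ i, IsProbabilityMeasure (P.D i)
  f_int : ∀ i z, Integrable (fun ξ => P.f i ξ z) (P.C i)
  g_int : ∀ i z, Integrable (fun ζ => P.g i ζ z) (P.D i)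
  f_diff : ∀ i ξ, Differentiable ℝ (P.f i ξ)
  g_diff : ∀ i ζ, Differentiable ℝ (P.g i ζ)
  g_grad_diff : ∀ i ζ, Differentiable ℝ (gradient (P.g i ζ))
  f_grad_meas : ∀ i, Measurable fun p : Pt d₁ d₂ × Ξ => gradient (P.f i p.2) p.1
  g_grad_meas : ∀ i, Measurable fun p : Pt d₁ d₂ × Ζ => gradient (P.g i p.2) p.1
  g_hess_meas : ∀ i, Measurable fun p : Pt d₁ d₂ × Ζ => hess (P.g i p.2) p.1
  f_grad_sq : ∀ i z, MemLp (fun ξ => gradient (P.f i ξ) z) 2 (P.C i)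
  g_grad_sq : ∀ i z, MemLp (fun ζ => gradient (P.g i ζ) z) 2 (P.D i)
  g_hess_sq : ∀ i z, MemLp (fun ζ => hess (P.g i ζ) z) 2 (P.D i)
  f_grad_unbiased : ∀ i z, ∫ ξ, gradient (P.f i ξ) z ∂(P.C i) = gradient (P.outerFun i) z
  g_grad_unbiased : ∀ i z, ∫ ζ, gradient (P.g i ζ) z ∂(P.D i) = gradient (P.innerFun i) z
  g_hess_unbiased : ∀ i z, ∫ ζ, hess (P.g i ζ) z ∂(P.D i) = hess (P.innerFun i) z
  f_grad_var : ∀ i z,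
    ∫ ξ, ‖gradient (P.f i ξ) z - gradient (P.outerFun i) z‖ ^ 2 ∂(P.C i) ≤ vf
  g_grad_var : ∀ i z,
    ∫ ζ, ‖gradient (P.g i ζ) z - gradient (P.innerFun i) z‖ ^ 2 ∂(P.D i) ≤ vg1
  g_hess_var : ∀ i z,
    ∫ ζ, ‖hess (P.g i ζ) z - hess (P.innerFun i) z‖ ^ 2 ∂(P.D i) ≤ vg2

/-! ### The inner optimizer -/

/-- The local iterates `y_{i,ν}` of client `i` in the inner optimizer, with local stepsize `βi`,
global direction `q` and local samples `ζ`. -/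
def innLocal (i : Fin m) (βi : ℝ) (x : Vec d₁) (y q : Vec d₂) (ζ : ℕ → Ζ) : ℕ → Vec d₂
  | 0 => y
  | ν + 1 =>
    let yν := innLocal i βi x y q ζ ν
    yν - βi • (gradY (P.g i (ζ ν)) (pt x yν) - gradY (P.g i (ζ ν)) (pt x y) + q)

/-- `FedInn(x, y, β)` with local stepsizes `β_i = β / τ_i`. -/
def fedInn (τ : Fin m → ℕ) (β : ℝ) (x : Vec d₁) (y : Vec d₂)
    (ζ₀ : Fin m → Ζ) (ζ : Fin m → ℕ → Ζ) : Vec d₂ :=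
  let q : Vec d₂ := (m : ℝ)⁻¹ • ∑ i, gradY (P.g i (ζ₀ i)) (pt x y)
  (m : ℝ)⁻¹ • ∑ i, P.innLocal i (β / τ i) x y q (ζ i) (τ i)

/-! ### The inverse-Hessian-gradient product -/

/-- The vectors `p_n` of `FedIHGP(x, y, N)`, with `ℓ = ℓ_{g,1}`, client subsets `S n`, gradient
samples `ξ i = ξ_{i,0}` and Hessian samples `ζ n i = ζ_{i,n}`. -/
def fedIHGP (ℓ : ℝ) (N : ℕ) (x : Vec d₁) (y : Vec d₂) (S : ℕ → Finset (Fin m))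
    (ξ : Fin m → Ξ) (ζ : ℕ → Fin m → Ζ) : ℕ → Vec d₂
  | 0 => ((N : ℝ) / ℓ) • ((S 0).card : ℝ)⁻¹ • ∑ i ∈ S 0, gradY (P.f i (ξ i)) (pt x y)
  | n + 1 =>
    let p := fedIHGP ℓ N x y S ξ ζ n
    ((S (n + 1)).card : ℝ)⁻¹ •
      ∑ i ∈ S (n + 1), (p - ℓ⁻¹ • hessY (P.g i (ζ (n + 1) i)) (pt x y) p)

/-! ### The outer optimizer -/

/-- The local iterates `x_{i,ν}` of client `i` in the outer optimizer, with local stepsize `αi`,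
global direction `h` and local samples `ξ`. -/
def outLocal (i : Fin m) (αi : ℝ) (x : Vec d₁) (y : Vec d₂) (h : Vec d₁) (ξ : ℕ → Ξ) :
    ℕ → Vec d₁
  | 0 => x
  | ν + 1 =>
    let xν := outLocal i αi x y h ξ ν
    xν - αi • (gradX (P.f i (ξ ν)) (pt xν y) - gradX (P.f i (ξ ν)) (pt x y) + h)

/-- `FedOut(x, y, α)` with local stepsizes `α_i = α / τ_i`, where `p` is the output of `FedIHGP`. -/
def fedOut (τ : Fin m → ℕ) (α : ℝ) (x : Vec d₁) (y p : Vec d₂)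
    (ξ₀ : Fin m → Ξ) (ζ : Fin m → Ζ) (ξ : Fin m → ℕ → Ξ) : Vec d₁ :=
  let h : Vec d₁ := (m : ℝ)⁻¹ •
    ∑ i, (gradX (P.f i (ξ₀ i)) (pt x y) - hessXY (P.g i (ζ i)) (pt x y) p)
  (m : ℝ)⁻¹ • ∑ i, P.outLocal i (α / τ i) x y h (ξ i) (τ i)

/-! ### The full algorithm -/

/-- The inner iterates `y^{k,t}` of outer round `k`. -/
def innerIter (τ : Fin m → ℕ) (β : ℝ) (x : Vec d₁) (y : Vec d₂) (w : Draws m Ξ Ζ) (k : ℕ) :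
    ℕ → Vec d₂
  | 0 => y
  | t + 1 => P.fedInn τ β x (innerIter τ β x y w k t) (w.innerAnchor k t) (w.innerLocal k t)

/-- The iterates `(x^k, y^k)` of FedNest with outer stepsizes `α k`, inner stepsizes `β k`, as a
function of the realisation `w` of the random draws. -/
def fedNest (ℓ : ℝ) (N T : ℕ) (τ : Fin m → ℕ) (α β : ℕ → ℝ) (x₀ : Vec d₁) (y₀ : Vec d₂)
    (w : Draws m Ξ Ζ) : ℕ → Vec d₁ × Vec d₂
  | 0 => (x₀, y₀)
  | k + 1 =>
    let x := (fedNest ℓ N T τ α β x₀ y₀ w k).1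
    let y := (fedNest ℓ N T τ α β x₀ y₀ w k).2
    let yNew := P.innerIter τ (β k) x y w k T
    let p := P.fedIHGP ℓ N x yNew (w.subset k) (w.ihgpGrad k) (w.ihgpHess k) (w.len k)
    (P.fedOut τ (α k) x yNew p (w.outerAnchor k) (w.outerJac k) (w.outerLocal k), yNew)

/-- The random draws `W` on the probability space `(Ω, Pr)`: all draws are mutually independent,
samples of client `i` have law `C i` or `D i`, `N'` is uniform on `{0, …, N - 1}`, and each `S_n` is
a nonempty client subset chosen uniformly at random (subsets of the same size are equally likely;
the law of the size is arbitrary, for instance a fixed size). -/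
structure IsSampling {Ω : Type*} [MeasurableSpace Ω] (Pr : Measure Ω) (N : ℕ)
    (W : Ω → Draws m Ξ Ζ) : Prop where
  innerAnchor_meas : ∀ k t i, Measurable fun ω => (W ω).innerAnchor k t i
  innerLocal_meas : ∀ k t i ν, Measurable fun ω => (W ω).innerLocal k t i ν
  outerAnchor_meas : ∀ k i, Measurable fun ω => (W ω).outerAnchor k i
  outerJac_meas : ∀ k i, Measurable fun ω => (W ω).outerJac k i
  outerLocal_meas : ∀ k i ν, Measurable fun ω => (W ω).outerLocal k i ν
  len_meas : ∀ k, Measurable fun ω => (W ω).len k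
  subset_meas : ∀ k n A, MeasurableSet {ω | (W ω).subset k n = A}
  ihgpGrad_meas : ∀ k i, Measurable fun ω => (W ω).ihgpGrad k i
  ihgpHess_meas : ∀ k n i, Measurable fun ω => (W ω).ihgpHess k n i
  innerAnchor_law : ∀ k t i, Pr.map (fun ω => (W ω).innerAnchor k t i) = P.D i
  innerLocal_law : ∀ k t i ν, Pr.map (fun ω => (W ω).innerLocal k t i ν) = P.D i
  outerAnchor_law : ∀ k i, Pr.map (fun ω => (W ω).outerAnchor k i) = P.C i
  outerJac_law : ∀ k i, Pr.map (fun ω => (W ω).outerJac k i) = P.D i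
  outerLocal_law : ∀ k i ν, Pr.map (fun ω => (W ω).outerLocal k i ν) = P.C i
  len_law : ∀ k, ∀ n < N, Pr.real {ω | (W ω).len k = n} = 1 / N
  subset_nonempty : ∀ k n, Pr.real {ω | (W ω).subset k n = ∅} = 0
  subset_unif : ∀ k n (A B : Finset (Fin m)), A.card = B.card →
    Pr.real {ω | (W ω).subset k n = A} = Pr.real {ω | (W ω).subset k n = B}
  ihgpGrad_law : ∀ k i, Pr.map (fun ω => (W ω).ihgpGrad k i) = P.C i
  ihgpHess_law : ∀ k n i, Pr.map (fun ω => (W ω).ihgpHess k n i) = P.D i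
  indep : iIndep (DrawIdx.sigma W) Pr

end FedProblem

/-- The Neumann-series bias `b = κ ℓ_{f,1} ((κ - 1) / κ) ^ N` with `κ = ℓ_{g,1} / μ_g`. -/
def neumannBias (lf1 lg1 mug : ℝ) (N : ℕ) : ℝ :=
  (lg1 / mug) * lf1 * ((lg1 / mug - 1) / (lg1 / mug)) ^ N

/-- The outer stepsize `α_k = min{ᾱ₁, ᾱ₂, ᾱ₃, ᾱ / √K}`, the same for all rounds `k < K`. -/
def outerStep (a₁ a₂ a₃ a : ℝ) (K : ℕ) : ℝ := min (min a₁ (min a₂ a₃)) (a / Real.sqrt K)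

end

/-!
The proof follows the potential `V_k = E f(x^k) + E ‖y^k - y*(x^k)‖²` through the rounds. For
small stepsizes one round gives

  `V_{k+1} ≤ V_k - (α / 4) E ‖∇f(x^k)‖² + 2 α (ℓ_{f,0} / ℓ_{f,1})² b² + A α²`,

with a constant `A` depending on the smoothness constants, the variances and `N`
(`round_potential`). Summing over the rounds `0, …, K` and dividing by `α K` gives the rate, since
`1 / α ≤ 1 / min(ᾱ₁, ᾱ₂, ᾱ₃) + √K / ᾱ` and `α ≤ ᾱ / √K` (`average_gradient_le`).

The deterministic part concerns a pair `F`, `G` of outer and inner functions. Strong convexity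
makes `y*` Lipschitz (`star_lip`) and the block `∇²_y G` invertible, so `y*` has a second-order
expansion (`star_quad`), the objective has gradient `∇_x F - ∇²_{xy} G [∇²_y G]⁻¹ ∇_y F` at
`(x, y*(x))` (`hasGradientAt_obj`), and this hypergradient is Lipschitz in `(x, y)`
(`hypergrad_lip`). Replacing the inverse by `N` terms of its Neumann series costs at most
`(ℓ_{f,0} / ℓ_{f,1}) |b|` (`norm_neumannGrad_sub_sq_le`), which is where the bias comes from.

The probabilistic part avoids conditional expectations. For the sigma-algebra `past W S` of the
draws with names in `S`, a conditional second moment is bounded by testing against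
square-integrable random weights measurable with respect to it (`CondSized`), and two vectors have
the same conditional mean if they have the same inner products with all such random vectors
(`SameCondMean`). A fresh sample is independent of the past, so Fubini's theorem bounds its noise
and shows that it is centred (`IsOracle.noise_bound`, `IsOracle.noise_orthogonal`); a random
client subset has, by symmetry, the same expected weight on every client and acts like the full
average (`condSized_random_average`, `sameCondMean_random_average`). In the variance-reduced local
steps the corrections cancel up to the distance travelled by the local iterates, so that their sum
is the stepsize times the global direction plus a centred noise and a drift proportional to the
stepsize (`local_updates`).

Consequently the inner optimizer contracts `E ‖y - y*(x)‖²` up to noise (`fedInn_contraction`,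
`innerIter_bound`). In the inverse-Hessian-gradient product the vector `p_n` has as conditional
mean `N / ℓ_{g,1}` times `(I - ∇²_y G / ℓ_{g,1})^n ∇_y F`, so that the uniform stopping index `N'`
produces the partial sum (`fedIHGP_moments`, `fedIHGP_len_moments`), and the outer optimizer moves
by `-α H` where `H` has the truncated hypergradient as conditional mean up to `O(α)`
(`fedOut_direction`). All second moments are bounded conditionally by constants, which may depend
on `N` and the variances because `C` does.

In the outer step the objective descends by the descent inequality (`integral_obj_step_le`). The
movement of `y*` is estimated by its second-order expansion (`integral_tracking_step_le`): its
linear part only involves the conditional mean of `H`, hence `‖∇f‖`, the bias and `‖y - y*(x)‖`,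
and the remainder `E[‖y - y*(x)‖ ‖H‖²]` is a conditional second moment with weight `√‖y - y*(x)‖`.
Both estimates lose at most a factor `1 + Q α` in `E ‖y - y*(x)‖²` with `Q = couplingRate`. The
inner stepsize `β = (2 Q / μ) α / T` makes the `T` inner rounds contract by `1 - Q α`, which
absorbs it.
-/

noncomputable section

open scoped RealInnerProductSpace Topology ENNReal

set_option linter.unusedSectionVars false

/-! ### Coordinates and blocks of the Hessian -/

section Coordinates

variable {d₁ d₂ : ℕ}

/-- The inclusion `x ↦ (x, 0)`. -/
def inX : Vec d₁ →L[ℝ] Pt d₁ d₂ :=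
  LinearMap.toContinuousLinearMap
    { toFun := fun x => pt x 0
      map_add' := fun x y => by ext (i | i) <;> simp [pt]
      map_smul' := fun c x => by ext (i | i) <;> simp [pt] }

/-- The inclusion `y ↦ (0, y)`. -/
def inY : Vec d₂ →L[ℝ] Pt d₁ d₂ :=
  LinearMap.toContinuousLinearMap
    { toFun := fun y => pt 0 y
      map_add' := fun x y => by ext (i | i) <;> simp [pt]
      map_smul' := fun c x => by ext (i | i) <;> simp [pt] }

/-- The projection `(x, y) ↦ x`. -/
def prX : Pt d₁ d₂ →L[ℝ] Vec d₁ :=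
  LinearMap.toContinuousLinearMap
    { toFun := fun z => xPart z
      map_add' := fun x y => by ext i; simp [xPart]
      map_smul' := fun c x => by ext i; simp [xPart] }

/-- The projection `(x, y) ↦ y`. -/
def prY : Pt d₁ d₂ →L[ℝ] Vec d₂ :=
  LinearMap.toContinuousLinearMap
    { toFun := fun z => yPart z
      map_add' := fun x y => by ext i; simp [yPart]
      map_smul' := fun c x => by ext i; simp [yPart] }

theorem pt_eq (x : Vec d₁) (y : Vec d₂) : pt x y = inX x + inY y := by
  ext (i | i) <;> simp [pt, inX, inY]

theorem pt_sub_pt (x x' : Vec d₁) (y y' : Vec d₂) : pt x y - pt x' y' = pt (x - x') (y - y') := by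
  ext (i | i) <;> simp [pt]

theorem norm_pt_sq (x : Vec d₁) (y : Vec d₂) : ‖pt x y‖ ^ 2 = ‖x‖ ^ 2 + ‖y‖ ^ 2 := by
  simp [EuclideanSpace.norm_sq_eq, pt]

theorem norm_pt_zero_left (y : Vec d₂) : ‖(pt 0 y : Pt d₁ d₂)‖ = ‖y‖ := by
  have h := norm_pt_sq (0 : Vec d₁) y
  have : ‖(pt 0 y : Pt d₁ d₂)‖ ^ 2 = ‖y‖ ^ 2 := by simpa using h
  exact (sq_eq_sq₀ (norm_nonneg _) (norm_nonneg _)).1 this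

theorem norm_pt_zero_right (x : Vec d₁) : ‖(pt x 0 : Pt d₁ d₂)‖ = ‖x‖ := by
  have h := norm_pt_sq x (0 : Vec d₂)
  have : ‖(pt x 0 : Pt d₁ d₂)‖ ^ 2 = ‖x‖ ^ 2 := by simpa using h
  exact (sq_eq_sq₀ (norm_nonneg _) (norm_nonneg _)).1 this

theorem norm_inX (x : Vec d₁) : ‖(inX x : Pt d₁ d₂)‖ = ‖x‖ := norm_pt_zero_right x

theorem norm_inY (y : Vec d₂) : ‖(inY y : Pt d₁ d₂)‖ = ‖y‖ := norm_pt_zero_left y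

theorem norm_sq_parts (z : Pt d₁ d₂) : ‖z‖ ^ 2 = ‖prX z‖ ^ 2 + ‖prY z‖ ^ 2 := by
  simp [EuclideanSpace.norm_sq_eq, prX, prY, xPart, yPart]

theorem norm_prX_le (z : Pt d₁ d₂) : ‖prX z‖ ≤ ‖z‖ := by
  have := norm_sq_parts z
  exact abs_le_of_sq_le_sq' (by nlinarith [sq_nonneg ‖prY z‖]) (norm_nonneg _) |>.2

theorem norm_prY_le (z : Pt d₁ d₂) : ‖prY z‖ ≤ ‖z‖ := by
  have := norm_sq_parts z
  exact abs_le_of_sq_le_sq' (by nlinarith [sq_nonneg ‖prX z‖]) (norm_nonneg _) |>.2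

theorem inner_inX (x : Vec d₁) (z : Pt d₁ d₂) : ⟪z, inX x⟫ = ⟪prX z, x⟫ := by
  simp [PiLp.inner_apply, inX, prX, pt, xPart]

theorem inner_inY (y : Vec d₂) (z : Pt d₁ d₂) : ⟪z, inY y⟫ = ⟪prY z, y⟫ := by
  simp [PiLp.inner_apply, inY, prY, pt, yPart]

theorem gradX_eq (φ : Pt d₁ d₂ → ℝ) (z : Pt d₁ d₂) : gradX φ z = prX (gradient φ z) := rfl

theorem gradY_eq (φ : Pt d₁ d₂ → ℝ) (z : Pt d₁ d₂) : gradY φ z = prY (gradient φ z) := rfl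

/-- The block `∇²_y φ (z)` as a continuous linear map. -/
def blockY (φ : Pt d₁ d₂ → ℝ) (z : Pt d₁ d₂) : Vec d₂ →L[ℝ] Vec d₂ :=
  prY ∘L hess φ z ∘L inY

/-- The block `∇²_{xy} φ (z)` as a continuous linear map. -/
def blockXY (φ : Pt d₁ d₂ → ℝ) (z : Pt d₁ d₂) : Vec d₂ →L[ℝ] Vec d₁ :=
  prX ∘L hess φ z ∘L inY

/-- The block `∇²_{yx} φ (z)` as a continuous linear map. -/
def blockYX (φ : Pt d₁ d₂ → ℝ) (z : Pt d₁ d₂) : Vec d₁ →L[ℝ] Vec d₂ :=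
  prY ∘L hess φ z ∘L inX

theorem hessY_eq (φ : Pt d₁ d₂ → ℝ) (z : Pt d₁ d₂) (v : Vec d₂) :
    hessY φ z v = prY (hess φ z (inY v)) := rfl

theorem hessXY_eq (φ : Pt d₁ d₂ → ℝ) (z : Pt d₁ d₂) (v : Vec d₂) :
    hessXY φ z v = prX (hess φ z (inY v)) := rfl

theorem blockY_apply (φ : Pt d₁ d₂ → ℝ) (z : Pt d₁ d₂) (v : Vec d₂) :
    blockY φ z v = prY (hess φ z (inY v)) := rfl

theorem blockXY_apply (φ : Pt d₁ d₂ → ℝ) (z : Pt d₁ d₂) (v : Vec d₂) :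
    blockXY φ z v = prX (hess φ z (inY v)) := rfl

theorem blockYX_apply (φ : Pt d₁ d₂ → ℝ) (z : Pt d₁ d₂) (v : Vec d₁) :
    blockYX φ z v = prY (hess φ z (inX v)) := rfl

/-- The full Hessian is symmetric because the gradient is differentiable everywhere. -/
theorem hess_symm {φ : Pt d₁ d₂ → ℝ} (h₁ : Differentiable ℝ φ)
    (h₂ : Differentiable ℝ (gradient φ)) (z u v : Pt d₁ d₂) :
    ⟪hess φ z u, v⟫ = ⟪hess φ z v, u⟫ := by
  let J : Pt d₁ d₂ →L[ℝ] (Pt d₁ d₂ →L[ℝ] ℝ) := innerSL ℝ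
  have hf : ∀ y, HasFDerivAt φ (J (gradient φ y)) y := fun y =>
    (h₁ y).hasGradientAt.hasFDerivAt
  have hx : HasFDerivAt (fun y => J (gradient φ y)) (J ∘L hess φ z) z :=
    J.hasFDerivAt.comp z (h₂ z).hasFDerivAt
  exact second_derivative_symmetric hf hx u v

end Coordinates

/-! ### First-order consequences of smoothness and strong convexity -/

/-- A map with Lipschitz derivative agrees with its linearisation up to a quadratic error. -/
theorem norm_image_sub_sub_fderiv_le {E F : Type*} [NormedAddCommGroup E] [NormedSpace ℝ E]
    [NormedAddCommGroup F] [NormedSpace ℝ F] {f : E → F} {f' : E → E →L[ℝ] F} {L : ℝ}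
    (hL : 0 ≤ L) (hf : ∀ x, HasFDerivAt f (f' x) x) (hlip : ∀ x x', ‖f' x - f' x'‖ ≤ L * ‖x - x'‖)
    (x x' : E) : ‖f x' - f x - f' x (x' - x)‖ ≤ L * ‖x' - x‖ ^ 2 := by
  have h := Convex.norm_image_sub_le_of_norm_hasFDerivWithin_le' (𝕜 := ℝ)
    (s := Metric.closedBall x ‖x' - x‖) (f := f) (f' := f') (φ := f' x) (C := L * ‖x' - x‖)
    (x := x) (y := x') (fun z _ => (hf z).hasFDerivWithinAt)
    (fun z hz => (hlip z x).trans (by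
      gcongr
      rwa [Metric.mem_closedBall, dist_eq_norm] at hz))
    (convex_closedBall _ _) (Metric.mem_closedBall_self (norm_nonneg _))
    (by rw [Metric.mem_closedBall, dist_eq_norm])
  calc _ ≤ _ := h
    _ = _ := by ring

/-- The first-order form of strong convexity: the limit `t → 0` of the defining inequality on the
segment from `a` to `b`. -/
theorem StrongConvexOn.add_inner_gradient_le {E : Type*} [NormedAddCommGroup E]
    [InnerProductSpace ℝ E] [CompleteSpace E] {φ : E → ℝ} {μ : ℝ}
    (h : StrongConvexOn Set.univ μ φ) {a v : E} (hv : HasGradientAt φ v a) (b : E) :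
    φ a + ⟪v, b - a⟫ + μ / 2 * ‖b - a‖ ^ 2 ≤ φ b := by
  have hline : HasDerivAt (fun t : ℝ => a + t • (b - a)) (b - a) 0 := by
    simpa using ((hasDerivAt_id (0 : ℝ)).smul_const (b - a)).const_add a
  have hd : HasDerivAt (fun t : ℝ => φ (a + t • (b - a))) ⟪v, b - a⟫ 0 := by
    have h1 : HasFDerivAt φ (InnerProductSpace.toDual ℝ E v) (a + (0 : ℝ) • (b - a)) := by
      simpa using hv.hasFDerivAt
    have h2 := h1.comp_hasDerivAt (0 : ℝ) hline
    rw [InnerProductSpace.toDual_apply_apply] at h2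
    exact h2
  have hs := (hasDerivAt_iff_tendsto_slope.1 hd).mono_left
    (nhdsWithin_mono (0 : ℝ) (s := Set.Ioi 0) (fun t ht => ne_of_gt ht))
  have hr : Filter.Tendsto (fun t : ℝ => φ b - φ a - (1 - t) * (μ / 2 * ‖b - a‖ ^ 2)) (𝓝[>] 0)
      (𝓝 (φ b - φ a - (1 - 0) * (μ / 2 * ‖b - a‖ ^ 2))) := by
    refine Filter.Tendsto.mono_left ?_ nhdsWithin_le_nhds
    refine Continuous.tendsto ?_ 0
    fun_prop
  have hle := le_of_tendsto_of_tendsto hs hr (by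
    have : Set.Ioc (0 : ℝ) 1 ∈ 𝓝[>] (0 : ℝ) := Ioc_mem_nhdsGT one_pos
    filter_upwards [this] with t ht
    have hc := h.2 (Set.mem_univ a) (Set.mem_univ b) (sub_nonneg.2 ht.2) ht.1.le (by ring)
    have e : (1 - t) • a + t • b = a + t • (b - a) := by module
    rw [e, norm_sub_rev] at hc
    simp only [smul_eq_mul] at hc
    simp only [slope_def_field, zero_smul, add_zero, sub_zero]
    rw [div_le_iff₀ ht.1]
    nlinarith)
  nlinarith

/-- A positive semidefinite symmetric map with quadratic form at most `ρ ‖·‖²` has norm at most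
`ρ`. -/
theorem norm_apply_le_of_symm {E : Type*} [NormedAddCommGroup E] [InnerProductSpace ℝ E]
    {B : E →L[ℝ] E} {ρ : ℝ} (hs : ∀ u v, ⟪B u, v⟫ = ⟪B v, u⟫) (h0 : ∀ v, 0 ≤ ⟪B v, v⟫)
    (h1 : ∀ v, ⟪B v, v⟫ ≤ ρ * ‖v‖ ^ 2) (hρ : 0 ≤ ρ) (v : E) : ‖B v‖ ≤ ρ * ‖v‖ := by
  have key : ∀ s : ℝ, 0 ≤ ⟪B v, v⟫ - 2 * s * ‖B v‖ ^ 2 + s ^ 2 * ⟪B (B v), B v⟫ := by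
    intro s
    have h := h0 (v - s • B v)
    simp only [map_sub, map_smul, inner_sub_left, inner_sub_right, inner_smul_left,
      inner_smul_right, RCLike.conj_to_real] at h
    rw [hs (B v) v, real_inner_self_eq_norm_sq] at h
    linarith
  rcases hρ.eq_or_lt with rfl | hρ
  · have h2 := key 1
    have h3 := h1 v
    have h4 := h1 (B v)
    have : ‖B v‖ ^ 2 ≤ 0 := by linarith
    have : ‖B v‖ = 0 := by nlinarith [norm_nonneg (B v)]
    simp [this]
  · have h2 := key ρ⁻¹
    have h3 := h1 v
    have h4 := h1 (B v)
    have h5 : (ρ⁻¹) ^ 2 * ⟪B (B v), B v⟫ ≤ ρ⁻¹ * ‖B v‖ ^ 2 := by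
      calc _ ≤ (ρ⁻¹) ^ 2 * (ρ * ‖B v‖ ^ 2) := by gcongr
        _ = _ := by field_simp
    have h6 : ρ⁻¹ * ‖B v‖ ^ 2 ≤ ρ * ‖v‖ ^ 2 := by linarith
    have h7 : ‖B v‖ ^ 2 ≤ (ρ * ‖v‖) ^ 2 := by
      have : ‖B v‖ ^ 2 = ρ * (ρ⁻¹ * ‖B v‖ ^ 2) := by field_simp
      rw [this]
      calc _ ≤ ρ * (ρ * ‖v‖ ^ 2) := by gcongr
        _ = _ := by ring
    exact abs_le_of_sq_le_sq' h7 (by positivity) |>.2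

/-! ### The deterministic bilevel problem -/

/-- The regularity of an outer function `F` and an inner function `G` used in the analysis.
Strong convexity of `G (x, ·)` is recorded through its first-order form. -/
structure BilevelRegular {d₁ d₂ : ℕ} (F G : Pt d₁ d₂ → ℝ) (lf0 lf1 lg1 lg2 mug : ℝ) : Prop where
  f_diff : Differentiable ℝ F
  f_grad_le : ∀ z, ‖gradient F z‖ ≤ lf0
  f_grad_lip : ∀ z z', ‖gradient F z - gradient F z'‖ ≤ lf1 * ‖z - z'‖
  g_diff : Differentiable ℝ G
  g_grad_diff : Differentiable ℝ (gradient G)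
  g_grad_lip : ∀ z z', ‖gradient G z - gradient G z'‖ ≤ lg1 * ‖z - z'‖
  g_hess_lip : ∀ z z', ‖hess G z - hess G z'‖ ≤ lg2 * ‖z - z'‖
  g_strong : ∀ x y y',
    G (pt x y) + ⟪gradY G (pt x y), y' - y⟫ + mug / 2 * ‖y' - y‖ ^ 2 ≤ G (pt x y')
  lf0_nonneg : 0 ≤ lf0
  lf1_pos : 0 < lf1
  lg1_pos : 0 < lg1
  lg2_nonneg : 0 ≤ lg2
  mug_pos : 0 < mug

/-- The inverse of the block `∇²_y G (z)`. -/
def invBlockY {d₁ d₂ : ℕ} (G : Pt d₁ d₂ → ℝ) (z : Pt d₁ d₂) : Vec d₂ →L[ℝ] Vec d₂ :=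
  Ring.inverse (blockY G z)

/-- The hypergradient `∇_x F - ∇²_{xy} G [∇²_y G]⁻¹ ∇_y F` as a function of `z = (x, y)`; at
`y = y*(x)` it is the gradient of the bilevel objective. -/
def hypergrad {d₁ d₂ : ℕ} (F G : Pt d₁ d₂ → ℝ) (z : Pt d₁ d₂) : Vec d₁ :=
  gradX F z - blockXY G z (invBlockY G z (gradY F z))

/-- The hypergradient with the inverse Hessian replaced by `N` terms of its Neumann series. -/
def neumannGrad {d₁ d₂ : ℕ} (F G : Pt d₁ d₂ → ℝ) (l : ℝ) (N : ℕ) (z : Pt d₁ d₂) : Vec d₁ :=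
  gradX F z - blockXY G z
    (l⁻¹ • ∑ n ∈ Finset.range N, ((1 - l⁻¹ • blockY G z) ^ n) (gradY F z))

/-- The Lipschitz constant of the hypergradient. -/
def lipHyper (lf0 lf1 lg1 lg2 mug : ℝ) : ℝ :=
  lf1 + lg2 * lf0 / mug + lg1 * lg2 * lf0 / mug ^ 2 + lg1 * lf1 / mug

/-- The constant of the second-order expansion of `y*`. -/
def quadStar (lg1 lg2 mug : ℝ) : ℝ := lg2 / mug * (1 + (lg1 / mug) ^ 2)

/-- The derivative of `y*`, for a map `ys` that plays the role of `y*`. -/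
def derivStar {d₁ d₂ : ℕ} (G : Pt d₁ d₂ → ℝ) (ys : Vec d₁ → Vec d₂) (x : Vec d₁) :
    Vec d₁ →L[ℝ] Vec d₂ :=
  -(invBlockY G (pt x (ys x)) ∘L blockYX G (pt x (ys x)))

namespace BilevelRegular

variable {d₁ d₂ : ℕ} {F G : Pt d₁ d₂ → ℝ} {lf0 lf1 lg1 lg2 mug : ℝ}
  (R : BilevelRegular F G lf0 lf1 lg1 lg2 mug)
include R

theorem grad_mono (x : Vec d₁) (y y' : Vec d₂) :
    mug * ‖y - y'‖ ^ 2 ≤ ⟪gradY G (pt x y) - gradY G (pt x y'), y - y'⟫ := by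
  have h1 := R.g_strong x y y'
  have h2 := R.g_strong x y' y
  have e : y' - y = -(y - y') := by abel
  rw [e, inner_neg_right, norm_neg] at h1
  rw [inner_sub_left]
  linarith

theorem hess_le (z : Pt d₁ d₂) : ‖hess G z‖ ≤ lg1 := by
  refine norm_fderiv_le_of_lip' ℝ R.lg1_pos.le (Filter.Eventually.of_forall fun w => ?_)
  exact R.g_grad_lip w z

theorem blockY_le (z : Pt d₁ d₂) (v : Vec d₂) : ‖blockY G z v‖ ≤ lg1 * ‖v‖ :=
  (norm_prY_le _).trans (((hess G z).le_of_opNorm_le (R.hess_le z) _).trans_eq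
    (congrArg _ (norm_inY v)))

theorem blockXY_le (z : Pt d₁ d₂) (v : Vec d₂) : ‖blockXY G z v‖ ≤ lg1 * ‖v‖ :=
  (norm_prX_le _).trans (((hess G z).le_of_opNorm_le (R.hess_le z) _).trans_eq
    (congrArg _ (norm_inY v)))

theorem blockYX_le (z : Pt d₁ d₂) (v : Vec d₁) : ‖blockYX G z v‖ ≤ lg1 * ‖v‖ :=
  (norm_prY_le _).trans (((hess G z).le_of_opNorm_le (R.hess_le z) _).trans_eq
    (congrArg _ (norm_inX v)))

theorem blockY_sub_le (z z' : Pt d₁ d₂) (v : Vec d₂) :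
    ‖blockY G z v - blockY G z' v‖ ≤ lg2 * ‖z - z'‖ * ‖v‖ := by
  have : blockY G z v - blockY G z' v = prY ((hess G z - hess G z') (inY v)) := by
    simp [blockY_apply]
  rw [this]
  exact (norm_prY_le _).trans
    ((ContinuousLinearMap.le_of_opNorm_le _ (R.g_hess_lip z z') _).trans_eq
    (by rw [norm_inY]))

theorem blockXY_sub_le (z z' : Pt d₁ d₂) (v : Vec d₂) :
    ‖blockXY G z v - blockXY G z' v‖ ≤ lg2 * ‖z - z'‖ * ‖v‖ := by
  have : blockXY G z v - blockXY G z' v = prX ((hess G z - hess G z') (inY v)) := by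
    simp [blockXY_apply]
  rw [this]
  exact (norm_prX_le _).trans
    ((ContinuousLinearMap.le_of_opNorm_le _ (R.g_hess_lip z z') _).trans_eq
    (by rw [norm_inY]))

theorem blockY_symm (z : Pt d₁ d₂) (u v : Vec d₂) : ⟪blockY G z u, v⟫ = ⟪blockY G z v, u⟫ := by
  rw [blockY_apply, blockY_apply, ← inner_inY, ← inner_inY, hess_symm R.g_diff R.g_grad_diff]

theorem blockXY_adjoint (z : Pt d₁ d₂) (u : Vec d₂) (v : Vec d₁) :
    ⟪blockXY G z u, v⟫ = ⟪blockYX G z v, u⟫ := by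
  rw [blockXY_apply, blockYX_apply, ← inner_inY, ← inner_inX, hess_symm R.g_diff R.g_grad_diff]

theorem grad_quad (z z' : Pt d₁ d₂) :
    ‖gradient G z' - gradient G z - hess G z (z' - z)‖ ≤ lg2 * ‖z' - z‖ ^ 2 :=
  norm_image_sub_sub_fderiv_le R.lg2_nonneg (fun x => (R.g_grad_diff x).hasFDerivAt) R.g_hess_lip
    z z'

theorem blockY_coercive (z : Pt d₁ d₂) (v : Vec d₂) : mug * ‖v‖ ^ 2 ≤ ⟪blockY G z v, v⟫ := by
  refine le_of_forall_pos_le_add fun ε hε => ?_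
  -- compare the gradients at `z` and `z + (0, t v)` for a small step `t`
  obtain ⟨t, ht, hte⟩ : ∃ t : ℝ, 0 < t ∧ lg2 * t * ‖v‖ ^ 3 ≤ ε := by
    refine ⟨ε / (lg2 * ‖v‖ ^ 3 + 1), by have := R.lg2_nonneg; positivity, ?_⟩
    have h0 : 0 ≤ lg2 * ‖v‖ ^ 3 := by have := R.lg2_nonneg; positivity
    have : lg2 * (ε / (lg2 * ‖v‖ ^ 3 + 1)) * ‖v‖ ^ 3
        = ε * ((lg2 * ‖v‖ ^ 3) / (lg2 * ‖v‖ ^ 3 + 1)) := by ring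
    rw [this]
    have : (lg2 * ‖v‖ ^ 3) / (lg2 * ‖v‖ ^ 3 + 1) ≤ 1 := by
      rw [div_le_one (by positivity)]; linarith
    nlinarith
  have hz : z = pt (prX z) (prY z) := by
    ext (i | i) <;> simp [pt, prX, prY, xPart, yPart]
  have hz' : z + inY (t • v) = pt (prX z) (prY z + t • v) := by
    conv_lhs => rw [hz]
    rw [pt_eq, pt_eq, map_add, add_assoc]
  have h1 := R.grad_mono (prX z) (prY z + t • v) (prY z)
  rw [← hz, ← hz', gradY_eq, gradY_eq, add_sub_cancel_left, inner_smul_right, norm_smul,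
    Real.norm_of_nonneg ht.le] at h1
  have h2 := R.grad_quad z (z + inY (t • v))
  rw [add_sub_cancel_left, norm_inY, norm_smul, Real.norm_of_nonneg ht.le] at h2
  set r := gradient G (z + inY (t • v)) - gradient G z - hess G z (inY (t • v)) with hr
  have h3 : prY (gradient G (z + inY (t • v))) - prY (gradient G z) = prY r + t • blockY G z v := by
    simp only [hr, map_sub, map_smul, blockY_apply]; abel
  rw [h3, inner_add_left, inner_smul_left, RCLike.conj_to_real] at h1
  have h4 : ⟪prY r, v⟫ ≤ lg2 * (t * ‖v‖) ^ 2 * ‖v‖ :=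
    (real_inner_le_norm _ _).trans (by gcongr; exact (norm_prY_le _).trans h2)
  have h5 : t ^ 2 * (mug * ‖v‖ ^ 2) ≤ t ^ 2 * (⟪blockY G z v, v⟫ + lg2 * t * ‖v‖ ^ 3) := by
    nlinarith
  have h6 := le_of_mul_le_mul_left h5 (by positivity)
  linarith

theorem isUnit_blockY (z : Pt d₁ d₂) : IsUnit (blockY G z) := by
  have hinj : Function.Injective (blockY G z).toLinearMap := by
    rw [← LinearMap.ker_eq_bot, LinearMap.ker_eq_bot']
    intro v hv
    have hv' : blockY G z v = 0 := hv
    have h := R.blockY_coercive z v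
    rw [hv', inner_zero_left] at h
    have : ‖v‖ ^ 2 ≤ 0 := by
      have := R.mug_pos
      by_contra hc
      nlinarith [mul_pos this (not_le.1 hc)]
    simpa using le_antisymm this (sq_nonneg _)
  let e := (LinearEquiv.ofInjectiveEndo _ hinj).toContinuousLinearEquiv
  have : blockY G z = (e : Vec d₂ →L[ℝ] Vec d₂) := by ext v; rfl
  rw [this]
  exact (ContinuousLinearEquiv.toUnit e).isUnit

theorem blockY_inv (z : Pt d₁ d₂) (v : Vec d₂) : blockY G z (invBlockY G z v) = v := by
  have h := Ring.mul_inverse_cancel _ (R.isUnit_blockY z)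
  exact congrArg (fun A : Vec d₂ →L[ℝ] Vec d₂ => A v) h

theorem inv_blockY (z : Pt d₁ d₂) (v : Vec d₂) : invBlockY G z (blockY G z v) = v := by
  have h := Ring.inverse_mul_cancel _ (R.isUnit_blockY z)
  exact congrArg (fun A : Vec d₂ →L[ℝ] Vec d₂ => A v) h

theorem norm_le_blockY (z : Pt d₁ d₂) (v : Vec d₂) : mug * ‖v‖ ≤ ‖blockY G z v‖ := by
  have h1 := R.blockY_coercive z v
  have h2 := real_inner_le_norm (blockY G z v) v
  rcases (norm_nonneg v).eq_or_lt with h | h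
  · rw [← h, mul_zero]; positivity
  · refine le_of_mul_le_mul_right ?_ h
    nlinarith

theorem invBlockY_le (z : Pt d₁ d₂) (v : Vec d₂) : ‖invBlockY G z v‖ ≤ ‖v‖ / mug := by
  rw [le_div_iff₀ R.mug_pos, mul_comm]
  simpa [R.blockY_inv] using R.norm_le_blockY z (invBlockY G z v)

theorem invBlockY_symm (z : Pt d₁ d₂) (u v : Vec d₂) :
    ⟪invBlockY G z u, v⟫ = ⟪invBlockY G z v, u⟫ := by
  conv_lhs => rw [← R.blockY_inv z v, real_inner_comm, R.blockY_symm, R.blockY_inv, real_inner_comm]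

theorem invBlockY_sub_le (z z' : Pt d₁ d₂) (v : Vec d₂) :
    ‖invBlockY G z v - invBlockY G z' v‖ ≤ lg2 * ‖z - z'‖ * ‖v‖ / mug ^ 2 := by
  have e : invBlockY G z v - invBlockY G z' v
      = -invBlockY G z (blockY G z (invBlockY G z' v) - blockY G z' (invBlockY G z' v)) := by
    rw [map_sub, R.inv_blockY, R.blockY_inv]; abel
  have := R.lg2_nonneg
  have := R.mug_pos
  rw [e, norm_neg]
  calc _ ≤ lg2 * ‖z - z'‖ * (‖v‖ / mug) / mug := by
        refine (R.invBlockY_le z _).trans ?_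
        gcongr
        refine (R.blockY_sub_le z z' _).trans ?_
        gcongr
        exact R.invBlockY_le z' v
    _ = _ := by field_simp

theorem gradY_le (z : Pt d₁ d₂) : ‖gradY F z‖ ≤ lf0 := (norm_prY_le _).trans (R.f_grad_le z)

theorem gradX_le (z : Pt d₁ d₂) : ‖gradX F z‖ ≤ lf0 := (norm_prX_le _).trans (R.f_grad_le z)

theorem hypergrad_le (z : Pt d₁ d₂) : ‖hypergrad F G z‖ ≤ lf0 + lg1 * (lf0 / mug) := by
  have := R.lg1_pos
  have := R.mug_pos
  refine (norm_sub_le _ _).trans (add_le_add (R.gradX_le z) ?_)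
  refine (R.blockXY_le z _).trans ?_
  gcongr
  refine (R.invBlockY_le z _).trans ?_
  gcongr
  exact R.gradY_le z

theorem lipHyper_nonneg : 0 ≤ lipHyper lf0 lf1 lg1 lg2 mug := by
  have := R.lg1_pos
  have := R.mug_pos
  have := R.lf1_pos
  have := R.lf0_nonneg
  have := R.lg2_nonneg
  unfold lipHyper
  positivity

theorem hypergrad_lip (z z' : Pt d₁ d₂) :
    ‖hypergrad F G z - hypergrad F G z'‖ ≤ lipHyper lf0 lf1 lg1 lg2 mug * ‖z - z'‖ := by
  have := R.lg1_pos
  have := R.mug_pos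
  have := R.lf1_pos
  have := R.lf0_nonneg
  have := R.lg2_nonneg
  have e : hypergrad F G z - hypergrad F G z' =
      prX (gradient F z - gradient F z')
      - (blockXY G z (invBlockY G z (gradY F z)) - blockXY G z' (invBlockY G z (gradY F z)))
      - blockXY G z' (invBlockY G z (gradY F z) - invBlockY G z' (gradY F z))
      - blockXY G z' (invBlockY G z' (prY (gradient F z - gradient F z'))) := by
    simp only [hypergrad, map_sub, gradX_eq, gradY_eq]; abel
  have h1 : ‖prX (gradient F z - gradient F z')‖ ≤ lf1 * ‖z - z'‖ :=
    (norm_prX_le _).trans (R.f_grad_lip z z')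
  have h2 : ‖blockXY G z (invBlockY G z (gradY F z)) - blockXY G z' (invBlockY G z (gradY F z))‖
      ≤ lg2 * ‖z - z'‖ * (lf0 / mug) := by
    refine (R.blockXY_sub_le z z' _).trans ?_
    gcongr
    refine (R.invBlockY_le z _).trans ?_
    gcongr
    exact R.gradY_le z
  have h3 : ‖blockXY G z' (invBlockY G z (gradY F z) - invBlockY G z' (gradY F z))‖
      ≤ lg1 * (lg2 * ‖z - z'‖ * lf0 / mug ^ 2) := by
    refine (R.blockXY_le z' _).trans ?_
    gcongr
    refine (R.invBlockY_sub_le z z' _).trans ?_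
    gcongr
    exact R.gradY_le z
  have h4 : ‖blockXY G z' (invBlockY G z' (prY (gradient F z - gradient F z')))‖
      ≤ lg1 * (lf1 * ‖z - z'‖ / mug) := by
    refine (R.blockXY_le z' _).trans ?_
    gcongr
    refine (R.invBlockY_le z' _).trans ?_
    gcongr
    exact (norm_prY_le _).trans (R.f_grad_lip z z')
  rw [e]
  calc _ ≤ lf1 * ‖z - z'‖ + lg2 * ‖z - z'‖ * (lf0 / mug)
        + lg1 * (lg2 * ‖z - z'‖ * lf0 / mug ^ 2) + lg1 * (lf1 * ‖z - z'‖ / mug) :=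
      (norm_sub_le _ _).trans (add_le_add ((norm_sub_le _ _).trans
        (add_le_add ((norm_sub_le _ _).trans (add_le_add h1 h2)) h3)) h4)
    _ = _ := by unfold lipHyper; ring

/-! ### The minimizer of the inner problem -/

theorem exists_forall_le (x : Vec d₁) : ∃ y, ∀ y', G (pt x y) ≤ G (pt x y') := by
  have hc : Continuous fun y => G (pt x y) := by
    simp only [pt_eq]
    exact R.g_diff.continuous.comp (by fun_prop)
  refine hc.exists_forall_le ?_
  have hμ := R.mug_pos
  -- strong convexity at `0` gives a quadratic lower bound
  set c := ‖gradY G (pt x 0)‖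
  have hlow : ∀ y, G (pt x 0) + ‖y‖ * (mug / 2 * ‖y‖ - c) ≤ G (pt x y) := by
    intro y
    have h := R.g_strong x 0 y
    rw [sub_zero] at h
    have h2 : -(c * ‖y‖) ≤ ⟪gradY G (pt x 0), y⟫ :=
      (abs_le.1 (abs_real_inner_le_norm _ _)).1
    nlinarith
  refine Filter.tendsto_atTop_mono hlow ?_
  refine Filter.tendsto_atTop_add_const_left _ _ ?_
  have hn := tendsto_norm_cocompact_atTop (E := Vec d₂)
  refine hn.atTop_mul_atTop₀ ?_
  exact Filter.tendsto_atTop_add_const_right _ (-c) (hn.const_mul_atTop (by positivity))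

omit R in
theorem _root_.hasGradientAt_pt_right {φ : Pt d₁ d₂ → ℝ} (hφ : Differentiable ℝ φ) (x : Vec d₁)
    (y : Vec d₂) : HasGradientAt (fun y => φ (pt x y)) (gradY φ (pt x y)) y := by
  have h1 : HasFDerivAt (fun y : Vec d₂ => (pt x y : Pt d₁ d₂)) inY y := by
    simp only [pt_eq]
    exact inY.hasFDerivAt.const_add (inX x)
  have h2 := (hφ (pt x y)).hasGradientAt.hasFDerivAt.comp y h1
  rw [hasGradientAt_iff_hasFDerivAt]
  refine h2.congr_fderiv ?_
  ext v
  simp only [ContinuousLinearMap.comp_apply, InnerProductSpace.toDual_apply_apply, gradY_eq,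
    inner_inY]

theorem gradY_eq_zero {x : Vec d₁} {y : Vec d₂} (hy : ∀ y', G (pt x y) ≤ G (pt x y')) :
    gradY G (pt x y) = 0 := by
  have h1 : IsLocalMin (fun y => G (pt x y)) y := Filter.Eventually.of_forall hy
  have h2 := h1.hasFDerivAt_eq_zero (hasGradientAt_pt_right R.g_diff x y).hasFDerivAt
  simpa using h2

section Star

variable {ys : Vec d₁ → Vec d₂} (hys : ∀ x, gradY G (pt x (ys x)) = 0)
include hys

/-- Strong monotonicity of `∇_y G (x, ·)` at the two stationary points bounds the distance between
them by the change of `∇_y G` in `x`. -/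
theorem star_lip (x x' : Vec d₁) : ‖ys x - ys x'‖ ≤ lg1 / mug * ‖x - x'‖ := by
  have h1 := R.grad_mono x (ys x) (ys x')
  have e : gradY G (pt x (ys x)) - gradY G (pt x (ys x'))
      = prY (gradient G (pt x' (ys x')) - gradient G (pt x (ys x'))) := by
    rw [map_sub, ← gradY_eq, ← gradY_eq, hys, hys]
  have h2 : ‖gradY G (pt x (ys x)) - gradY G (pt x (ys x'))‖ ≤ lg1 * ‖x - x'‖ := by
    rw [e]
    refine (norm_prY_le _).trans ((R.g_grad_lip _ _).trans_eq ?_)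
    rw [pt_sub_pt, sub_self, norm_pt_zero_right, norm_sub_rev]
  have h3 := real_inner_le_norm (gradY G (pt x (ys x)) - gradY G (pt x (ys x'))) (ys x - ys x')
  have hμ := R.mug_pos
  rw [div_mul_eq_mul_div, le_div_iff₀ hμ]
  rcases (norm_nonneg (ys x - ys x')).eq_or_lt with h | h
  · rw [← h, zero_mul]; have := R.lg1_pos; positivity
  · refine le_of_mul_le_mul_right ?_ h
    nlinarith

omit hys in
theorem derivStar_le (x v : Vec d₁) : ‖derivStar G ys x v‖ ≤ lg1 / mug * ‖v‖ := by
  have hμ := R.mug_pos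
  change ‖-(invBlockY G (pt x (ys x)) (blockYX G (pt x (ys x)) v))‖ ≤ _
  rw [norm_neg]
  refine (R.invBlockY_le _ _).trans ?_
  rw [div_mul_eq_mul_div]
  gcongr
  exact R.blockYX_le _ _

/-- The second-order expansion of `y*`. It makes the first-order movement of `y*` linear in the
outer step, so that only the conditional mean of the step matters at first order. -/
theorem star_quad (x x' : Vec d₁) :
    ‖ys x' - ys x - derivStar G ys x (x' - x)‖ ≤ quadStar lg1 lg2 mug * ‖x' - x‖ ^ 2 := by
  set z := pt x (ys x) with hz
  set z' := pt x' (ys x') with hz'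
  have hμ := R.mug_pos
  have hl2 := R.lg2_nonneg
  have h1 := R.grad_quad z z'
  set r := gradient G z' - gradient G z - hess G z (z' - z) with hr
  have hd : z' - z = inX (x' - x) + inY (ys x' - ys x) := by
    rw [hz, hz', pt_sub_pt, pt_eq]
  have h2 : prY r = -(blockYX G z (x' - x) + blockY G z (ys x' - ys x)) := by
    rw [hr, map_sub, map_sub, ← gradY_eq, ← gradY_eq, hys, hys, hd, map_add, map_add,
      blockYX_apply, blockY_apply]
    abel
  have h3 : ys x' - ys x - derivStar G ys x (x' - x) = -invBlockY G z (prY r) := by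
    rw [h2, map_neg, map_add, R.inv_blockY]
    change _ - (-(invBlockY G z (blockYX G z (x' - x)))) = _
    abel
  have h4 : ‖z' - z‖ ^ 2 ≤ (1 + (lg1 / mug) ^ 2) * ‖x' - x‖ ^ 2 := by
    rw [hz, hz', pt_sub_pt, norm_pt_sq, add_mul, one_mul, ← mul_pow]
    gcongr
    exact R.star_lip hys x' x
  rw [h3, norm_neg]
  calc _ ≤ ‖prY r‖ / mug := R.invBlockY_le _ _
    _ ≤ lg2 * ((1 + (lg1 / mug) ^ 2) * ‖x' - x‖ ^ 2) / mug := by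
        gcongr
        exact (norm_prY_le _).trans (h1.trans (by gcongr))
    _ = _ := by unfold quadStar; ring

theorem hasFDerivAt_star (x : Vec d₁) : HasFDerivAt ys (derivStar G ys x) x := by
  refine HasFDerivAt.of_isLittleO ?_
  refine Asymptotics.IsBigO.trans_isLittleO (g := fun x' => ‖x' - x‖ ^ 2) ?_ ?_
  · refine Asymptotics.IsBigO.of_bound (quadStar lg1 lg2 mug) (Filter.Eventually.of_forall ?_)
    intro x'
    simpa using R.star_quad hys x x'
  · exact Asymptotics.isLittleO_pow_sub_sub x one_lt_two

/-- The implicit gradient formula. -/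
theorem hasGradientAt_obj (x : Vec d₁) :
    HasGradientAt (fun x => F (pt x (ys x))) (hypergrad F G (pt x (ys x))) x := by
  have h1 : HasFDerivAt (fun x => (pt x (ys x) : Pt d₁ d₂)) (inX + inY ∘L derivStar G ys x) x := by
    simp only [pt_eq]
    exact inX.hasFDerivAt.add (inY.hasFDerivAt.comp x (R.hasFDerivAt_star hys x))
  have h2 := HasFDerivAt.comp x (R.f_diff (pt x (ys x))).hasGradientAt.hasFDerivAt h1
  rw [hasGradientAt_iff_hasFDerivAt]
  refine h2.congr_fderiv ?_
  ext v
  simp only [ContinuousLinearMap.comp_apply, InnerProductSpace.toDual_apply_apply, hypergrad,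
    add_apply, inner_add_right, inner_inY, inner_inX, inner_sub_left,
    ← gradX_eq, ← gradY_eq]
  rw [R.blockXY_adjoint, derivStar, neg_apply, inner_neg_right,
    ContinuousLinearMap.comp_apply, real_inner_comm (invBlockY G _ (gradY F _)), R.invBlockY_symm,
    real_inner_comm (gradY F _), sub_eq_add_neg]

theorem gradient_obj (x : Vec d₁) :
    gradient (fun x => F (pt x (ys x))) x = hypergrad F G (pt x (ys x)) :=
  (R.hasGradientAt_obj hys x).gradient

omit hys in
theorem norm_hypergrad_sub_gradient_le (x : Vec d₁) (y : Vec d₂) :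
    ‖hypergrad F G (pt x y) - hypergrad F G (pt x (ys x))‖
      ≤ lipHyper lf0 lf1 lg1 lg2 mug * ‖y - ys x‖ := by
  refine (R.hypergrad_lip _ _).trans_eq ?_
  rw [pt_sub_pt, sub_self, norm_pt_zero_left]

theorem hypergrad_star_lip (x x' : Vec d₁) :
    ‖hypergrad F G (pt x (ys x)) - hypergrad F G (pt x' (ys x'))‖
      ≤ lipHyper lf0 lf1 lg1 lg2 mug * (1 + lg1 / mug) * ‖x - x'‖ := by
  have := R.lg1_pos
  have := R.mug_pos
  have := R.lipHyper_nonneg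
  refine (R.hypergrad_lip _ _).trans ?_
  rw [mul_assoc]
  gcongr
  rw [pt_sub_pt, pt_eq, add_mul, one_mul]
  refine (norm_add_le _ _).trans ?_
  rw [norm_inX, norm_inY]
  gcongr
  exact R.star_lip hys x x'

/-- The descent inequality for the bilevel objective. -/
theorem obj_le (x x' : Vec d₁) :
    F (pt x' (ys x')) ≤ F (pt x (ys x)) + ⟪hypergrad F G (pt x (ys x)), x' - x⟫
      + lipHyper lf0 lf1 lg1 lg2 mug * (1 + lg1 / mug) * ‖x' - x‖ ^ 2 := by
  have := R.lg1_pos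
  have := R.mug_pos
  have := R.lipHyper_nonneg
  have h := norm_image_sub_sub_fderiv_le (f := fun x => F (pt x (ys x)))
    (f' := fun x => InnerProductSpace.toDual ℝ _ (hypergrad F G (pt x (ys x))))
    (L := lipHyper lf0 lf1 lg1 lg2 mug * (1 + lg1 / mug)) (by positivity)
    (fun x => (R.hasGradientAt_obj hys x).hasFDerivAt) (fun x x' => by
      rw [← map_sub, LinearIsometryEquiv.norm_map]
      exact R.hypergrad_star_lip hys x x') x x'
  have h' := (le_abs_self _).trans h
  rw [InnerProductSpace.toDual_apply_apply] at h'
  linarith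

theorem obj_lip (x x' : Vec d₁) :
    |F (pt x (ys x)) - F (pt x' (ys x'))| ≤ (lf0 + lg1 * (lf0 / mug)) * ‖x - x'‖ := by
  have h := Convex.norm_image_sub_le_of_norm_hasFDerivWithin_le (𝕜 := ℝ)
    (f := fun x => F (pt x (ys x)))
    (f' := fun x => InnerProductSpace.toDual ℝ _ (hypergrad F G (pt x (ys x))))
    (s := Set.univ) (x := x') (y := x) (C := lf0 + lg1 * (lf0 / mug))
    (fun x _ => (R.hasGradientAt_obj hys x).hasFDerivAt.hasFDerivWithinAt)
    (fun x _ => by rw [LinearIsometryEquiv.norm_map]; exact R.hypergrad_le _)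
    convex_univ (Set.mem_univ _) (Set.mem_univ _)
  exact h

end Star

/-! ### The Neumann series -/

/-- `I - ∇²_y G / ℓ` has spectrum in `[0, 1 - μ / ℓ]`. -/
theorem norm_one_sub_blockY_le (z : Pt d₁ d₂) (v : Vec d₂) :
    ‖(1 - lg1⁻¹ • blockY G z) v‖ ≤ |1 - mug / lg1| * ‖v‖ := by
  have hl := R.lg1_pos
  have hμ := R.mug_pos
  have hform : ∀ v, ⟪(1 - lg1⁻¹ • blockY G z) v, v⟫ = ‖v‖ ^ 2 - lg1⁻¹ * ⟪blockY G z v, v⟫ := by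
    intro v
    simp [inner_sub_left, inner_smul_left]
  have hup : ∀ v, ⟪blockY G z v, v⟫ ≤ lg1 * ‖v‖ ^ 2 := fun v =>
    (real_inner_le_norm _ _).trans (by nlinarith [R.blockY_le z v, norm_nonneg v])
  have h0 : ∀ v, 0 ≤ ⟪(1 - lg1⁻¹ • blockY G z) v, v⟫ := by
    intro v
    rw [hform, sub_nonneg, inv_mul_le_iff₀ hl]
    exact hup v
  have h1 : ∀ v, ⟪(1 - lg1⁻¹ • blockY G z) v, v⟫ ≤ (1 - mug / lg1) * ‖v‖ ^ 2 := by
    intro v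
    rw [hform]
    have : lg1⁻¹ * (mug * ‖v‖ ^ 2) ≤ lg1⁻¹ * ⟪blockY G z v, v⟫ := by
      gcongr; exact R.blockY_coercive z v
    have e : (1 - mug / lg1) * ‖v‖ ^ 2 = ‖v‖ ^ 2 - lg1⁻¹ * (mug * ‖v‖ ^ 2) := by
      rw [div_eq_inv_mul]; ring
    linarith
  -- `mug ≤ lg1` unless the space is trivial, so the sign of `1 - mug / lg1` matters only there
  by_cases hv : v = 0
  · simp [hv]
  · have hρ : 0 ≤ 1 - mug / lg1 := by
      have h2 := (h0 v).trans (h1 v)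
      have h3 : 0 < ‖v‖ ^ 2 := by positivity
      by_contra hc
      nlinarith [mul_pos_of_neg_of_neg (not_le.1 hc) (neg_neg_of_pos h3)]
    rw [abs_of_nonneg hρ]
    refine norm_apply_le_of_symm (fun u v => ?_) h0 h1 hρ v
    simp only [sub_apply, one_apply_eq_self,
      smul_apply, inner_sub_left, inner_smul_left, R.blockY_symm z u v,
      real_inner_comm]

theorem norm_one_sub_blockY_pow_le (z : Pt d₁ d₂) (n : ℕ) (v : Vec d₂) :
    ‖((1 - lg1⁻¹ • blockY G z) ^ n) v‖ ≤ |1 - mug / lg1| ^ n * ‖v‖ := by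
  induction n with
  | zero => simp
  | succ n ih =>
    rw [pow_succ', pow_succ', mul_apply_eq_comp]
    refine (R.norm_one_sub_blockY_le z _).trans ?_
    rw [mul_assoc]
    gcongr

/-- The remainder of the Neumann series of the inverse Hessian, in closed form. -/
theorem neumann_error (z : Pt d₁ d₂) (N : ℕ) (v : Vec d₂) :
    lg1⁻¹ • ∑ n ∈ Finset.range N, ((1 - lg1⁻¹ • blockY G z) ^ n) v - invBlockY G z v
      = -((1 - lg1⁻¹ • blockY G z) ^ N) (invBlockY G z v) := by
  have h := mul_neg_geom_sum (1 - lg1⁻¹ • blockY G z) N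
  have h' : (1 - (1 - lg1⁻¹ • blockY G z)) = lg1⁻¹ • blockY G z := by abel
  rw [h'] at h
  -- the partial sums commute with the Hessian block, which cancels its inverse
  have hc : (lg1⁻¹ • blockY G z) * ∑ i ∈ Finset.range N, (1 - lg1⁻¹ • blockY G z) ^ i
      = (∑ i ∈ Finset.range N, (1 - lg1⁻¹ • blockY G z) ^ i) * (lg1⁻¹ • blockY G z) := by
    refine Commute.sum_right _ _ _ fun i _ => Commute.pow_right ?_ i
    exact Commute.sub_right (Commute.one_right _) (Commute.refl _)
  rw [hc] at h
  have h2 := congrArg (fun A : Vec d₂ →L[ℝ] Vec d₂ => A (invBlockY G z v)) h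
  simp only [mul_apply_eq_comp, smul_apply, R.blockY_inv, map_smul,
    sub_apply, one_apply_eq_self,
    sum_apply] at h2
  rw [h2]
  abel

theorem norm_neumannGrad_sub_le (z : Pt d₁ d₂) (N : ℕ) :
    ‖neumannGrad F G lg1 N z - hypergrad F G z‖
      ≤ lg1 / mug * lf0 * |1 - mug / lg1| ^ N := by
  have hl := R.lg1_pos
  have hμ := R.mug_pos
  have e : neumannGrad F G lg1 N z - hypergrad F G z = -blockXY G z
      (lg1⁻¹ • ∑ n ∈ Finset.range N, ((1 - lg1⁻¹ • blockY G z) ^ n) (gradY F z)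
        - invBlockY G z (gradY F z)) := by
    rw [map_sub, neumannGrad, hypergrad]; abel
  rw [e, norm_neg, R.neumann_error]
  calc _ ≤ lg1 * (|1 - mug / lg1| ^ N * (lf0 / mug)) := by
        refine (R.blockXY_le z _).trans ?_
        gcongr
        rw [norm_neg]
        refine (R.norm_one_sub_blockY_pow_le z N _).trans ?_
        gcongr
        refine (R.invBlockY_le z _).trans ?_
        gcongr
        exact R.gradY_le z
    _ = _ := by ring

/-- The truncation error of the Neumann series is the source of the bias `b` in the rate. -/
theorem norm_neumannGrad_sub_sq_le (z : Pt d₁ d₂) (N : ℕ) :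
    ‖neumannGrad F G lg1 N z - hypergrad F G z‖ ^ 2
      ≤ (lf0 / lf1 * neumannBias lf1 lg1 mug N) ^ 2 := by
  have hl := R.lg1_pos
  have hμ := R.mug_pos
  have hf := R.lf1_pos
  have h0 := R.lf0_nonneg
  have e : lf0 / lf1 * neumannBias lf1 lg1 mug N = lg1 / mug * lf0 * (1 - mug / lg1) ^ N := by
    have : (lg1 / mug - 1) / (lg1 / mug) = 1 - mug / lg1 := by field_simp
    rw [neumannBias, this]
    field_simp
  rw [e, ← sq_abs (lg1 / mug * lf0 * _), abs_mul, abs_pow, abs_of_nonneg (by positivity)]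
  gcongr
  exact R.norm_neumannGrad_sub_le z N

/-! ### Continuity -/

omit R in
theorem _root_.continuous_of_norm_sub_le {E F : Type*} [NormedAddCommGroup E]
    [NormedAddCommGroup F] {f : E → F} {L : ℝ} (h : ∀ x y, ‖f x - f y‖ ≤ L * ‖x - y‖) :
    Continuous f :=
  (LipschitzWith.of_dist_le_mul (K := L.toNNReal) fun x y => by
    rw [dist_eq_norm, dist_eq_norm]
    exact (h x y).trans (mul_le_mul_of_nonneg_right (Real.le_coe_toNNReal L)
      (norm_nonneg _))).continuous

theorem continuous_gradF : Continuous (gradient F) := continuous_of_norm_sub_le R.f_grad_lip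

theorem continuous_gradG : Continuous (gradient G) := continuous_of_norm_sub_le R.g_grad_lip

theorem continuous_hess : Continuous (hess G) := continuous_of_norm_sub_le R.g_hess_lip

theorem continuous_blockY : Continuous (blockY G) :=
  continuous_const.clm_comp (R.continuous_hess.clm_comp continuous_const)

theorem continuous_blockXY : Continuous (blockXY G) :=
  continuous_const.clm_comp (R.continuous_hess.clm_comp continuous_const)

theorem continuous_blockYX : Continuous (blockYX G) :=
  continuous_const.clm_comp (R.continuous_hess.clm_comp continuous_const)

theorem continuous_invBlockY : Continuous (invBlockY G) :=
  continuous_of_norm_sub_le (L := lg2 / mug ^ 2) fun z z' => by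
    have := R.lg2_nonneg
    refine ContinuousLinearMap.opNorm_le_bound _ (by positivity) fun v => ?_
    exact (R.invBlockY_sub_le z z' v).trans_eq (by ring)

theorem continuous_hypergrad : Continuous (hypergrad F G) :=
  continuous_of_norm_sub_le R.hypergrad_lip

theorem continuous_star {ys : Vec d₁ → Vec d₂} (hys : ∀ x, gradY G (pt x (ys x)) = 0) :
    Continuous ys := continuous_of_norm_sub_le (R.star_lip hys)

end BilevelRegular

/-! ### Averaging over the clients -/

section Average

variable {m : ℕ} {E : Type*} [NormedAddCommGroup E] [NormedSpace ℝ E]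

theorem norm_avg_le (hm : 0 < m) {v : Fin m → E} {c : ℝ} (h : ∀ i, ‖v i‖ ≤ c) :
    ‖(m : ℝ)⁻¹ • ∑ i, v i‖ ≤ c := by
  have hm' : (0 : ℝ) < m := by exact_mod_cast hm
  rw [norm_smul, Real.norm_of_nonneg (by positivity), inv_mul_le_iff₀ hm']
  refine (norm_sum_le _ _).trans ((Finset.sum_le_sum fun i _ => h i).trans_eq ?_)
  simp

theorem norm_avg_sub_avg_le (hm : 0 < m) {v w : Fin m → E} {c : ℝ} (h : ∀ i, ‖v i - w i‖ ≤ c) :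
    ‖(m : ℝ)⁻¹ • ∑ i, v i - (m : ℝ)⁻¹ • ∑ i, w i‖ ≤ c := by
  rw [← smul_sub, ← Finset.sum_sub_distrib]
  exact norm_avg_le hm h

theorem avg_const (hm : 0 < m) (v : E) : (m : ℝ)⁻¹ • ∑ _i : Fin m, v = v := by
  have hm' : (m : ℝ) ≠ 0 := by exact_mod_cast hm.ne'
  rw [Finset.sum_const, Finset.card_univ, Fintype.card_fin, ← Nat.cast_smul_eq_nsmul ℝ, smul_smul,
    inv_mul_cancel₀ hm', one_smul]

end Average

namespace FedProblem

variable {m d₁ d₂ : ℕ} {Ξ Ζ : Type*} [MeasurableSpace Ξ] [MeasurableSpace Ζ]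
variable (P : FedProblem m d₁ d₂ Ξ Ζ)

/-- The average `(1/m) ∑ᵢ f_i` of the outer functions. -/
def outerAvg (z : Pt d₁ d₂) : ℝ := (m : ℝ)⁻¹ * ∑ i, P.outerFun i z

/-- The average `(1/m) ∑ᵢ g_i` of the inner functions. -/
def innerAvg (z : Pt d₁ d₂) : ℝ := (m : ℝ)⁻¹ * ∑ i, P.innerFun i z

theorem hasGradientAt_avg {φ : Fin m → Pt d₁ d₂ → ℝ} (h : ∀ i, Differentiable ℝ (φ i))
    (z : Pt d₁ d₂) : HasGradientAt (fun z => (m : ℝ)⁻¹ * ∑ i, φ i z)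
      ((m : ℝ)⁻¹ • ∑ i, gradient (φ i) z) z := by
  rw [hasGradientAt_iff_hasFDerivAt, map_smul, map_sum]
  exact (HasFDerivAt.fun_sum fun i _ => (h i z).hasGradientAt.hasFDerivAt).const_mul _

theorem gradient_avg {φ : Fin m → Pt d₁ d₂ → ℝ} (h : ∀ i, Differentiable ℝ (φ i)) :
    gradient (fun z => (m : ℝ)⁻¹ * ∑ i, φ i z) = fun z => (m : ℝ)⁻¹ • ∑ i, gradient (φ i) z :=
  funext fun z => (hasGradientAt_avg h z).gradient

theorem hess_avg {φ : Fin m → Pt d₁ d₂ → ℝ} (h : ∀ i, Differentiable ℝ (φ i))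
    (h' : ∀ i, Differentiable ℝ (gradient (φ i))) (z : Pt d₁ d₂) :
    hess (fun z => (m : ℝ)⁻¹ * ∑ i, φ i z) z = (m : ℝ)⁻¹ • ∑ i, hess (φ i) z := by
  rw [hess, gradient_avg h]
  exact ((HasFDerivAt.fun_sum fun i _ => (h' i z).hasFDerivAt).const_smul (m : ℝ)⁻¹).fderiv

variable {P} {lf0 lf1 lg1 lg2 mug : ℝ} (hP : P.WellBehaved lf0 lf1 lg1 lg2 mug)
include hP

theorem WellBehaved.outer_grad_le (hlf0 : 0 ≤ lf0) (i : Fin m) (z : Pt d₁ d₂) :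
    ‖gradient (P.outerFun i) z‖ ≤ lf0 := by
  rw [gradient, LinearIsometryEquiv.norm_map]
  exact norm_fderiv_le_of_lip' ℝ hlf0 (Filter.Eventually.of_forall fun w => hP.f_lip i w z)

theorem WellBehaved.inner_hess_le (hlg1 : 0 ≤ lg1) (i : Fin m) (z : Pt d₁ d₂) :
    ‖hess (P.innerFun i) z‖ ≤ lg1 :=
  norm_fderiv_le_of_lip' ℝ hlg1 (Filter.Eventually.of_forall fun w => hP.g_grad_lip i w z)

theorem WellBehaved.gradient_outerAvg (z : Pt d₁ d₂) :
    gradient P.outerAvg z = (m : ℝ)⁻¹ • ∑ i, gradient (P.outerFun i) z :=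
  (hasGradientAt_avg hP.f_diff z).gradient

theorem WellBehaved.gradient_innerAvg (z : Pt d₁ d₂) :
    gradient P.innerAvg z = (m : ℝ)⁻¹ • ∑ i, gradient (P.innerFun i) z :=
  (hasGradientAt_avg hP.g_diff z).gradient

theorem WellBehaved.hess_innerAvg (z : Pt d₁ d₂) :
    hess P.innerAvg z = (m : ℝ)⁻¹ • ∑ i, hess (P.innerFun i) z :=
  hess_avg hP.g_diff hP.g_grad_diff z

theorem WellBehaved.bilevelRegular (hm : 0 < m) (hlf0 : 0 ≤ lf0) (hlf1 : 0 < lf1) (hlg1 : 0 < lg1)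
    (hlg2 : 0 ≤ lg2) (hmug : 0 < mug) :
    BilevelRegular P.outerAvg P.innerAvg lf0 lf1 lg1 lg2 mug where
  f_diff z := (hasGradientAt_avg hP.f_diff z).differentiableAt
  f_grad_le z := by
    rw [hP.gradient_outerAvg]
    exact norm_avg_le hm fun i => hP.outer_grad_le hlf0 i z
  f_grad_lip z z' := by
    rw [hP.gradient_outerAvg, hP.gradient_outerAvg]
    exact norm_avg_sub_avg_le hm fun i => hP.f_grad_lip i z z'
  g_diff z := (hasGradientAt_avg hP.g_diff z).differentiableAt
  g_grad_diff := by
    have : gradient P.innerAvg = fun z => (m : ℝ)⁻¹ • ∑ i, gradient (P.innerFun i) z :=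
      funext hP.gradient_innerAvg
    rw [this]
    exact (Differentiable.fun_sum fun i _ => hP.g_grad_diff i).const_smul (m : ℝ)⁻¹
  g_grad_lip z z' := by
    rw [hP.gradient_innerAvg, hP.gradient_innerAvg]
    exact norm_avg_sub_avg_le hm fun i => hP.g_grad_lip i z z'
  g_hess_lip z z' := by
    rw [hP.hess_innerAvg, hP.hess_innerAvg]
    exact norm_avg_sub_avg_le hm fun i => hP.g_hess_lip i z z'
  g_strong x y y' := by
    have h : ∀ i, P.innerFun i (pt x y) + ⟪gradY (P.innerFun i) (pt x y), y' - y⟫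
        + mug / 2 * ‖y' - y‖ ^ 2 ≤ P.innerFun i (pt x y') := fun i =>
      (hP.g_strong i x).add_inner_gradient_le (hasGradientAt_pt_right (hP.g_diff i) x y) y'
    have hm' : (0 : ℝ) < m := by exact_mod_cast hm
    have hs := mul_le_mul_of_nonneg_left (Finset.sum_le_sum fun i (_ : i ∈ Finset.univ) => h i)
      (inv_nonneg.2 hm'.le)
    have e : gradY P.innerAvg (pt x y) = (m : ℝ)⁻¹ • ∑ i, gradY (P.innerFun i) (pt x y) := by
      rw [gradY_eq, hP.gradient_innerAvg, map_smul, map_sum]; rfl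
    have e2 : (m : ℝ)⁻¹ * (m * (mug / 2 * ‖y' - y‖ ^ 2)) = mug / 2 * ‖y' - y‖ ^ 2 := by
      field_simp
    rw [Finset.sum_add_distrib, Finset.sum_add_distrib, mul_add, mul_add, Finset.sum_const,
      Finset.card_univ, Fintype.card_fin, nsmul_eq_mul, e2] at hs
    rw [e, inner_smul_left, sum_inner]
    exact hs
  lf0_nonneg := hlf0
  lf1_pos := hlf1
  lg1_pos := hlg1
  lg2_nonneg := hlg2
  mug_pos := hmug

omit hP in
theorem gradY_yStar (R : BilevelRegular P.outerAvg P.innerAvg lf0 lf1 lg1 lg2 mug) (x : Vec d₁) :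
    gradY P.innerAvg (pt x (P.yStar x)) = 0 :=
  R.gradY_eq_zero (Classical.epsilon_spec (R.exists_forall_le x))

end FedProblem

/-! ### Mean-square estimates -/

section MeanSquare

variable {Ω : Type*} {𝓕 𝓖 : MeasurableSpace Ω} {mΩ : MeasurableSpace Ω} {Pr : Measure Ω}
variable {E : Type*} [NormedAddCommGroup E]

theorem lpNorm_two_sq {X : Ω → E} (hX : MemLp X 2 Pr) : lpNorm X 2 Pr ^ 2 = ∫ ω, ‖X ω‖ ^ 2 ∂Pr := by
  rw [lpNorm_eq_integral_norm_rpow_toReal two_ne_zero ENNReal.ofNat_ne_top hX.1]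
  simp only [ENNReal.toReal_ofNat, Real.rpow_two, ← one_div, ← Real.sqrt_eq_rpow]
  exact Real.sq_sqrt (integral_nonneg fun ω => sq_nonneg _)

theorem MeasureTheory.MemLp.integrable_norm_sq {X : Ω → E} (hX : MemLp X 2 Pr) :
    Integrable (fun ω => ‖X ω‖ ^ 2) Pr :=
  (memLp_two_iff_integrable_sq_norm hX.1).1 hX

theorem lpNorm_two_mono {F : Type*} [NormedAddCommGroup F] {X : Ω → E} {Y : Ω → F}
    (hY : MemLp Y 2 Pr) (h : ∀ ω, ‖X ω‖ ≤ ‖Y ω‖) : lpNorm X 2 Pr ≤ lpNorm Y 2 Pr := by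
  rw [← lpNorm_norm hY.1]
  exact lpNorm_mono_real hY.norm h

theorem lpNorm_two_add_le {X Y : Ω → E} (hX : MemLp X 2 Pr) :
    lpNorm (fun ω => X ω + Y ω) 2 Pr ≤ lpNorm X 2 Pr + lpNorm Y 2 Pr :=
  lpNorm_add_le hX one_le_two

theorem lpNorm_two_sub_le {X Y : Ω → E} (hX : MemLp X 2 Pr) :
    lpNorm (fun ω => X ω - Y ω) 2 Pr ≤ lpNorm X 2 Pr + lpNorm Y 2 Pr :=
  lpNorm_sub_le hX one_le_two

theorem lpNorm_two_smul [NormedSpace ℝ E] (c : ℝ) (X : Ω → E) :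
    lpNorm (fun ω => c • X ω) 2 Pr = |c| * lpNorm X 2 Pr :=
  (lpNorm_const_smul c X Pr).trans (by simp)

theorem memLp_avg [NormedSpace ℝ E] {ι : Type*} [Fintype ι] {c : ℝ} {X : ι → Ω → E}
    (hX : ∀ i, MemLp (X i) 2 Pr) : MemLp (fun ω => c • ∑ i, X i ω) 2 Pr :=
  (memLp_finsetSum _ fun i _ => hX i).const_smul c

theorem lpNorm_avg_le [NormedSpace ℝ E] {ι : Type*} [Fintype ι] [Nonempty ι] {c : ℝ}
    {X : ι → Ω → E} (hX : ∀ i, MemLp (X i) 2 Pr) (h : ∀ i, lpNorm (X i) 2 Pr ≤ c) :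
    lpNorm (fun ω => (Fintype.card ι : ℝ)⁻¹ • ∑ i, X i ω) 2 Pr ≤ c := by
  have hn : (0 : ℝ) < Fintype.card ι := by exact_mod_cast Fintype.card_pos
  rw [lpNorm_two_smul, abs_of_pos (inv_pos.2 hn), inv_mul_le_iff₀ hn]
  have e : (fun ω => ∑ i, X i ω) = ∑ i, X i := by ext ω; simp
  rw [e]
  refine (lpNorm_sum_le (fun i _ => hX i) one_le_two).trans
    ((Finset.sum_le_sum fun i _ => h i).trans_eq ?_)
  simp

theorem integral_norm_mul_norm_le {F : Type*} [NormedAddCommGroup F] {X : Ω → E} {Y : Ω → F}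
    (hX : MemLp X 2 Pr) (hY : MemLp Y 2 Pr) :
    ∫ ω, ‖X ω‖ * ‖Y ω‖ ∂Pr ≤ lpNorm X 2 Pr * lpNorm Y 2 Pr := by
  have e2 : ENNReal.ofReal 2 = 2 := by simp
  have h := integral_mul_norm_le_Lp_mul_Lq (f := fun ω => ‖X ω‖) (g := fun ω => ‖Y ω‖)
    Real.HolderConjugate.two_two (by rw [e2]; exact hX.norm) (by rw [e2]; exact hY.norm)
  rw [lpNorm_eq_integral_norm_rpow_toReal two_ne_zero ENNReal.ofNat_ne_top hX.1,
    lpNorm_eq_integral_norm_rpow_toReal two_ne_zero ENNReal.ofNat_ne_top hY.1]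
  simpa using h

theorem integrable_norm_mul_norm {F : Type*} [NormedAddCommGroup F] {X : Ω → E} {Y : Ω → F}
    (hX : MemLp X 2 Pr) (hY : MemLp Y 2 Pr) : Integrable (fun ω => ‖X ω‖ * ‖Y ω‖) Pr :=
  hX.norm.integrable_mul hY.norm

section Inner

variable {V : Type*} [NormedAddCommGroup V] [InnerProductSpace ℝ V]

theorem integrable_inner {X Y : Ω → V} (hX : MemLp X 2 Pr) (hY : MemLp Y 2 Pr) :
    Integrable (fun ω => ⟪X ω, Y ω⟫) Pr :=
  (integrable_norm_mul_norm hX hY).mono' (hX.1.inner hY.1)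
    (Filter.Eventually.of_forall fun _ => norm_inner_le_norm _ _)

theorem abs_integral_inner_le {X Y : Ω → V} (hX : MemLp X 2 Pr) (hY : MemLp Y 2 Pr) :
    |∫ ω, ⟪X ω, Y ω⟫ ∂Pr| ≤ lpNorm X 2 Pr * lpNorm Y 2 Pr := by
  refine abs_integral_le_integral_abs.trans (le_trans ?_ (integral_norm_mul_norm_le hX hY))
  exact integral_mono (integrable_inner hX hY).abs (integrable_norm_mul_norm hX hY)
    fun _ => abs_real_inner_le_norm _ _

theorem integral_norm_sub_sq {X Y : Ω → V} (hX : MemLp X 2 Pr) (hY : MemLp Y 2 Pr) :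
    ∫ ω, ‖X ω - Y ω‖ ^ 2 ∂Pr
      = ∫ ω, ‖X ω‖ ^ 2 ∂Pr - 2 * ∫ ω, ⟪X ω, Y ω⟫ ∂Pr + ∫ ω, ‖Y ω‖ ^ 2 ∂Pr := by
  simp only [norm_sub_sq_real]
  have h := integrable_inner hX hY
  have h' : Integrable (fun ω => ‖X ω‖ ^ 2 - 2 * ⟪X ω, Y ω⟫) Pr :=
    hX.integrable_norm_sq.sub (h.const_mul 2)
  rw [integral_add h' hY.integrable_norm_sq, integral_sub hX.integrable_norm_sq (h.const_mul 2),
    integral_const_mul]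

end Inner

/-! ### Conditional moments, tested against random weights -/

/-- `CondSized Pr 𝓕 c X` says `E[‖X‖² | 𝓕] ≤ c²`, expressed through square-integrable
`𝓕`-measurable weights. -/
def CondSized [NormedSpace ℝ E] (Pr : Measure Ω) (𝓕 : MeasurableSpace Ω) (c : ℝ) (X : Ω → E) :
    Prop :=
  ∀ θ : Ω → ℝ, Measurable[𝓕] θ → MemLp θ 2 Pr →
    MemLp (fun ω => θ ω • X ω) 2 Pr ∧ lpNorm (fun ω => θ ω • X ω) 2 Pr ≤ c * lpNorm θ 2 Pr

/-- `SameCondMean Pr 𝓕 X Y` says `E[X | 𝓕] = E[Y | 𝓕]`, expressed through square-integrable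
`𝓕`-measurable test vectors. -/
def SameCondMean {V : Type*} [NormedAddCommGroup V] [InnerProductSpace ℝ V] [MeasurableSpace V]
    (Pr : Measure Ω) (𝓕 : MeasurableSpace Ω) (X Y : Ω → V) : Prop :=
  ∀ U : Ω → V, Measurable[𝓕] U → MemLp U 2 Pr → ∫ ω, ⟪U ω, X ω⟫ ∂Pr = ∫ ω, ⟪U ω, Y ω⟫ ∂Pr

namespace CondSized

variable [NormedSpace ℝ E] {c c' : ℝ} {X Y : Ω → E}

theorem mono_sigma (h : CondSized Pr 𝓖 c X) (hle : 𝓕 ≤ 𝓖) : CondSized Pr 𝓕 c X :=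
  fun θ hθ hθ2 => h θ (hθ.mono hle le_rfl) hθ2

theorem mono_const (h : CondSized Pr 𝓕 c X) (hle : c ≤ c') : CondSized Pr 𝓕 c' X :=
  fun θ hθ hθ2 => ⟨(h θ hθ hθ2).1,
    (h θ hθ hθ2).2.trans (mul_le_mul_of_nonneg_right hle lpNorm_nonneg)⟩

theorem memLp [IsProbabilityMeasure Pr] (h : CondSized Pr 𝓕 c X) : MemLp X 2 Pr := by
  simpa using (h (fun _ => 1) measurable_const (memLp_const 1)).1

theorem lpNorm_le [IsProbabilityMeasure Pr] (h : CondSized Pr 𝓕 c X) : lpNorm X 2 Pr ≤ c := by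
  have h1 := (h (fun _ => 1) measurable_const (memLp_const 1)).2
  rw [lpNorm_const two_ne_zero (IsProbabilityMeasure.ne_zero Pr)] at h1
  simpa using h1

theorem add (hX : CondSized Pr 𝓕 c X) (hY : CondSized Pr 𝓕 c' Y) :
    CondSized Pr 𝓕 (c + c') (fun ω => X ω + Y ω) := by
  intro θ hθ hθ2
  obtain ⟨h1, h2⟩ := hX θ hθ hθ2
  obtain ⟨h3, h4⟩ := hY θ hθ hθ2
  simp only [smul_add]
  refine ⟨h1.add h3, (lpNorm_two_add_le h1).trans ?_⟩
  rw [add_mul]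
  exact add_le_add h2 h4

theorem sub (hX : CondSized Pr 𝓕 c X) (hY : CondSized Pr 𝓕 c' Y) :
    CondSized Pr 𝓕 (c + c') (fun ω => X ω - Y ω) := by
  intro θ hθ hθ2
  obtain ⟨h1, h2⟩ := hX θ hθ hθ2
  obtain ⟨h3, h4⟩ := hY θ hθ hθ2
  simp only [smul_sub]
  refine ⟨h1.sub h3, (lpNorm_two_sub_le h1).trans ?_⟩
  rw [add_mul]
  exact add_le_add h2 h4

theorem const_smul (r : ℝ) (hX : CondSized Pr 𝓕 c X) :
    CondSized Pr 𝓕 (|r| * c) (fun ω => r • X ω) := by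
  intro θ hθ hθ2
  obtain ⟨h1, h2⟩ := hX θ hθ hθ2
  have e : (fun ω => θ ω • r • X ω) = fun ω => r • θ ω • X ω := by
    ext ω; rw [smul_comm]
  rw [e]
  refine ⟨h1.const_smul r, ?_⟩
  rw [lpNorm_two_smul, mul_assoc]
  gcongr

theorem avg {ι : Type*} [Fintype ι] [Nonempty ι] {X : ι → Ω → E}
    (hX : ∀ i, CondSized Pr 𝓕 c (X i)) :
    CondSized Pr 𝓕 c (fun ω => (Fintype.card ι : ℝ)⁻¹ • ∑ i, X i ω) := by
  intro θ hθ hθ2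
  have e : (fun ω => θ ω • (Fintype.card ι : ℝ)⁻¹ • ∑ i, X i ω)
      = fun ω => (Fintype.card ι : ℝ)⁻¹ • ∑ i, θ ω • X i ω := by
    ext ω; rw [smul_comm, Finset.smul_sum]
  rw [e]
  exact ⟨memLp_avg fun i => (hX i θ hθ hθ2).1,
    lpNorm_avg_le (fun i => (hX i θ hθ hθ2).1) fun i => (hX i θ hθ hθ2).2⟩

theorem of_norm_le_mul {F : Type*} [NormedAddCommGroup F] [NormedSpace ℝ F] {Y : Ω → F} {r : ℝ}
    (hr : 0 ≤ r) (hY : CondSized Pr 𝓕 c Y) (hle : 𝓕 ≤ mΩ) (hX : AEStronglyMeasurable X Pr)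
    (h : ∀ ω, ‖X ω‖ ≤ r * ‖Y ω‖) : CondSized Pr 𝓕 (r * c) X := by
  intro θ hθ hθ2
  obtain ⟨h1, h2⟩ := hY θ hθ hθ2
  have hb : ∀ ω, ‖θ ω • X ω‖ ≤ ‖r • θ ω • Y ω‖ := fun ω => by
    rw [norm_smul, norm_smul, norm_smul, Real.norm_of_nonneg hr, mul_left_comm]
    gcongr
    exact h ω
  have h3 := h1.const_smul r
  refine ⟨h3.mono (((hθ.mono hle le_rfl).aestronglyMeasurable).smul hX)
    (Filter.Eventually.of_forall hb), (lpNorm_two_mono h3 hb).trans ?_⟩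
  refine (lpNorm_two_smul r fun ω => θ ω • Y ω).le.trans ?_
  rw [abs_of_nonneg hr, mul_assoc]
  gcongr

theorem of_norm_le (hle : 𝓕 ≤ mΩ) (hX : AEStronglyMeasurable X Pr) (hc : 0 ≤ c)
    (h : ∀ ω, ‖X ω‖ ≤ c) : CondSized Pr 𝓕 c X := by
  have h1 : CondSized Pr 𝓕 1 (fun _ : Ω => (1 : ℝ)) := fun θ hθ hθ2 => by simpa using hθ2
  simpa using h1.of_norm_le_mul hc hle hX (by simpa using h)

end CondSized

namespace SameCondMean

variable {V : Type*} [NormedAddCommGroup V] [InnerProductSpace ℝ V] [MeasurableSpace V]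
  {X Y Z X' Y' : Ω → V}

theorem mono_sigma (h : SameCondMean Pr 𝓖 X Y) (hle : 𝓕 ≤ 𝓖) : SameCondMean Pr 𝓕 X Y :=
  fun U hU hU2 => h U (hU.mono hle le_rfl) hU2

theorem refl (X : Ω → V) : SameCondMean Pr 𝓕 X X := fun _ _ _ => rfl

theorem trans (h : SameCondMean Pr 𝓕 X Y) (h' : SameCondMean Pr 𝓕 Y Z) : SameCondMean Pr 𝓕 X Z :=
  fun U hU hU2 => (h U hU hU2).trans (h' U hU hU2)

theorem add (h : SameCondMean Pr 𝓕 X Y) (h' : SameCondMean Pr 𝓕 X' Y') (hX : MemLp X 2 Pr)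
    (hY : MemLp Y 2 Pr) (hX' : MemLp X' 2 Pr) (hY' : MemLp Y' 2 Pr) :
    SameCondMean Pr 𝓕 (fun ω => X ω + X' ω) (fun ω => Y ω + Y' ω) := by
  intro U hU hU2
  simp only [inner_add_right]
  rw [integral_add (integrable_inner hU2 hX) (integrable_inner hU2 hX'),
    integral_add (integrable_inner hU2 hY) (integrable_inner hU2 hY'), h U hU hU2, h' U hU hU2]

theorem sub (h : SameCondMean Pr 𝓕 X Y) (h' : SameCondMean Pr 𝓕 X' Y') (hX : MemLp X 2 Pr)
    (hY : MemLp Y 2 Pr) (hX' : MemLp X' 2 Pr) (hY' : MemLp Y' 2 Pr) :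
    SameCondMean Pr 𝓕 (fun ω => X ω - X' ω) (fun ω => Y ω - Y' ω) := by
  intro U hU hU2
  simp only [inner_sub_right]
  rw [integral_sub (integrable_inner hU2 hX) (integrable_inner hU2 hX'),
    integral_sub (integrable_inner hU2 hY) (integrable_inner hU2 hY'), h U hU hU2, h' U hU hU2]

theorem const_smul (r : ℝ) (h : SameCondMean Pr 𝓕 X Y) :
    SameCondMean Pr 𝓕 (fun ω => r • X ω) (fun ω => r • Y ω) := by
  intro U hU hU2
  simp only [inner_smul_right, integral_const_mul, h U hU hU2]

theorem sum {ι : Type*} [Fintype ι] {X Y : ι → Ω → V}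
    (h : ∀ i, SameCondMean Pr 𝓕 (X i) (Y i)) (hX : ∀ i, MemLp (X i) 2 Pr)
    (hY : ∀ i, MemLp (Y i) 2 Pr) :
    SameCondMean Pr 𝓕 (fun ω => ∑ i, X i ω) (fun ω => ∑ i, Y i ω) := by
  intro U hU hU2
  simp only [inner_sum]
  rw [integral_finsetSum _ fun i _ => integrable_inner hU2 (hX i),
    integral_finsetSum _ fun i _ => integrable_inner hU2 (hY i)]
  exact Finset.sum_congr rfl fun i _ => h i U hU hU2

/-- A bounded `𝓕`-measurable random linear map with an adjoint can be taken out of conditional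
means. -/
theorem map {W : Type*} [NormedAddCommGroup W] [InnerProductSpace ℝ W] [MeasurableSpace W]
    (h : SameCondMean Pr 𝓕 X Y) (hle : 𝓕 ≤ mΩ) [BorelSpace V] [SecondCountableTopology V]
    {A : Ω → V →L[ℝ] W} {A' : Ω → W → V} {r : ℝ} (hr : 0 ≤ r)
    (hadj : ∀ ω v w, ⟪w, A ω v⟫ = ⟪A' ω w, v⟫) (hA' : ∀ ω w, ‖A' ω w‖ ≤ r * ‖w‖)
    (hmeas : ∀ U : Ω → W, Measurable[𝓕] U → Measurable[𝓕] fun ω => A' ω (U ω)) :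
    SameCondMean Pr 𝓕 (fun ω => A ω (X ω)) (fun ω => A ω (Y ω)) := by
  intro U hU hU2
  simp only [hadj]
  refine h _ (hmeas U hU) ?_
  refine (hU2.norm.const_mul r).mono
    (((hmeas U hU).mono hle le_rfl).aestronglyMeasurable) (Filter.Eventually.of_forall fun ω => ?_)
  rw [Real.norm_of_nonneg (by positivity)]
  exact hA' ω _

end SameCondMean

end MeanSquare

/-! ### Unbiased oracles and the noise of a fresh sample -/

/-- `G z ζ` is an unbiased estimator of `Gb z` with variance at most `v` when `ζ ∼ ν`. -/
structure IsOracle {𝒵 Ζ E : Type*} [MeasurableSpace 𝒵] [MeasurableSpace Ζ] [NormedAddCommGroup E]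
    [NormedSpace ℝ E] [MeasurableSpace E] (ν : Measure Ζ) (G : 𝒵 → Ζ → E) (Gb : 𝒵 → E)
    (v : ℝ) : Prop where
  prob : IsProbabilityMeasure ν
  meas : Measurable fun p : 𝒵 × Ζ => G p.1 p.2
  meas_mean : Measurable Gb
  sq : ∀ z, MemLp (G z) 2 ν
  unbiased : ∀ z, ∫ ζ, G z ζ ∂ν = Gb z
  var_le : ∀ z, ∫ ζ, ‖G z ζ - Gb z‖ ^ 2 ∂ν ≤ v

section Freeze

variable {Ω 𝒳 Ζ : Type*} {mΩ : MeasurableSpace Ω} {Pr : Measure Ω} [IsProbabilityMeasure Pr]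
  [MeasurableSpace 𝒳] [MeasurableSpace Ζ] {ν : Measure Ζ} {X : Ω → 𝒳} {Z : Ω → Ζ}

theorem map_prodMk_eq (hX : Measurable X) (hZ : Measurable Z) (hind : IndepFun X Z Pr)
    (hlaw : Pr.map Z = ν) : Pr.map (fun ω => (X ω, Z ω)) = (Pr.map X).prod ν := by
  rw [(indepFun_iff_map_prod_eq_prod_map_map hX.aemeasurable hZ.aemeasurable).1 hind, hlaw]

/-- Integration over a fresh sample with everything known before it held fixed. -/
theorem lintegral_freeze (hX : Measurable X) (hZ : Measurable Z) (hind : IndepFun X Z Pr)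
    (hlaw : Pr.map Z = ν) {φ : 𝒳 × Ζ → ℝ≥0∞} (hφ : Measurable φ) :
    ∫⁻ ω, φ (X ω, Z ω) ∂Pr = ∫⁻ ω, ∫⁻ ζ, φ (X ω, ζ) ∂ν ∂Pr := by
  have : IsProbabilityMeasure ν := hlaw ▸ Measure.isProbabilityMeasure_map hZ.aemeasurable
  rw [← lintegral_map hφ (hX.prodMk hZ), map_prodMk_eq hX hZ hind hlaw,
    lintegral_prod _ hφ.aemeasurable, lintegral_map hφ.lintegral_prod_right' hX]

/-- A function with mean zero in the fresh sample for every value of the past has mean zero. -/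
theorem integral_freeze_eq_zero (hX : Measurable X) (hZ : Measurable Z) (hind : IndepFun X Z Pr)
    (hlaw : Pr.map Z = ν) {φ : 𝒳 × Ζ → ℝ} (hφ : Measurable φ)
    (hint : Integrable (fun ω => φ (X ω, Z ω)) Pr) (h0 : ∀ x, ∫ ζ, φ (x, ζ) ∂ν = 0) :
    ∫ ω, φ (X ω, Z ω) ∂Pr = 0 := by
  have : IsProbabilityMeasure ν := hlaw ▸ Measure.isProbabilityMeasure_map hZ.aemeasurable
  have hm := (hX.prodMk hZ).aemeasurable (μ := Pr)
  have hi : Integrable φ ((Pr.map X).prod ν) := by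
    rw [← map_prodMk_eq hX hZ hind hlaw]
    exact (integrable_map_measure hφ.aestronglyMeasurable hm).2 hint
  rw [← integral_map hm hφ.aestronglyMeasurable, map_prodMk_eq hX hZ hind hlaw,
    integral_prod _ hi]
  simp [h0]

end Freeze

section Sandwich

variable {H H' E' V : Type*} [NormedAddCommGroup H] [NormedSpace ℝ H] [NormedAddCommGroup H']
  [NormedSpace ℝ H'] [NormedAddCommGroup E'] [NormedSpace ℝ E'] [NormedAddCommGroup V]
  [NormedSpace ℝ V]

/-- The bilinear map `(a, b) ↦ L (a (J b))`. -/
def sandwich (L : H →L[ℝ] V) (J : E' →L[ℝ] H') : (H' →L[ℝ] H) →L[ℝ] E' →L[ℝ] V :=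
  (ContinuousLinearMap.compL ℝ E' H V L) ∘L ((ContinuousLinearMap.compL ℝ E' H' H).flip J)

theorem sandwich_apply (L : H →L[ℝ] V) (J : E' →L[ℝ] H') (a : H' →L[ℝ] H) (b : E') :
    sandwich L J a b = L (a (J b)) := rfl

theorem norm_sandwich_le (L : H →L[ℝ] V) (hL : ∀ a, ‖L a‖ ≤ ‖a‖) (J : E' →L[ℝ] H')
    (hJ : ∀ b, ‖J b‖ ≤ ‖b‖) (a : H' →L[ℝ] H) (b : E') : ‖sandwich L J a b‖ ≤ ‖a‖ * ‖b‖ := by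
  rw [sandwich_apply]
  exact (hL _).trans ((a.le_opNorm _).trans (by gcongr; exact hJ b))

end Sandwich

section Noise

variable {Ω 𝒵 Ζ E E' V : Type*} {𝓕 𝓖 : MeasurableSpace Ω} {mΩ : MeasurableSpace Ω} {Pr : Measure Ω}
  [IsProbabilityMeasure Pr]
  [MeasurableSpace 𝒵] [MeasurableSpace Ζ]
  [NormedAddCommGroup E] [NormedSpace ℝ E] [MeasurableSpace E] [BorelSpace E]
  [SecondCountableTopology E] [CompleteSpace E]
  [NormedAddCommGroup E'] [NormedSpace ℝ E'] [MeasurableSpace E'] [BorelSpace E']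
  [SecondCountableTopology E']
  [NormedAddCommGroup V] [InnerProductSpace ℝ V] [MeasurableSpace V] [BorelSpace V]
  [SecondCountableTopology V] [CompleteSpace V]
  {ν : Measure Ζ} {G : 𝒵 → Ζ → E} {Gb : 𝒵 → E} {v : ℝ}
  {Y : Ω → 𝒵} {Z : Ω → Ζ} {q : Ω → E'}

theorem indepFun_of_indep {𝒳 : Type*} [MeasurableSpace 𝒳] {X : Ω → 𝒳} (hX : Measurable[𝓕] X)
    (hind : Indep 𝓕 (MeasurableSpace.comap Z inferInstance) Pr) : IndepFun X Z Pr :=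
  indep_of_indep_of_le_left hind hX.comap_le

theorem IsOracle.measurable_noise (hO : IsOracle ν G Gb v) (B : E →L[ℝ] E' →L[ℝ] V)
    (hY : Measurable[mΩ] Y) (hZ : Measurable[mΩ] Z) (hq : Measurable[mΩ] q) :
    Measurable[mΩ] fun ω => B (G (Y ω) (Z ω) - Gb (Y ω)) (q ω) :=
  B.continuous₂.measurable.comp
    (((hO.meas.comp (hY.prodMk hZ)).sub (hO.meas_mean.comp hY)).prodMk hq)

/-- The noise of a fresh sample, applied through a bilinear map to an `𝓕`-measurable factor `q`, is
bounded in mean square by the standard deviation times the size of `q`. -/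
theorem IsOracle.noise_bound (hO : IsOracle ν G Gb v) (h𝓕 : 𝓕 ≤ mΩ) (hZ : Measurable[mΩ] Z)
    (hlaw : Pr.map Z = ν) (hind : Indep 𝓕 (MeasurableSpace.comap Z inferInstance) Pr)
    (hY : Measurable[𝓕] Y) (hq : Measurable[𝓕] q) (hq2 : MemLp q 2 Pr)
    (B : E →L[ℝ] E' →L[ℝ] V) (hB : ∀ a b, ‖B a b‖ ≤ ‖a‖ * ‖b‖) :
    MemLp (fun ω => B (G (Y ω) (Z ω) - Gb (Y ω)) (q ω)) 2 Pr ∧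
      lpNorm (fun ω => B (G (Y ω) (Z ω) - Gb (Y ω)) (q ω)) 2 Pr ≤ √v * lpNorm q 2 Pr := by
  have hν := hO.prob
  have hY' := hY.mono h𝓕 le_rfl
  have hq' := hq.mono h𝓕 le_rfl
  have hR := hO.measurable_noise B hY' hZ hq'
  have hdev : ∀ y, MemLp (fun ζ => G y ζ - Gb y) 2 ν := fun y => (hO.sq y).sub (memLp_const _)
  have hinner : ∀ y, ∫⁻ ζ, ‖G y ζ - Gb y‖ₑ ^ 2 ∂ν ≤ ENNReal.ofReal v := by
    intro y
    refine le_trans (le_of_eq ?_) (ENNReal.ofReal_le_ofReal (hO.var_le y))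
    rw [ofReal_integral_eq_lintegral_ofReal (hdev y).integrable_norm_sq
      (Filter.Eventually.of_forall fun _ => sq_nonneg _)]
    refine lintegral_congr fun ζ => ?_
    rw [ENNReal.ofReal_pow (norm_nonneg _), ofReal_norm]
  have hsq : ∫⁻ ω, ‖B (G (Y ω) (Z ω) - Gb (Y ω)) (q ω)‖ₑ ^ 2 ∂Pr
      ≤ ENNReal.ofReal v * ∫⁻ ω, ‖q ω‖ₑ ^ 2 ∂Pr := by
    have hφ : Measurable fun p : (𝒵 × E') × Ζ => ‖G p.1.1 p.2 - Gb p.1.1‖ₑ ^ 2 * ‖p.1.2‖ₑ ^ 2 := by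
      refine Measurable.mul (Measurable.pow_const (Measurable.enorm ?_) 2)
        ((measurable_snd.comp measurable_fst).enorm.pow_const 2)
      exact (hO.meas.comp ((measurable_fst.comp measurable_fst).prodMk measurable_snd)).sub
        (hO.meas_mean.comp (measurable_fst.comp measurable_fst))
    calc _ ≤ ∫⁻ ω, ‖G (Y ω) (Z ω) - Gb (Y ω)‖ₑ ^ 2 * ‖q ω‖ₑ ^ 2 ∂Pr := by
          refine lintegral_mono fun ω => ?_
          rw [← mul_pow]
          gcongr
          rw [← ofReal_norm, ← ofReal_norm, ← ofReal_norm,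
            ← ENNReal.ofReal_mul (norm_nonneg _)]
          exact ENNReal.ofReal_le_ofReal (hB _ _)
      _ = ∫⁻ ω, ∫⁻ ζ, ‖G (Y ω) ζ - Gb (Y ω)‖ₑ ^ 2 * ‖q ω‖ₑ ^ 2 ∂ν ∂Pr :=
          lintegral_freeze (X := fun ω => (Y ω, q ω)) (hY'.prodMk hq') hZ
            (indepFun_of_indep (hY.prodMk hq) hind) hlaw hφ
      _ ≤ ∫⁻ ω, ENNReal.ofReal v * ‖q ω‖ₑ ^ 2 ∂Pr := by
          refine lintegral_mono fun ω => ?_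
          rw [lintegral_mul_const' _ _ (by finiteness)]
          gcongr
          exact hinner _
      _ = _ := lintegral_const_mul _ (hq'.enorm.pow_const 2)
  have hnorm : eLpNorm (fun ω => B (G (Y ω) (Z ω) - Gb (Y ω)) (q ω)) 2 Pr
      ≤ ENNReal.ofReal (√v) * eLpNorm q 2 Pr := by
    rw [eLpNorm_eq_lintegral_rpow_enorm_toReal two_ne_zero ENNReal.ofNat_ne_top,
      eLpNorm_eq_lintegral_rpow_enorm_toReal two_ne_zero ENNReal.ofNat_ne_top]
    simp only [ENNReal.toReal_ofNat, ENNReal.rpow_two]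
    have hv : ENNReal.ofReal (√v) = ENNReal.ofReal v ^ (1 / 2 : ℝ) := by
      have h0 : 0 ≤ v := (integral_nonneg fun _ => sq_nonneg _).trans
        (hO.var_le (Y (Nonempty.some (nonempty_of_isProbabilityMeasure Pr))))
      rw [ENNReal.ofReal_rpow_of_nonneg h0 (by norm_num), Real.sqrt_eq_rpow]
    rw [hv, ← ENNReal.mul_rpow_of_nonneg _ _ (by norm_num)]
    exact ENNReal.rpow_le_rpow hsq (by norm_num)
  have hfin : ENNReal.ofReal (√v) * eLpNorm q 2 Pr ≠ ⊤ :=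
    ENNReal.mul_ne_top ENNReal.ofReal_ne_top hq2.eLpNorm_ne_top
  refine ⟨⟨hR.aestronglyMeasurable, hnorm.trans_lt hfin.lt_top⟩, ?_⟩
  rw [← toReal_eLpNorm hR.aestronglyMeasurable, ← toReal_eLpNorm hq2.1,
    ← ENNReal.toReal_ofReal (Real.sqrt_nonneg v), ← ENNReal.toReal_mul]
  exact ENNReal.toReal_mono hfin hnorm

/-- The noise of a fresh sample has conditional mean zero: it is orthogonal to every
`𝓕`-measurable vector. -/
theorem IsOracle.noise_orthogonal (hO : IsOracle ν G Gb v) (h𝓕 : 𝓕 ≤ mΩ) (hZ : Measurable[mΩ] Z)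
    (hlaw : Pr.map Z = ν) (hind : Indep 𝓕 (MeasurableSpace.comap Z inferInstance) Pr)
    (hY : Measurable[𝓕] Y) (hq : Measurable[𝓕] q) (hq2 : MemLp q 2 Pr)
    (B : E →L[ℝ] E' →L[ℝ] V) (hB : ∀ a b, ‖B a b‖ ≤ ‖a‖ * ‖b‖)
    {U : Ω → V} (hU : Measurable[𝓕] U) (hU2 : MemLp U 2 Pr) :
    ∫ ω, ⟪U ω, B (G (Y ω) (Z ω) - Gb (Y ω)) (q ω)⟫ ∂Pr = 0 := by
  have hν := hO.prob
  have hY' := hY.mono h𝓕 le_rfl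
  have hq' := hq.mono h𝓕 le_rfl
  have hU' := hU.mono h𝓕 le_rfl
  refine integral_freeze_eq_zero (X := fun ω => (U ω, Y ω, q ω)) (Z := Z) (ν := ν)
    (φ := fun p => ⟪p.1.1, B (G p.1.2.1 p.2 - Gb p.1.2.1) p.1.2.2⟫)
    (hU'.prodMk (hY'.prodMk hq')) hZ (indepFun_of_indep (hU.prodMk (hY.prodMk hq)) hind) hlaw
    ?_ ?_ ?_
  · refine Measurable.inner (measurable_fst.comp measurable_fst) ?_
    have h1 : Measurable fun p : (V × 𝒵 × E') × Ζ => p.1.2.1 :=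
      measurable_fst.comp (measurable_snd.comp measurable_fst)
    refine B.continuous₂.measurable.comp (((hO.meas.comp (h1.prodMk measurable_snd)).sub
      (hO.meas_mean.comp h1)).prodMk ?_)
    exact measurable_snd.comp (measurable_snd.comp measurable_fst)
  · exact integrable_inner hU2 (hO.noise_bound h𝓕 hZ hlaw hind hY hq hq2 B hB).1
  · rintro ⟨u, y, r⟩
    have h1 : Integrable (G y) ν := (hO.sq y).integrable one_le_two
    have h2 := ContinuousLinearMap.integral_comp_comm ((innerSL ℝ u) ∘L (B.flip r))
      (h1.sub (integrable_const (Gb y)))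
    have h3 : ∫ ζ, (G y ζ - Gb y) ∂ν = 0 := by
      rw [integral_sub h1 (integrable_const _), hO.unbiased]
      simp
    exact h2.trans (by rw [← map_zero ((innerSL ℝ u) ∘L (B.flip r)), ← h3]; rfl)

variable {H : Type*} [NormedAddCommGroup H] [InnerProductSpace ℝ H] [MeasurableSpace H]
  [BorelSpace H] [SecondCountableTopology H] [CompleteSpace H] {Gv : 𝒵 → Ζ → H} {Gvb : 𝒵 → H}

/-- Vector-valued noise, mapped by a contraction, has conditional second moment at most `v`. -/
theorem IsOracle.condSized (hO : IsOracle ν Gv Gvb v) (h𝓕 : 𝓕 ≤ mΩ) (hZ : Measurable[mΩ] Z)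
    (hlaw : Pr.map Z = ν) (hind : Indep 𝓕 (MeasurableSpace.comap Z inferInstance) Pr)
    (hY : Measurable[𝓕] Y) (L : H →L[ℝ] V) (hL : ∀ a, ‖L a‖ ≤ ‖a‖) :
    CondSized Pr 𝓕 (√v) fun ω => L (Gv (Y ω) (Z ω) - Gvb (Y ω)) := by
  intro θ hθ hθ2
  exact hO.noise_bound h𝓕 hZ hlaw hind hY hθ hθ2 ((ContinuousLinearMap.lsmul ℝ ℝ).flip ∘L L)
    fun a b => by
      simp only [ContinuousLinearMap.comp_apply, ContinuousLinearMap.flip_apply,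
        ContinuousLinearMap.lsmul_apply, norm_smul]
      rw [mul_comm]
      gcongr
      exact hL a

theorem IsOracle.sameCondMean (hO : IsOracle ν Gv Gvb v) (h𝓕 : 𝓕 ≤ mΩ) (hZ : Measurable[mΩ] Z)
    (hlaw : Pr.map Z = ν) (hind : Indep 𝓕 (MeasurableSpace.comap Z inferInstance) Pr)
    (hY : Measurable[𝓕] Y) (L : H →L[ℝ] V) (hL : ∀ a, ‖L a‖ ≤ ‖a‖) :
    SameCondMean Pr 𝓕 (fun ω => L (Gv (Y ω) (Z ω) - Gvb (Y ω))) fun _ => 0 := by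
  intro U hU hU2
  have h := hO.noise_orthogonal h𝓕 hZ hlaw hind hY (q := fun _ => (1 : ℝ)) measurable_const
    (memLp_const 1) ((ContinuousLinearMap.lsmul ℝ ℝ).flip ∘L L) (fun a b => by
      simp only [ContinuousLinearMap.comp_apply, ContinuousLinearMap.flip_apply,
        ContinuousLinearMap.lsmul_apply, norm_smul]
      rw [mul_comm]
      gcongr
      exact hL a) hU hU2
  simpa using h

variable {H' : Type*} [NormedAddCommGroup H'] [NormedSpace ℝ H'] [MeasurableSpace H']
  [BorelSpace H'] [SecondCountableTopology H'] {A : 𝒵 → Ζ → H' →L[ℝ] H} {Ab : 𝒵 → H' →L[ℝ] H}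
  [SecondCountableTopology (H' →L[ℝ] H)] {p : Ω → E'} {c : ℝ}

/-- Matrix-valued noise, applied to a random vector `p` known before the sample is drawn. -/
theorem IsOracle.condSized_apply (hO : IsOracle ν A Ab v) (h𝓕 : 𝓕 ≤ 𝓖) (h𝓖 : 𝓖 ≤ mΩ)
    (hZ : Measurable[mΩ] Z) (hlaw : Pr.map Z = ν)
    (hind : Indep 𝓖 (MeasurableSpace.comap Z inferInstance) Pr)
    (hY : Measurable[𝓖] Y) (hp : Measurable[𝓖] p) (hpc : CondSized Pr 𝓕 c p)
    (L : H →L[ℝ] V) (hL : ∀ a, ‖L a‖ ≤ ‖a‖) (J : E' →L[ℝ] H') (hJ : ∀ b, ‖J b‖ ≤ ‖b‖) :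
    CondSized Pr 𝓕 (√v * c) fun ω => L ((A (Y ω) (Z ω) - Ab (Y ω)) (J (p ω))) := by
  intro θ hθ hθ2
  obtain ⟨h1, h2⟩ := hpc θ hθ hθ2
  have h := hO.noise_bound h𝓖 hZ hlaw hind hY ((hθ.mono h𝓕 le_rfl).smul hp) h1 (sandwich L J)
    (norm_sandwich_le L hL J hJ)
  simp only [sandwich_apply, Pi.smul_apply', map_smul] at h
  refine ⟨h.1, h.2.trans ?_⟩
  rw [mul_assoc]
  gcongr
  exact h2

theorem IsOracle.sameCondMean_apply (hO : IsOracle ν A Ab v) (h𝓕 : 𝓕 ≤ 𝓖) (h𝓖 : 𝓖 ≤ mΩ)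
    (hZ : Measurable[mΩ] Z) (hlaw : Pr.map Z = ν)
    (hind : Indep 𝓖 (MeasurableSpace.comap Z inferInstance) Pr)
    (hY : Measurable[𝓖] Y) (hp : Measurable[𝓖] p) (hp2 : MemLp p 2 Pr)
    (L : H →L[ℝ] V) (hL : ∀ a, ‖L a‖ ≤ ‖a‖) (J : E' →L[ℝ] H') (hJ : ∀ b, ‖J b‖ ≤ ‖b‖) :
    SameCondMean Pr 𝓕 (fun ω => L ((A (Y ω) (Z ω) - Ab (Y ω)) (J (p ω)))) fun _ => 0 := by
  intro U hU hU2
  have h := hO.noise_orthogonal h𝓖 hZ hlaw hind hY hp hp2 (sandwich L J)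
    (norm_sandwich_le L hL J hJ) (hU.mono h𝓕 le_rfl) hU2
  simpa [sandwich_apply] using h

end Noise

/-! ### Averages with random weights -/

section RandomAverage

variable {Ω V : Type*} {𝓕 𝓖 : MeasurableSpace Ω} {mΩ : MeasurableSpace Ω} {Pr : Measure Ω}
  [IsProbabilityMeasure Pr]
  [NormedAddCommGroup V] [InnerProductSpace ℝ V] [MeasurableSpace V] [BorelSpace V]
  [SecondCountableTopology V]

theorem integral_mul_of_indep {w Q : Ω → ℝ} (hw : Measurable[mΩ] w) (hQ : Measurable[𝓖] Q)
    (hle : 𝓖 ≤ mΩ) (hind : Indep 𝓖 (MeasurableSpace.comap w inferInstance) Pr) :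
    ∫ ω, w ω * Q ω ∂Pr = (∫ ω, w ω ∂Pr) * ∫ ω, Q ω ∂Pr :=
  (indepFun_of_indep hQ hind).symm.integral_fun_mul_eq_mul_integral hw.aestronglyMeasurable
    (hQ.mono hle le_rfl).aestronglyMeasurable

/-- Jensen's inequality for sub-convex combinations. -/
theorem norm_weighted_sum_sq_le {ι : Type*} [Fintype ι] {w : ι → ℝ} (h0 : ∀ i, 0 ≤ w i)
    (h1 : ∑ i, w i ≤ 1) (v : ι → V) : ‖∑ i, w i • v i‖ ^ 2 ≤ ∑ i, w i * ‖v i‖ ^ 2 := by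
  have h2 : ‖∑ i, w i • v i‖ ≤ ∑ i, w i * ‖v i‖ :=
    (norm_sum_le _ _).trans_eq (Finset.sum_congr rfl fun i _ => by
      rw [norm_smul, Real.norm_of_nonneg (h0 i)])
  have h3 := Finset.sum_sq_le_sum_mul_sum_of_sq_le_mul Finset.univ (fun i _ => h0 i)
    (fun i _ => mul_nonneg (h0 i) (sq_nonneg ‖v i‖)) (r := fun i => w i * ‖v i‖)
    fun i _ => le_of_eq (by ring)
  have h4 : 0 ≤ ∑ i, w i * ‖v i‖ ^ 2 := Finset.sum_nonneg fun i _ =>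
    mul_nonneg (h0 i) (sq_nonneg _)
  calc _ ≤ (∑ i, w i * ‖v i‖) ^ 2 := by gcongr
    _ ≤ (∑ i, w i) * ∑ i, w i * ‖v i‖ ^ 2 := h3
    _ ≤ 1 * ∑ i, w i * ‖v i‖ ^ 2 := by gcongr
    _ = _ := one_mul _

variable {ι : Type*} [Fintype ι] [Nonempty ι] {w : ι → Ω → ℝ} {X : ι → Ω → V} {c : ℝ}

theorem memLp_weight_smul (h0 : ∀ i ω, 0 ≤ w i ω) (h1 : ∀ ω, ∑ i, w i ω ≤ 1)
    (hw : ∀ i, Measurable[mΩ] (w i)) (i : ι) {Y : Ω → V} (hY : MemLp Y 2 Pr) :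
    MemLp (fun ω => w i ω • Y ω) 2 Pr := by
  refine hY.mono ((hw i).aestronglyMeasurable.smul hY.1) (Filter.Eventually.of_forall fun ω => ?_)
  have h2 : w i ω ≤ 1 :=
    (Finset.single_le_sum (f := fun i => w i ω) (fun j _ => h0 j ω)
      (Finset.mem_univ i)).trans (h1 ω)
  rw [norm_smul, Real.norm_of_nonneg (h0 i ω)]
  exact mul_le_of_le_one_left (norm_nonneg _) h2

/-- A convex combination whose random weights have equal means and are independent of the
combined vectors does not increase conditional second moments (Jensen). -/
theorem condSized_random_average (h0 : ∀ i ω, 0 ≤ w i ω) (h1 : ∀ ω, ∑ i, w i ω ≤ 1)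
    (hw : ∀ i, Measurable[mΩ] (w i)) (h𝓕 : 𝓕 ≤ 𝓖) (h𝓖 : 𝓖 ≤ mΩ)
    (hind : ∀ i, Indep 𝓖 (MeasurableSpace.comap (w i) inferInstance) Pr)
    (hmean : ∀ i, ∫ ω, w i ω ∂Pr = (Fintype.card ι : ℝ)⁻¹) (hX : ∀ i, Measurable[𝓖] (X i))
    (hc : 0 ≤ c) (hXc : ∀ i, CondSized Pr 𝓕 c (X i)) :
    CondSized Pr 𝓕 c fun ω => ∑ i, w i ω • X i ω := by
  intro θ hθ hθ2
  have hn : (0 : ℝ) < Fintype.card ι := by exact_mod_cast Fintype.card_pos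
  have hL : ∀ i, MemLp (fun ω => θ ω • X i ω) 2 Pr := fun i => (hXc i θ hθ hθ2).1
  have hterm : ∀ i, MemLp (fun ω => w i ω • θ ω • X i ω) 2 Pr := fun i =>
    memLp_weight_smul h0 h1 hw i (hL i)
  have e : (fun ω => θ ω • ∑ i, w i ω • X i ω) = fun ω => ∑ i, w i ω • θ ω • X i ω := by
    ext ω
    rw [Finset.smul_sum]
    exact Finset.sum_congr rfl fun i _ => smul_comm _ _ _
  rw [e]
  have hmem : MemLp (fun ω => ∑ i, w i ω • θ ω • X i ω) 2 Pr :=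
    memLp_finsetSum _ fun i _ => hterm i
  have hint : ∀ i, Integrable (fun ω => w i ω * ‖θ ω • X i ω‖ ^ 2) Pr := fun i => by
    refine Integrable.bdd_mul (c := 1) (hL i).integrable_norm_sq (hw i).aestronglyMeasurable
      (Filter.Eventually.of_forall fun ω => ?_)
    rw [Real.norm_of_nonneg (h0 i ω)]
    exact (Finset.single_le_sum (f := fun i => w i ω) (fun j _ => h0 j ω)
      (Finset.mem_univ i)).trans (h1 ω)
  refine ⟨hmem, abs_le_of_sq_le_sq' ?_ (mul_nonneg hc lpNorm_nonneg) |>.2⟩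
  rw [lpNorm_two_sq hmem]
  calc _ ≤ ∫ ω, ∑ i, w i ω * ‖θ ω • X i ω‖ ^ 2 ∂Pr :=
        integral_mono hmem.integrable_norm_sq (integrable_finsetSum _ fun i _ => hint i)
          fun ω => norm_weighted_sum_sq_le (fun i => h0 i ω) (h1 ω) _
    _ = ∑ i, (Fintype.card ι : ℝ)⁻¹ * lpNorm (fun ω => θ ω • X i ω) 2 Pr ^ 2 := by
        rw [integral_finsetSum _ fun i _ => hint i]
        refine Finset.sum_congr rfl fun i _ => ?_
        have hQ : Measurable[𝓖] fun ω => ‖θ ω • X i ω‖ ^ 2 :=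
          (continuous_norm.pow 2).measurable.comp ((hθ.mono h𝓕 le_rfl).smul (hX i))
        rw [integral_mul_of_indep (hw i) hQ h𝓖 (hind i), hmean, lpNorm_two_sq (hL i)]
    _ ≤ ∑ _i : ι, (Fintype.card ι : ℝ)⁻¹ * (c * lpNorm θ 2 Pr) ^ 2 := by
        gcongr with i
        · exact lpNorm_nonneg
        · exact (hXc i θ hθ hθ2).2
    _ = (c * lpNorm θ 2 Pr) ^ 2 := by
        rw [Finset.sum_const, Finset.card_univ, nsmul_eq_mul, ← mul_assoc,
          mul_inv_cancel₀ hn.ne', one_mul]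

/-- Random weights of equal means that are independent of the combined vectors can be replaced by
those means. -/
theorem sameCondMean_random_average (h0 : ∀ i ω, 0 ≤ w i ω) (h1 : ∀ ω, ∑ i, w i ω ≤ 1)
    (hw : ∀ i, Measurable[mΩ] (w i)) (h𝓕 : 𝓕 ≤ 𝓖) (h𝓖 : 𝓖 ≤ mΩ)
    (hind : ∀ i, Indep 𝓖 (MeasurableSpace.comap (w i) inferInstance) Pr)
    (hmean : ∀ i, ∫ ω, w i ω ∂Pr = (Fintype.card ι : ℝ)⁻¹) (hX : ∀ i, Measurable[𝓖] (X i))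
    (hX2 : ∀ i, MemLp (X i) 2 Pr) :
    SameCondMean Pr 𝓕 (fun ω => ∑ i, w i ω • X i ω)
      fun ω => (Fintype.card ι : ℝ)⁻¹ • ∑ i, X i ω := by
  intro U hU hU2
  have hterm : ∀ i, MemLp (fun ω => w i ω • X i ω) 2 Pr := fun i =>
    memLp_weight_smul h0 h1 hw i (hX2 i)
  have hI : ∀ i, Integrable (fun ω => w i ω * ⟪U ω, X i ω⟫) Pr := fun i => by
    simpa only [inner_smul_right] using integrable_inner hU2 (hterm i)
  simp only [inner_sum, inner_smul_right]
  rw [integral_const_mul, integral_finsetSum _ fun i _ => integrable_inner hU2 (hX2 i),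
    integral_finsetSum _ fun i _ => hI i, Finset.mul_sum]
  refine Finset.sum_congr rfl fun i _ => ?_
  have hQ : Measurable[𝓖] fun ω => ⟪U ω, X i ω⟫ := (hU.mono h𝓕 le_rfl).inner (hX i)
  rw [integral_mul_of_indep (hw i) hQ h𝓖 (hind i), hmean]

end RandomAverage

/-! ### Variance-reduced local updates -/

section LocalUpdates

variable {Ω Ζ Z' V : Type*} {𝓕₀ : MeasurableSpace Ω} {mΩ : MeasurableSpace Ω} {Pr : Measure Ω}
  [IsProbabilityMeasure Pr] [MeasurableSpace Ζ]
  [NormedAddCommGroup Z'] [InnerProductSpace ℝ Z'] [MeasurableSpace Z'] [BorelSpace Z']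
  [SecondCountableTopology Z'] [CompleteSpace Z']
  [NormedAddCommGroup V] [InnerProductSpace ℝ V] [MeasurableSpace V] [BorelSpace V]
  [SecondCountableTopology V] [CompleteSpace V]
  {ν₀ : Measure Ζ} {G : Z' → Ζ → Z'} {Gb : Z' → Z'} {v lip : ℝ}

/-- The increment of a client after its local steps is `-s` times the global direction `h`, plus a
centred noise, plus a drift proportional to the stepsize. The local samples are `Z ν`, and the
local variable `v` sits at the point `base + J v`. -/
theorem local_updates {𝓕 : ℕ → MeasurableSpace Ω} (h𝓕₀ : 𝓕 0 = 𝓕₀) (hmono : Monotone 𝓕)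
    (hle : ∀ ν, 𝓕 ν ≤ mΩ) (hO : IsOracle ν₀ G Gb v)
    (hlip : ∀ z z', ‖Gb z - Gb z'‖ ≤ lip * ‖z - z'‖) (hlip0 : 0 ≤ lip)
    {Z : ℕ → Ω → Ζ} (hZ : ∀ ν, Measurable[𝓕 (ν + 1)] (Z ν)) (hlaw : ∀ ν, Pr.map (Z ν) = ν₀)
    (hind : ∀ ν, Indep (𝓕 ν) (MeasurableSpace.comap (Z ν) inferInstance) Pr)
    (L : Z' →L[ℝ] V) (hL : ∀ z, ‖L z‖ ≤ ‖z‖) (J : V →L[ℝ] Z') (hJ : ∀ v, ‖J v‖ = ‖v‖)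
    {base : Ω → Z'} (hbase : Measurable[𝓕₀] base) {u : ℕ → Ω → V} {u₀ h : Ω → V}
    (huu : u 0 = u₀)
    (hu0 : Measurable[𝓕₀] u₀) (hh : Measurable[𝓕₀] h) {s : ℝ} (hs : 0 ≤ s) {τ : ℕ}
    (hτ : 1 ≤ τ)
    (hrec : ∀ ν ω, u (ν + 1) ω = u ν ω - (s / τ) • (L (G (base ω + J (u ν ω)) (Z ν ω))
      - L (G (base ω + J (u₀ ω)) (Z ν ω)) + h ω))
    (hsmall : s * lip ≤ 1 / 2) :
    ∃ n d : Ω → V, (∀ ω, u τ ω = u₀ ω - s • (h ω + n ω + d ω)) ∧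
      CondSized Pr 𝓕₀ (2 * √v) n ∧ SameCondMean Pr 𝓕₀ n (fun _ => 0) ∧
      ∀ θ : Ω → ℝ, Measurable[𝓕₀] θ → MemLp θ 2 Pr → MemLp (fun ω => θ ω • h ω) 2 Pr →
        MemLp (fun ω => θ ω • d ω) 2 Pr ∧ lpNorm (fun ω => θ ω • d ω) 2 Pr
          ≤ 2 * lip * s * (2 * √v * lpNorm θ 2 Pr + lpNorm (fun ω => θ ω • h ω) 2 Pr) := by
  subst h𝓕₀ huu
  have hτ0 : (0 : ℝ) < τ := by exact_mod_cast hτ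
  have h0le : ∀ ν, 𝓕 0 ≤ 𝓕 ν := fun ν => hmono (Nat.zero_le ν)
  have hZm : ∀ ν, Measurable[mΩ] (Z ν) := fun ν => (hZ ν).mono (hle _) le_rfl
  -- all iterates are adapted
  have hpt : ∀ ν {y : Ω → V}, Measurable[𝓕 ν] y → Measurable[𝓕 ν] fun ω => base ω + J (y ω) :=
    fun ν y hy => (hbase.mono (h0le ν) le_rfl).add (J.continuous.measurable.comp hy)
  have hu : ∀ ν, Measurable[𝓕 ν] (u ν) := by
    intro ν
    induction ν with
    | zero => exact hu0
    | succ ν ih =>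
      have e : u (ν + 1) = fun ω => u ν ω - (s / τ) • (L (G (base ω + J (u ν ω)) (Z ν ω))
        - L (G (base ω + J (u 0 ω)) (Z ν ω)) + h ω) := funext (hrec ν)
      have h1 := ih.mono (hmono (Nat.le_succ ν)) le_rfl
      have h2 := hu0.mono (h0le (ν + 1)) le_rfl
      have h3 := hh.mono (h0le (ν + 1)) le_rfl
      rw [e]
      exact h1.sub ((((L.continuous.measurable.comp
        (hO.meas.comp ((hpt (ν + 1) h1).prodMk (hZ ν)))).sub (L.continuous.measurable.comp
        (hO.meas.comp ((hpt (ν + 1) h2).prodMk (hZ ν))))).add h3).const_smul _)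
  let A : ℕ → Ω → V := fun ν ω =>
    L (G (base ω + J (u ν ω)) (Z ν ω) - Gb (base ω + J (u ν ω)))
  let A₀ : ℕ → Ω → V := fun ν ω =>
    L (G (base ω + J (u 0 ω)) (Z ν ω) - Gb (base ω + J (u 0 ω)))
  let D : ℕ → Ω → V := fun ν ω => L (Gb (base ω + J (u ν ω)) - Gb (base ω + J (u 0 ω)))
  have hA : ∀ ν, CondSized Pr (𝓕 0) (2 * √v) fun ω => A ν ω - A₀ ν ω := fun ν => by
    rw [two_mul]
    exact ((hO.condSized (hle ν) (hZm ν) (hlaw ν) (hind ν) (hpt ν (hu ν)) L hL).sub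
      (hO.condSized (hle ν) (hZm ν) (hlaw ν) (hind ν)
        (hpt ν (hu0.mono (h0le ν) le_rfl)) L hL)).mono_sigma (h0le ν)
  have hA0 : ∀ ν, SameCondMean Pr (𝓕 0) (fun ω => A ν ω - A₀ ν ω) fun _ => 0 := fun ν => by
    have a1 := hO.condSized (hle ν) (hZm ν) (hlaw ν) (hind ν) (hpt ν (hu ν)) L hL
    have a2 := hO.condSized (hle ν) (hZm ν) (hlaw ν) (hind ν)
      (hpt ν (hu0.mono (h0le ν) le_rfl)) L hL
    have b1 := hO.sameCondMean (hle ν) (hZm ν) (hlaw ν) (hind ν) (hpt ν (hu ν)) L hL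
    have b2 := hO.sameCondMean (hle ν) (hZm ν) (hlaw ν) (hind ν)
      (hpt ν (hu0.mono (h0le ν) le_rfl)) L hL
    have := (b1.sub b2 a1.memLp (memLp_const 0) a2.memLp (memLp_const 0)).mono_sigma (h0le ν)
    simpa only [sub_zero] using this
  have hD : ∀ ν ω, ‖D ν ω‖ ≤ lip * ‖u ν ω - u 0 ω‖ := fun ν ω => by
    refine (hL _).trans ((hlip _ _).trans_eq ?_)
    rw [add_sub_add_left_eq_sub, ← map_sub, hJ]
  have hDm : ∀ ν, Measurable[mΩ] (D ν) := fun ν =>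
    L.continuous.measurable.comp ((hO.meas_mean.comp ((hpt ν (hu ν)).mono (hle ν) le_rfl)).sub
      (hO.meas_mean.comp ((hpt 0 hu0).mono (hle 0) le_rfl)))
  have hstep : ∀ ν ω, u (ν + 1) ω = u ν ω - (s / τ) • ((A ν ω - A₀ ν ω) + D ν ω + h ω) := by
    intro ν ω
    rw [hrec]
    congr 2
    simp only [A, A₀, D, map_sub]
    abel
  -- the distance travelled by the local iterates, by induction on the number of steps
  have htravel : ∀ θ : Ω → ℝ, Measurable[𝓕 0] θ → MemLp θ 2 Pr → MemLp (fun ω => θ ω • h ω) 2 Pr →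
      ∀ ν ≤ τ, MemLp (fun ω => θ ω • (u ν ω - u 0 ω)) 2 Pr ∧
        lpNorm (fun ω => θ ω • (u ν ω - u 0 ω)) 2 Pr ≤ 2 * ν * (s / τ) *
          (2 * √v * lpNorm θ 2 Pr + lpNorm (fun ω => θ ω • h ω) 2 Pr) := by
    intro θ hθ hθ2 hθh ν
    set c := 2 * √v * lpNorm θ 2 Pr + lpNorm (fun ω => θ ω • h ω) 2 Pr with hc
    have hc0 : 0 ≤ c := by
      have h1 : 0 ≤ lpNorm θ 2 Pr := lpNorm_nonneg
      have h2 : 0 ≤ lpNorm (fun ω => θ ω • h ω) 2 Pr := lpNorm_nonneg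
      positivity
    induction ν with
    | zero => intro _; simp
    | succ ν ih =>
      intro hν
      obtain ⟨i1, i2⟩ := ih (Nat.le_of_succ_le hν)
      obtain ⟨n1, n2⟩ := hA ν θ hθ hθ2
      have hDb : ∀ ω, ‖θ ω • D ν ω‖ ≤ ‖lip • θ ω • (u ν ω - u 0 ω)‖ := fun ω => by
        rw [norm_smul, norm_smul, norm_smul, Real.norm_of_nonneg hlip0, mul_left_comm]
        gcongr
        exact hD ν ω
      have i3 := i1.const_smul lip
      have d1 : MemLp (fun ω => θ ω • D ν ω) 2 Pr :=
        i3.mono ((hθ.mono (hle 0) le_rfl).smul (hDm ν)).aestronglyMeasurable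
          (Filter.Eventually.of_forall hDb)
      have d2 : lpNorm (fun ω => θ ω • D ν ω) 2 Pr
          ≤ lip * lpNorm (fun ω => θ ω • (u ν ω - u 0 ω)) 2 Pr := by
        refine (lpNorm_two_mono i3 hDb).trans_eq ((lpNorm_two_smul lip _).trans ?_)
        rw [abs_of_nonneg hlip0]
      have e : (fun ω => θ ω • (u (ν + 1) ω - u 0 ω)) = fun ω => θ ω • (u ν ω - u 0 ω)
          - (s / τ) • (θ ω • (A ν ω - A₀ ν ω) + θ ω • D ν ω + θ ω • h ω) := by
        ext1 ω
        rw [hstep, ← smul_add, ← smul_add, smul_comm (s / (τ : ℝ)), ← smul_sub]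
        congr 1
        abel
      have m1 : MemLp (fun ω => θ ω • (A ν ω - A₀ ν ω) + θ ω • D ν ω) 2 Pr := n1.add d1
      have m2 : MemLp (fun ω => θ ω • (A ν ω - A₀ ν ω) + θ ω • D ν ω + θ ω • h ω) 2 Pr :=
        m1.add hθh
      rw [e]
      refine ⟨i1.sub (m2.const_smul _), ?_⟩
      have hst : 0 ≤ s / τ := by positivity
      have hνle : ν * (s / τ) ≤ s := by
        rw [mul_div_assoc', div_le_iff₀ hτ0, mul_comm]
        gcongr
        exact_mod_cast Nat.le_of_succ_le hν
      set a := lpNorm (fun ω => θ ω • (u ν ω - u 0 ω)) 2 Pr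
      have h1 : lpNorm (fun ω => θ ω • (A ν ω - A₀ ν ω) + θ ω • D ν ω + θ ω • h ω) 2 Pr
          ≤ lip * a + c := by
        refine (lpNorm_two_add_le m1).trans ?_
        have := lpNorm_two_add_le (Y := fun ω => θ ω • D ν ω) n1
        rw [hc]
        linarith
      -- the feedback term is at most half of the bound since `s * lip ≤ 1 / 2`
      have h2 : lip * a ≤ c := by
        calc lip * a ≤ lip * (2 * ν * (s / τ) * c) := by gcongr
          _ = lip * (ν * (s / τ)) * (2 * c) := by ring
          _ ≤ lip * s * (2 * c) := by gcongr
          _ ≤ 1 / 2 * (2 * c) := by gcongr; linarith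
          _ = c := by ring
      calc _ ≤ a + (s / τ) * (lip * a + c) := by
            refine (lpNorm_two_sub_le i1).trans ?_
            rw [lpNorm_two_smul, abs_of_nonneg hst]
            gcongr
        _ ≤ 2 * ν * (s / τ) * c + (s / τ) * (c + c) := by gcongr
        _ = _ := by push_cast; ring
  have hne : Nonempty (Fin τ) := ⟨⟨0, hτ⟩⟩
  have hcard : (Fintype.card (Fin τ) : ℝ) = τ := by simp
  refine ⟨fun ω => (Fintype.card (Fin τ) : ℝ)⁻¹ • ∑ ν : Fin τ, (A ν ω - A₀ ν ω),
    fun ω => (Fintype.card (Fin τ) : ℝ)⁻¹ • ∑ ν : Fin τ, D ν ω, ?_, CondSized.avg fun ν => hA ν,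
    ?_, ?_⟩
  · intro ω
    have hsum : ∀ ν, u ν ω = u 0 ω
        - (s / τ) • ∑ j ∈ Finset.range ν, ((A j ω - A₀ j ω) + D j ω + h ω) := by
      intro ν
      induction ν with
      | zero => simp
      | succ ν ih => rw [hstep, ih, Finset.sum_range_succ, sub_sub, ← smul_add]
    rw [hsum τ, hcard, Finset.sum_range, Finset.sum_add_distrib, Finset.sum_add_distrib,
      Finset.sum_const, Finset.card_univ, Fintype.card_fin, ← Nat.cast_smul_eq_nsmul ℝ,
      div_eq_mul_inv,
      mul_smul]
    congr 2
    rw [smul_add, smul_add, smul_smul, inv_mul_cancel₀ hτ0.ne', one_smul]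
    abel
  · have := (SameCondMean.sum (fun ν : Fin τ => hA0 ν) (fun ν => (hA ν).memLp)
      (fun ν => memLp_const 0)).const_smul (Fintype.card (Fin τ) : ℝ)⁻¹
    simpa using this
  · intro θ hθ hθ2 hθh
    set c := 2 * √v * lpNorm θ 2 Pr + lpNorm (fun ω => θ ω • h ω) 2 Pr with hc
    have hc0 : 0 ≤ c := by
      have h1 : 0 ≤ lpNorm θ 2 Pr := lpNorm_nonneg
      have h2 : 0 ≤ lpNorm (fun ω => θ ω • h ω) 2 Pr := lpNorm_nonneg
      positivity
    have hDν : ∀ ν : Fin τ, MemLp (fun ω => θ ω • D ν ω) 2 Pr ∧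
        lpNorm (fun ω => θ ω • D ν ω) 2 Pr ≤ 2 * lip * s * c := by
      intro ν
      obtain ⟨i1, i2⟩ := htravel θ hθ hθ2 hθh ν ν.2.le
      have hDb : ∀ ω, ‖θ ω • D ν ω‖ ≤ ‖lip • θ ω • (u ν ω - u 0 ω)‖ := fun ω => by
        rw [norm_smul, norm_smul, norm_smul, Real.norm_of_nonneg hlip0, mul_left_comm]
        gcongr
        exact hD ν ω
      have i3 := i1.const_smul lip
      refine ⟨i3.mono ((hθ.mono (hle 0) le_rfl).smul (hDm ν)).aestronglyMeasurable
        (Filter.Eventually.of_forall hDb), ?_⟩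
      have hνle : (ν : ℕ) * (s / τ) ≤ s := by
        rw [mul_div_assoc', div_le_iff₀ hτ0, mul_comm]
        gcongr
        exact_mod_cast ν.2.le
      calc _ ≤ lip * lpNorm (fun ω => θ ω • (u ν ω - u 0 ω)) 2 Pr := by
            refine (lpNorm_two_mono i3 hDb).trans_eq ((lpNorm_two_smul lip _).trans ?_)
            rw [abs_of_nonneg hlip0]
        _ ≤ lip * (2 * ν * (s / τ) * c) := by gcongr
        _ = lip * (ν * (s / τ)) * (2 * c) := by ring
        _ ≤ lip * s * (2 * c) := by gcongr
        _ = _ := by ring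
    have e : (fun ω => θ ω • (Fintype.card (Fin τ) : ℝ)⁻¹ • ∑ ν : Fin τ, D ν ω)
        = fun ω => (Fintype.card (Fin τ) : ℝ)⁻¹ • ∑ ν : Fin τ, θ ω • D ν ω := by
      ext1 ω; rw [smul_comm, Finset.smul_sum]
    rw [e]
    exact ⟨memLp_avg fun ν => (hDν ν).1, lpNorm_avg_le (fun ν => (hDν ν).1) fun ν => (hDν ν).2⟩

end LocalUpdates

/-! ### The history of the random draws -/

section History

variable {m : ℕ} {Ξ Ζ Ω : Type*} [MeasurableSpace Ξ] [MeasurableSpace Ζ]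

/-- The sigma-algebra generated by the draws with index in `S`. -/
@[reducible] def past (W : Ω → Draws m Ξ Ζ) (S : Set (DrawIdx m)) : MeasurableSpace Ω :=
  ⨆ j ∈ S, DrawIdx.sigma W j

theorem sigma_le_past {W : Ω → Draws m Ξ Ζ} {S : Set (DrawIdx m)} {j : DrawIdx m} (hj : j ∈ S) :
    DrawIdx.sigma W j ≤ past W S :=
  le_biSup (DrawIdx.sigma W) hj

theorem past_mono {W : Ω → Draws m Ξ Ζ} {S S' : Set (DrawIdx m)} (h : S ⊆ S') :
    past W S ≤ past W S' :=
  biSup_mono h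

/-- The outer round in which a draw is made. -/
def DrawIdx.round : DrawIdx m → ℕ
  | .innerAnchor k _ _ => k
  | .innerLocal k _ _ _ => k
  | .outerAnchor k _ => k
  | .outerJac k _ => k
  | .outerLocal k _ _ => k
  | .len k => k
  | .subset k _ => k
  | .ihgpGrad k _ => k
  | .ihgpHess k _ _ => k

/-- The draws made before outer round `k`. -/
def drawsBefore (m k : ℕ) : Set (DrawIdx m) := {j | j.round < k}

/-- The draws made by the inner optimizer in outer round `k` before inner round `t`. -/
def innerDraws (m k t : ℕ) : Set (DrawIdx m) :=
  {j | ∃ t' < t, ∃ i, j = .innerAnchor k t' i ∨ ∃ ν, j = .innerLocal k t' i ν}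

namespace FedProblem.IsSampling

variable {d₁ d₂ : ℕ} {P : FedProblem m d₁ d₂ Ξ Ζ} {mΩ : MeasurableSpace Ω} {Pr : Measure Ω} {N : ℕ}
  {W : Ω → Draws m Ξ Ζ} (hS : P.IsSampling Pr N W)
include hS

theorem sigma_le (j : DrawIdx m) : DrawIdx.sigma W j ≤ mΩ := by
  cases j with
  | innerAnchor k t i => exact (hS.innerAnchor_meas k t i).comap_le
  | innerLocal k t i ν => exact (hS.innerLocal_meas k t i ν).comap_le
  | outerAnchor k i => exact (hS.outerAnchor_meas k i).comap_le
  | outerJac k i => exact (hS.outerJac_meas k i).comap_le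
  | outerLocal k i ν => exact (hS.outerLocal_meas k i ν).comap_le
  | len k => exact (hS.len_meas k).comap_le
  | subset k n =>
    rintro s ⟨A, -, rfl⟩
    have : (fun ω => (W ω).subset k n) ⁻¹' A = ⋃ B ∈ A, {ω | (W ω).subset k n = B} := by
      ext ω; simp
    rw [this]
    exact MeasurableSet.biUnion (Set.to_countable A) fun B _ => hS.subset_meas k n B
  | ihgpGrad k i => exact (hS.ihgpGrad_meas k i).comap_le
  | ihgpHess k n i => exact (hS.ihgpHess_meas k n i).comap_le

theorem past_le (S : Set (DrawIdx m)) : past W S ≤ mΩ :=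
  iSup₂_le fun j _ => hS.sigma_le j

theorem indep_past {S : Set (DrawIdx m)} {j : DrawIdx m} (hj : j ∉ S) :
    Indep (past W S) (DrawIdx.sigma W j) Pr := by
  have h := indep_iSup_of_disjoint hS.sigma_le hS.indep (Set.disjoint_singleton_right.2 hj)
  simpa [past] using h

end FedProblem.IsSampling

end History

/-! ### The sample gradients and Hessians as oracles -/

namespace FedProblem

variable {m d₁ d₂ : ℕ} {Ξ Ζ : Type*} [MeasurableSpace Ξ] [MeasurableSpace Ζ]
variable {P : FedProblem m d₁ d₂ Ξ Ζ} {lf0 lf1 lg1 lg2 mug vf vg1 vg2 : ℝ}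

theorem StochasticSamples.oracle_gradF (hQ : P.StochasticSamples vf vg1 vg2)
    (hP : P.WellBehaved lf0 lf1 lg1 lg2 mug) (i : Fin m) :
    IsOracle (P.C i) (fun z ξ => gradient (P.f i ξ) z) (gradient (P.outerFun i)) vf where
  prob := hQ.C_prob i
  meas := hQ.f_grad_meas i
  meas_mean := (continuous_of_norm_sub_le (hP.f_grad_lip i)).measurable
  sq := hQ.f_grad_sq i
  unbiased := hQ.f_grad_unbiased i
  var_le := hQ.f_grad_var i

theorem StochasticSamples.oracle_gradG (hQ : P.StochasticSamples vf vg1 vg2)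
    (hP : P.WellBehaved lf0 lf1 lg1 lg2 mug) (i : Fin m) :
    IsOracle (P.D i) (fun z ζ => gradient (P.g i ζ) z) (gradient (P.innerFun i)) vg1 where
  prob := hQ.D_prob i
  meas := hQ.g_grad_meas i
  meas_mean := (continuous_of_norm_sub_le (hP.g_grad_lip i)).measurable
  sq := hQ.g_grad_sq i
  unbiased := hQ.g_grad_unbiased i
  var_le := hQ.g_grad_var i

theorem StochasticSamples.oracle_hessG (hQ : P.StochasticSamples vf vg1 vg2)
    (hP : P.WellBehaved lf0 lf1 lg1 lg2 mug) (i : Fin m) :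
    IsOracle (P.D i) (fun z ζ => hess (P.g i ζ) z) (hess (P.innerFun i)) vg2 where
  prob := hQ.D_prob i
  meas := hQ.g_hess_meas i
  meas_mean := (continuous_of_norm_sub_le (hP.g_hess_lip i)).measurable
  sq := hQ.g_hess_sq i
  unbiased := hQ.g_hess_unbiased i
  var_le := hQ.g_hess_var i

end FedProblem

theorem continuous_pt {d₁ d₂ : ℕ} :
    Continuous fun p : Vec d₁ × Vec d₂ => (pt p.1 p.2 : Pt d₁ d₂) := by
  simp only [pt_eq]
  fun_prop

theorem Measurable.pt {Ω : Type*} {mΩ : MeasurableSpace Ω} {d₁ d₂ : ℕ} {x : Ω → Vec d₁}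
    {y : Ω → Vec d₂} (hx : Measurable x) (hy : Measurable y) :
    Measurable fun ω => pt (x ω) (y ω) :=
  continuous_pt.measurable.comp (hx.prodMk hy)

/-! ### Averaging local updates over the clients -/

section FedUpdates

variable {Ω Ζ Z' V : Type*} {𝓕₀ : MeasurableSpace Ω} {mΩ : MeasurableSpace Ω} {Pr : Measure Ω}
  [IsProbabilityMeasure Pr] [MeasurableSpace Ζ]
  [NormedAddCommGroup Z'] [InnerProductSpace ℝ Z'] [MeasurableSpace Z'] [BorelSpace Z']
  [SecondCountableTopology Z'] [CompleteSpace Z']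
  [NormedAddCommGroup V] [InnerProductSpace ℝ V] [MeasurableSpace V] [BorelSpace V]
  [SecondCountableTopology V] [CompleteSpace V]
  {m : ℕ} {ν₀ : Fin m → Measure Ζ} {G : Fin m → Z' → Ζ → Z'} {Gb : Fin m → Z' → Z'} {v lip : ℝ}

/-- The average over the clients of the increments described by `local_updates`. -/
theorem averaged_local_updates (hm : 0 < m) {𝓕 : Fin m → ℕ → MeasurableSpace Ω}
    (h𝓕₀ : ∀ i, 𝓕 i 0 = 𝓕₀) (hmono : ∀ i, Monotone (𝓕 i)) (hle : ∀ i ν, 𝓕 i ν ≤ mΩ)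
    (hO : ∀ i, IsOracle (ν₀ i) (G i) (Gb i) v)
    (hlip : ∀ i z z', ‖Gb i z - Gb i z'‖ ≤ lip * ‖z - z'‖) (hlip0 : 0 ≤ lip)
    {Z : Fin m → ℕ → Ω → Ζ} (hZ : ∀ i ν, Measurable[𝓕 i (ν + 1)] (Z i ν))
    (hlaw : ∀ i ν, Pr.map (Z i ν) = ν₀ i)
    (hind : ∀ i ν, Indep (𝓕 i ν) (MeasurableSpace.comap (Z i ν) inferInstance) Pr)
    (L : Z' →L[ℝ] V) (hL : ∀ z, ‖L z‖ ≤ ‖z‖) (J : V →L[ℝ] Z') (hJ : ∀ v, ‖J v‖ = ‖v‖)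
    {base : Ω → Z'} (hbase : Measurable[𝓕₀] base) {u : Fin m → ℕ → Ω → V} {u₀ h : Ω → V}
    (huu : ∀ i, u i 0 = u₀) (hu0 : Measurable[𝓕₀] u₀) (hh : Measurable[𝓕₀] h)
    {s : ℝ} (hs : 0 ≤ s) {τ : Fin m → ℕ} (hτ : ∀ i, 1 ≤ τ i)
    (hrec : ∀ i ν ω, u i (ν + 1) ω = u i ν ω - (s / τ i) • (L (G i (base ω + J (u i ν ω)) (Z i ν ω))
      - L (G i (base ω + J (u₀ ω)) (Z i ν ω)) + h ω))
    (hsmall : s * lip ≤ 1 / 2) :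
    ∃ n d : Ω → V, (∀ ω, (m : ℝ)⁻¹ • ∑ i, u i (τ i) ω = u₀ ω - s • (h ω + n ω + d ω)) ∧
      CondSized Pr 𝓕₀ (2 * √v) n ∧ SameCondMean Pr 𝓕₀ n (fun _ => 0) ∧
      ∀ θ : Ω → ℝ, Measurable[𝓕₀] θ → MemLp θ 2 Pr → MemLp (fun ω => θ ω • h ω) 2 Pr →
        MemLp (fun ω => θ ω • d ω) 2 Pr ∧ lpNorm (fun ω => θ ω • d ω) 2 Pr
          ≤ 2 * lip * s * (2 * √v * lpNorm θ 2 Pr + lpNorm (fun ω => θ ω • h ω) 2 Pr) := by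
  have hloc := fun i => local_updates (h𝓕₀ i) (hmono i) (hle i) (hO i) (hlip i) hlip0 (hZ i)
    (hlaw i) (hind i) L hL J hJ hbase (huu i) hu0 hh hs (hτ i) (hrec i) hsmall
  choose n d hnd hn hn0 hd using hloc
  have hne : Nonempty (Fin m) := ⟨⟨0, hm⟩⟩
  have hcard : (Fintype.card (Fin m) : ℝ) = m := by simp
  have hm0 : (m : ℝ) ≠ 0 := by exact_mod_cast hm.ne'
  refine ⟨fun ω => (Fintype.card (Fin m) : ℝ)⁻¹ • ∑ i, n i ω,
    fun ω => (Fintype.card (Fin m) : ℝ)⁻¹ • ∑ i, d i ω, ?_, CondSized.avg hn, ?_, ?_⟩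
  · intro ω
    simp only [hnd, hcard]
    have e : (m : ℝ)⁻¹ • ∑ i, (h ω + n i ω + d i ω)
        = h ω + (m : ℝ)⁻¹ • ∑ i, n i ω + (m : ℝ)⁻¹ • ∑ i, d i ω := by
      rw [Finset.sum_add_distrib, Finset.sum_add_distrib, smul_add, smul_add, avg_const hm]
    rw [← e, Finset.sum_sub_distrib, ← Finset.smul_sum, smul_sub, avg_const hm, smul_comm]
  · have := (SameCondMean.sum hn0 (fun i => (hn i).memLp)
      (fun i => memLp_const 0)).const_smul (Fintype.card (Fin m) : ℝ)⁻¹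
    simpa only [Finset.sum_const_zero, smul_zero] using this
  · intro θ hθ hθ2 hθh
    have e : (fun ω => θ ω • (Fintype.card (Fin m) : ℝ)⁻¹ • ∑ i, d i ω)
        = fun ω => (Fintype.card (Fin m) : ℝ)⁻¹ • ∑ i, θ ω • d i ω := by
      ext1 ω; rw [smul_comm, Finset.smul_sum]
    rw [e]
    exact ⟨memLp_avg fun i => (hd i θ hθ hθ2 hθh).1,
      lpNorm_avg_le (fun i => (hd i θ hθ hθ2 hθh).1) fun i => (hd i θ hθ hθ2 hθh).2⟩

end FedUpdates

/-! ### The inner optimizer -/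

namespace FedProblem

variable {m d₁ d₂ : ℕ} {Ξ Ζ Ω : Type*} [MeasurableSpace Ξ] [MeasurableSpace Ζ]
  {mΩ : MeasurableSpace Ω} {Pr : Measure Ω} [IsProbabilityMeasure Pr]
  {P : FedProblem m d₁ d₂ Ξ Ζ} {lf0 lf1 lg1 lg2 mug vf vg1 vg2 : ℝ} {N : ℕ} {W : Ω → Draws m Ξ Ζ}

theorem WellBehaved.gradY_innerAvg (hP : P.WellBehaved lf0 lf1 lg1 lg2 mug) (z : Pt d₁ d₂) :
    gradY P.innerAvg z = (m : ℝ)⁻¹ • ∑ i, gradY (P.innerFun i) z := by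
  rw [gradY_eq, hP.gradient_innerAvg, map_smul, map_sum]; rfl

theorem WellBehaved.gradY_outerAvg (hP : P.WellBehaved lf0 lf1 lg1 lg2 mug) (z : Pt d₁ d₂) :
    gradY P.outerAvg z = (m : ℝ)⁻¹ • ∑ i, gradY (P.outerFun i) z := by
  rw [gradY_eq, hP.gradient_outerAvg, map_smul, map_sum]; rfl

theorem WellBehaved.gradX_outerAvg (hP : P.WellBehaved lf0 lf1 lg1 lg2 mug) (z : Pt d₁ d₂) :
    gradX P.outerAvg z = (m : ℝ)⁻¹ • ∑ i, gradX (P.outerFun i) z := by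
  rw [gradX_eq, hP.gradient_outerAvg, map_smul, map_sum]; rfl

/-- One round of the inner optimizer moves by `-β` times the exact gradient, plus a centred noise,
plus a drift of order `β` caused by the movement of the local iterates. The noise combines the
anchor samples, which enter through the global direction, with the local samples. -/
theorem fedInn_direction (hm : 0 < m) (hP : P.WellBehaved lf0 lf1 lg1 lg2 mug) (hlg1 : 0 ≤ lg1)
    (hQ : P.StochasticSamples vf vg1 vg2) (hS : P.IsSampling Pr N W) {S : Set (DrawIdx m)}
    {k t : ℕ} (hS1 : ∀ i, DrawIdx.innerAnchor k t i ∉ S)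
    (hS2 : ∀ i ν, DrawIdx.innerLocal k t i ν ∉ S)
    {x : Ω → Vec d₁} {y : Ω → Vec d₂} (hx : Measurable[past W S] x) (hy : Measurable[past W S] y)
    {β : ℝ} (hβ : 0 ≤ β) (hsmall : β * lg1 ≤ 1 / 2) {τ : Fin m → ℕ} (hτ : ∀ i, 1 ≤ τ i)
    (hg : MemLp (fun ω => gradY P.innerAvg (pt (x ω) (y ω))) 2 Pr) :
    ∃ n d : Ω → Vec d₂, (∀ ω, P.fedInn τ β (x ω) (y ω) ((W ω).innerAnchor k t)
        ((W ω).innerLocal k t)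
        = y ω - β • (gradY P.innerAvg (pt (x ω) (y ω)) + n ω + d ω)) ∧
      MemLp n 2 Pr ∧ lpNorm n 2 Pr ≤ 3 * √vg1 ∧ SameCondMean Pr (past W S) n (fun _ => 0) ∧
      MemLp d 2 Pr ∧ lpNorm d 2 Pr ≤ 2 * lg1 * β *
        (3 * √vg1 + lpNorm (fun ω => gradY P.innerAvg (pt (x ω) (y ω))) 2 Pr) := by
  have hne : Nonempty (Fin m) := ⟨⟨0, hm⟩⟩
  have hcard : (Fintype.card (Fin m) : ℝ) = m := by simp
  have hz : Measurable[past W S] fun ω => pt (x ω) (y ω) := hx.pt hy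
  let a : Fin m → Ω → Vec d₂ := fun i ω => prY (gradient (P.g i ((W ω).innerAnchor k t i))
    (pt (x ω) (y ω)) - gradient (P.innerFun i) (pt (x ω) (y ω)))
  let q : Ω → Vec d₂ := fun ω =>
    (m : ℝ)⁻¹ • ∑ i, gradY (P.g i ((W ω).innerAnchor k t i)) (pt (x ω) (y ω))
  let nq : Ω → Vec d₂ := fun ω => (Fintype.card (Fin m) : ℝ)⁻¹ • ∑ i, a i ω
  have hq : ∀ ω, q ω = gradY P.innerAvg (pt (x ω) (y ω)) + nq ω := by
    intro ω
    simp only [q, nq, a, map_sub, ← gradY_eq, hcard]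
    rw [hP.gradY_innerAvg, ← smul_add, ← Finset.sum_add_distrib]
    simp
  have ha : ∀ i, CondSized Pr (past W S) (√vg1) (a i) := fun i =>
    (hQ.oracle_gradG hP i).condSized (hS.past_le S) (hS.innerAnchor_meas k t i)
      (hS.innerAnchor_law k t i) (hS.indep_past (hS1 i)) hz prY norm_prY_le
  have ha0 : ∀ i, SameCondMean Pr (past W S) (a i) fun _ => 0 := fun i =>
    (hQ.oracle_gradG hP i).sameCondMean (hS.past_le S) (hS.innerAnchor_meas k t i)
      (hS.innerAnchor_law k t i) (hS.indep_past (hS1 i)) hz prY norm_prY_le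
  have hnq : CondSized Pr (past W S) (√vg1) nq := CondSized.avg ha
  have hnq0 : SameCondMean Pr (past W S) nq fun _ => 0 := by
    have := (SameCondMean.sum ha0 (fun i => (ha i).memLp)
      (fun i => memLp_const 0)).const_smul (Fintype.card (Fin m) : ℝ)⁻¹
    simpa only [Finset.sum_const_zero, smul_zero] using this
  -- the local phase starts after the anchor samples are drawn
  let S₁ : Set (DrawIdx m) := S ∪ {j | ∃ i, j = .innerAnchor k t i}
  let S₂ : Fin m → ℕ → Set (DrawIdx m) := fun i ν => S₁ ∪ {j | ∃ ν' < ν, j = .innerLocal k t i ν'}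
  have hSS : S ⊆ S₁ := Set.subset_union_left
  have hqm : Measurable[past W S₁] q := by
    have h1 : ∀ i, Measurable[past W S₁] fun ω => (W ω).innerAnchor k t i := fun i =>
      (comap_measurable _).mono (sigma_le_past (j := .innerAnchor k t i)
        (Or.inr ⟨i, rfl⟩)) le_rfl
    have h2 : ∀ i, Measurable[past W S₁] fun ω =>
        gradY (P.g i ((W ω).innerAnchor k t i)) (pt (x ω) (y ω)) := fun i =>
      prY.continuous.measurable.comp
        ((hQ.g_grad_meas i).comp ((hz.mono (past_mono hSS) le_rfl).prodMk (h1 i)))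
    exact (Finset.measurable_fun_sum Finset.univ fun i _ => h2 i).const_smul (m : ℝ)⁻¹
  obtain ⟨n, d, hnd, hn, hn0, hd⟩ := averaged_local_updates (Pr := Pr) hm (𝓕₀ := past W S₁)
    (𝓕 := fun i ν => past W (S₂ i ν)) (fun i => by simp [S₂])
    (fun i ν ν' h => past_mono (Set.union_subset_union_right _ fun j ⟨ν'', h1, h2⟩ =>
      ⟨ν'', h1.trans_le h, h2⟩)) (fun i ν => hS.past_le _) (hQ.oracle_gradG hP) hP.g_grad_lip
    hlg1 (Z := fun i ν ω => (W ω).innerLocal k t i ν)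
    (fun i ν => (comap_measurable _).mono (sigma_le_past (j := .innerLocal k t i ν)
      (Or.inr ⟨ν, Nat.lt_succ_self ν, rfl⟩)) le_rfl)
    (fun i ν => hS.innerLocal_law k t i ν)
    (fun i ν => hS.indep_past (j := .innerLocal k t i ν) (by
      simp [S₂, S₁, hS2]))
    prY norm_prY_le inY norm_inY (base := fun ω => inX (x ω))
    ((inX.continuous.measurable.comp hx).mono (past_mono hSS) le_rfl)
    (u := fun i ν ω => P.innLocal i (β / τ i) (x ω) (y ω) (q ω) ((W ω).innerLocal k t i) ν)
    (u₀ := y) (h := q) (fun i => rfl) (hy.mono (past_mono hSS) le_rfl) hqm hβ hτ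
    (fun i ν ω => by simp only [← pt_eq]; rfl) hsmall
  have hnq2 : MemLp nq 2 Pr := hnq.memLp
  have hqe : q = fun ω => gradY P.innerAvg (pt (x ω) (y ω)) + nq ω := funext hq
  have hq2 : MemLp q 2 Pr := by rw [hqe]; exact hg.add hnq2
  have hqn : lpNorm q 2 Pr ≤ lpNorm (fun ω => gradY P.innerAvg (pt (x ω) (y ω))) 2 Pr + √vg1 := by
    rw [hqe]
    exact (lpNorm_two_add_le hg).trans (by gcongr; exact hnq.lpNorm_le)
  obtain ⟨hd1, hd2⟩ := hd (fun _ => 1) measurable_const (memLp_const 1) (by simpa using hq2)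
  rw [lpNorm_const two_ne_zero (IsProbabilityMeasure.ne_zero Pr)] at hd2
  simp only [one_smul, norm_one, probReal_univ, Real.one_rpow, mul_one] at hd1 hd2
  refine ⟨fun ω => nq ω + n ω, d, ?_, hnq2.add hn.memLp, ?_, ?_, hd1, hd2.trans ?_⟩
  · intro ω
    rw [← add_assoc (gradY _ _), ← hq]
    exact hnd ω
  · refine (lpNorm_two_add_le hnq2).trans ?_
    have h1 := hnq.lpNorm_le
    have h2 := hn.lpNorm_le
    linarith
  · have := hnq0.add (hn0.mono_sigma (past_mono hSS)) hnq2 (memLp_const 0) hn.memLp (memLp_const 0)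
    simpa using this
  · have hqn' : lpNorm (fun ω => q ω) 2 Pr ≤ _ := hqn
    exact mul_le_mul_of_nonneg_left (by linarith) (by positivity)

/-- One round of the inner optimizer contracts the mean-square distance to `y*(x)`, up to a noise
of the order of the squared stepsize. -/
theorem fedInn_contraction (hm : 0 < m) (hP : P.WellBehaved lf0 lf1 lg1 lg2 mug)
    (R : BilevelRegular P.outerAvg P.innerAvg lf0 lf1 lg1 lg2 mug)
    (hQ : P.StochasticSamples vf vg1 vg2) (hvg1 : 0 ≤ vg1) (hS : P.IsSampling Pr N W)
    {S : Set (DrawIdx m)}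
    {k t : ℕ} (hS1 : ∀ i, DrawIdx.innerAnchor k t i ∉ S)
    (hS2 : ∀ i ν, DrawIdx.innerLocal k t i ν ∉ S)
    {x : Ω → Vec d₁} {y : Ω → Vec d₂} (hx : Measurable[past W S] x) (hy : Measurable[past W S] y)
    {β : ℝ} (hβ : 0 ≤ β) (hsmall : β * lg1 ≤ 1 / 2) (hsmall' : 18 * lg1 ^ 2 * β ≤ mug)
    {τ : Fin m → ℕ} (hτ : ∀ i, 1 ≤ τ i)
    (he : MemLp (fun ω => y ω - P.yStar (x ω)) 2 Pr) :
    MemLp (fun ω => P.fedInn τ β (x ω) (y ω) ((W ω).innerAnchor k t) ((W ω).innerLocal k t)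
      - P.yStar (x ω)) 2 Pr ∧
    ∫ ω, ‖P.fedInn τ β (x ω) (y ω) ((W ω).innerAnchor k t) ((W ω).innerLocal k t)
        - P.yStar (x ω)‖ ^ 2 ∂Pr
      ≤ (1 - β * mug) * ∫ ω, ‖y ω - P.yStar (x ω)‖ ^ 2 ∂Pr + 48 * β ^ 2 * vg1 := by
  have hl := R.lg1_pos
  have hμ := R.mug_pos
  have hys := gradY_yStar R
  set e : Ω → Vec d₂ := fun ω => y ω - P.yStar (x ω) with he_def
  set g : Ω → Vec d₂ := fun ω => gradY P.innerAvg (pt (x ω) (y ω)) with hg_def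
  have hle := hS.past_le S
  have hysm : Measurable[past W S] fun ω => P.yStar (x ω) :=
    (R.continuous_star hys).measurable.comp hx
  have hem : Measurable[past W S] e := hy.sub hysm
  have hgm : Measurable[past W S] g :=
    prY.continuous.measurable.comp (R.continuous_gradG.measurable.comp (hx.pt hy))
  have hge : ∀ ω, ‖g ω‖ ≤ lg1 * ‖e ω‖ := fun ω => by
    have h1 : g ω = prY (gradient P.innerAvg (pt (x ω) (y ω))
        - gradient P.innerAvg (pt (x ω) (P.yStar (x ω)))) := by
      rw [map_sub, ← gradY_eq, ← gradY_eq, hys, sub_zero]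
    rw [h1]
    refine (norm_prY_le _).trans ((R.g_grad_lip _ _).trans_eq ?_)
    rw [pt_sub_pt, sub_self, norm_pt_zero_left]
  have hel := he.const_smul lg1
  have hge' : ∀ ω, ‖g ω‖ ≤ ‖lg1 • e ω‖ := fun ω => by
    rw [norm_smul, Real.norm_of_nonneg hl.le]; exact hge ω
  have hg : MemLp g 2 Pr := hel.mono (hgm.mono hle le_rfl).aestronglyMeasurable
    (Filter.Eventually.of_forall hge')
  have hgn : lpNorm g 2 Pr ≤ lg1 * lpNorm e 2 Pr := by
    refine (lpNorm_two_mono hel hge').trans_eq ((lpNorm_two_smul lg1 e).trans ?_)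
    rw [abs_of_pos hl]
  obtain ⟨n, d, hnd, hn2, hnn, hn0, hd2, hdn⟩ :=
    fedInn_direction hm hP hl.le hQ hS hS1 hS2 hx hy hβ hsmall hτ hg
  set A : Ω → Vec d₂ := fun ω => e ω - β • g ω with hA_def
  have hAm : Measurable[past W S] A := hem.sub (hgm.const_smul β)
  have hA2 : MemLp A 2 Pr := he.sub (hg.const_smul β)
  have hnd2 : MemLp (fun ω => n ω + d ω) 2 Pr := hn2.add hd2
  have hB2 : MemLp (fun ω => β • (n ω + d ω)) 2 Pr := hnd2.const_smul β
  have hdec : (fun ω => P.fedInn τ β (x ω) (y ω) ((W ω).innerAnchor k t) ((W ω).innerLocal k t)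
      - P.yStar (x ω)) = fun ω => A ω - β • (n ω + d ω) := by
    ext1 ω
    rw [hnd]
    simp only [hA_def, he_def, hg_def, smul_add]
    abel
  have hdec' := fun ω => congrFun hdec ω
  simp only [hdec']
  refine ⟨hA2.sub hB2, ?_⟩
  rw [integral_norm_sub_sq hA2 hB2]
  set E := lpNorm e 2 Pr with hE
  have hE0 : 0 ≤ E := lpNorm_nonneg
  have hσ0 : 0 ≤ √vg1 := Real.sqrt_nonneg _
  have hσ2 : √vg1 ^ 2 = vg1 := Real.sq_sqrt hvg1
  have hEsq : ∫ ω, ‖e ω‖ ^ 2 ∂Pr = E ^ 2 := (lpNorm_two_sq he).symm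
  have hfac : β ^ 2 * lg1 ^ 2 ≤ β * mug := by nlinarith [sq_nonneg lg1]
  -- the exact gradient step contracts
  have hAe : ∀ ω, ‖A ω‖ ^ 2 ≤ (1 - 2 * β * mug + β ^ 2 * lg1 ^ 2) * ‖e ω‖ ^ 2 := fun ω => by
    have h1 := R.grad_mono (x ω) (y ω) (P.yStar (x ω))
    rw [hys, sub_zero] at h1
    have h2 : ‖g ω‖ ^ 2 ≤ lg1 ^ 2 * ‖e ω‖ ^ 2 := by
      rw [← mul_pow]; exact pow_le_pow_left₀ (norm_nonneg _) (hge ω) 2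
    have h3 : ‖A ω‖ ^ 2 = ‖e ω‖ ^ 2 - 2 * β * ⟪g ω, e ω⟫ + β ^ 2 * ‖g ω‖ ^ 2 := by
      rw [hA_def]
      simp only
      rw [norm_sub_sq_real, inner_smul_right, norm_smul, mul_pow, Real.norm_eq_abs, sq_abs,
        real_inner_comm]
      ring
    have h4 : β * (mug * ‖e ω‖ ^ 2) ≤ β * ⟪g ω, e ω⟫ := by gcongr
    have h5 : β ^ 2 * ‖g ω‖ ^ 2 ≤ β ^ 2 * (lg1 ^ 2 * ‖e ω‖ ^ 2) := by gcongr
    rw [h3]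
    linarith
  have hA_int : ∫ ω, ‖A ω‖ ^ 2 ∂Pr ≤ (1 - 2 * β * mug + β ^ 2 * lg1 ^ 2) * E ^ 2 := by
    rw [← hEsq, ← integral_const_mul]
    exact integral_mono hA2.integrable_norm_sq (he.integrable_norm_sq.const_mul _) hAe
  have hAn : lpNorm A 2 Pr ≤ E := by
    refine lpNorm_two_mono he fun ω => abs_le_of_sq_le_sq' ((hAe ω).trans ?_) (norm_nonneg _) |>.2
    have : 0 ≤ β * mug := by positivity
    nlinarith [sq_nonneg ‖e ω‖]
  have hin : ∫ ω, ⟪A ω, β • (n ω + d ω)⟫ ∂Pr = β * ∫ ω, ⟪A ω, d ω⟫ ∂Pr := by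
    simp only [inner_smul_right, inner_add_right]
    rw [integral_const_mul, integral_add (integrable_inner hA2 hn2) (integrable_inner hA2 hd2),
      hn0 A hAm hA2]
    simp
  have hdn' : lpNorm d 2 Pr ≤ 2 * lg1 * β * (3 * √vg1 + lg1 * E) := hdn.trans (by gcongr)
  have hAd : -(E * (2 * lg1 * β * (3 * √vg1 + lg1 * E))) ≤ ∫ ω, ⟪A ω, d ω⟫ ∂Pr := by
    have h1 := (abs_le.1 (abs_integral_inner_le hA2 hd2)).1
    have h2 : lpNorm A 2 Pr * lpNorm d 2 Pr ≤ E * (2 * lg1 * β * (3 * √vg1 + lg1 * E)) :=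
      mul_le_mul hAn hdn' lpNorm_nonneg hE0
    linarith
  have hBn : ∫ ω, ‖β • (n ω + d ω)‖ ^ 2 ∂Pr ≤ β ^ 2 * (6 * √vg1 + lg1 * E) ^ 2 := by
    rw [← lpNorm_two_sq hB2, lpNorm_two_smul, mul_pow, sq_abs]
    gcongr
    · exact lpNorm_nonneg
    refine (lpNorm_two_add_le hn2).trans ((add_le_add hnn hdn').trans ?_)
    have h1 : 2 * lg1 * β ≤ 1 := by linarith
    have h2 : 2 * lg1 * β * (3 * √vg1 + lg1 * E) ≤ 1 * (3 * √vg1 + lg1 * E) := by gcongr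
    linarith
  rw [hin, hEsq]
  have hfin : β ^ 2 * (24 * (lg1 * E) * √vg1) ≤ β ^ 2 * (12 * (lg1 * E) ^ 2 + 12 * √vg1 ^ 2) := by
    gcongr
    nlinarith [sq_nonneg (lg1 * E - √vg1)]
  have hfin2 : 18 * lg1 ^ 2 * β * (β * E ^ 2) ≤ mug * (β * E ^ 2) := by gcongr
  have hmulAd := mul_le_mul_of_nonneg_left hAd hβ
  rw [← hσ2]
  nlinarith

end FedProblem

namespace FedProblem

section Measurability

variable {m d₁ d₂ : ℕ} {Ξ Ζ Ω : Type*} [MeasurableSpace Ξ] [MeasurableSpace Ζ]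
  {P : FedProblem m d₁ d₂ Ξ Ζ} {vf vg1 vg2 : ℝ} {𝓕 : MeasurableSpace Ω}

theorem StochasticSamples.measurable_gradX_f (hQ : P.StochasticSamples vf vg1 vg2) {i : Fin m}
    {z : Ω → Pt d₁ d₂} {ξ : Ω → Ξ} (hz : Measurable z) (hξ : Measurable ξ) :
    Measurable fun ω => gradX (P.f i (ξ ω)) (z ω) :=
  prX.continuous.measurable.comp ((hQ.f_grad_meas i).comp (hz.prodMk hξ))

theorem StochasticSamples.measurable_gradY_f (hQ : P.StochasticSamples vf vg1 vg2) {i : Fin m}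
    {z : Ω → Pt d₁ d₂} {ξ : Ω → Ξ} (hz : Measurable z) (hξ : Measurable ξ) :
    Measurable fun ω => gradY (P.f i (ξ ω)) (z ω) :=
  prY.continuous.measurable.comp ((hQ.f_grad_meas i).comp (hz.prodMk hξ))

theorem StochasticSamples.measurable_gradY_g (hQ : P.StochasticSamples vf vg1 vg2) {i : Fin m}
    {z : Ω → Pt d₁ d₂} {ζ : Ω → Ζ} (hz : Measurable z) (hζ : Measurable ζ) :
    Measurable fun ω => gradY (P.g i (ζ ω)) (z ω) :=
  prY.continuous.measurable.comp ((hQ.g_grad_meas i).comp (hz.prodMk hζ))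

theorem StochasticSamples.measurable_hess_g (hQ : P.StochasticSamples vf vg1 vg2) {i : Fin m}
    {z : Ω → Pt d₁ d₂} {ζ : Ω → Ζ} {p : Ω → Pt d₁ d₂} (hz : Measurable z) (hζ : Measurable ζ)
    (hp : Measurable p) : Measurable fun ω => hess (P.g i (ζ ω)) (z ω) (p ω) := by
  have hc : Continuous fun q : (Pt d₁ d₂ →L[ℝ] Pt d₁ d₂) × Pt d₁ d₂ => q.1 q.2 :=
    isBoundedBilinearMap_apply.continuous
  exact hc.measurable.comp (((hQ.g_hess_meas i).comp (hz.prodMk hζ)).prodMk hp)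

theorem StochasticSamples.measurable_hessY_g (hQ : P.StochasticSamples vf vg1 vg2) {i : Fin m}
    {z : Ω → Pt d₁ d₂} {ζ : Ω → Ζ} {p : Ω → Vec d₂} (hz : Measurable z) (hζ : Measurable ζ)
    (hp : Measurable p) : Measurable fun ω => hessY (P.g i (ζ ω)) (z ω) (p ω) :=
  prY.continuous.measurable.comp
    (hQ.measurable_hess_g hz hζ (inY.continuous.measurable.comp hp))

theorem StochasticSamples.measurable_hessXY_g (hQ : P.StochasticSamples vf vg1 vg2) {i : Fin m}
    {z : Ω → Pt d₁ d₂} {ζ : Ω → Ζ} {p : Ω → Vec d₂} (hz : Measurable z) (hζ : Measurable ζ)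
    (hp : Measurable p) : Measurable fun ω => hessXY (P.g i (ζ ω)) (z ω) (p ω) :=
  prX.continuous.measurable.comp
    (hQ.measurable_hess_g hz hζ (inY.continuous.measurable.comp hp))

theorem StochasticSamples.measurable_fedInn (hQ : P.StochasticSamples vf vg1 vg2) {τ : Fin m → ℕ}
    {β : ℝ} {x : Ω → Vec d₁} {y : Ω → Vec d₂} {ζ₀ : Ω → Fin m → Ζ} {ζ : Ω → Fin m → ℕ → Ζ}
    (hx : Measurable x) (hy : Measurable y) (hζ₀ : ∀ i, Measurable fun ω => ζ₀ ω i)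
    (hζ : ∀ i ν, Measurable fun ω => ζ ω i ν) :
    Measurable fun ω => P.fedInn τ β (x ω) (y ω) (ζ₀ ω) (ζ ω) := by
  have hq : Measurable fun ω => (m : ℝ)⁻¹ • ∑ i, gradY (P.g i (ζ₀ ω i)) (pt (x ω) (y ω)) :=
    (Finset.measurable_fun_sum Finset.univ fun i _ =>
      hQ.measurable_gradY_g (hx.pt hy) (hζ₀ i)).const_smul (m : ℝ)⁻¹
  refine (Finset.measurable_fun_sum Finset.univ fun i _ => ?_).const_smul (m : ℝ)⁻¹
  have hl : ∀ ν, Measurable fun ω => P.innLocal i (β / τ i) (x ω) (y ω)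
      ((m : ℝ)⁻¹ • ∑ i, gradY (P.g i (ζ₀ ω i)) (pt (x ω) (y ω))) (ζ ω i) ν := by
    intro ν
    induction ν with
    | zero => exact hy
    | succ ν ih =>
      exact ih.sub ((((hQ.measurable_gradY_g (hx.pt ih) (hζ i ν)).sub
        (hQ.measurable_gradY_g (hx.pt hy) (hζ i ν))).add hq).const_smul (β / τ i))
  exact hl _

theorem StochasticSamples.measurable_fedOut (hQ : P.StochasticSamples vf vg1 vg2) {τ : Fin m → ℕ}
    {α : ℝ} {x : Ω → Vec d₁} {y p : Ω → Vec d₂} {ξ₀ : Ω → Fin m → Ξ} {ζ : Ω → Fin m → Ζ}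
    {ξ : Ω → Fin m → ℕ → Ξ} (hx : Measurable x) (hy : Measurable y) (hp : Measurable p)
    (hξ₀ : ∀ i, Measurable fun ω => ξ₀ ω i) (hζ : ∀ i, Measurable fun ω => ζ ω i)
    (hξ : ∀ i ν, Measurable fun ω => ξ ω i ν) :
    Measurable fun ω => P.fedOut τ α (x ω) (y ω) (p ω) (ξ₀ ω) (ζ ω) (ξ ω) := by
  have hh : Measurable fun ω => (m : ℝ)⁻¹ • ∑ i, (gradX (P.f i (ξ₀ ω i)) (pt (x ω) (y ω))
      - hessXY (P.g i (ζ ω i)) (pt (x ω) (y ω)) (p ω)) :=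
    (Finset.measurable_fun_sum Finset.univ fun i _ =>
      (hQ.measurable_gradX_f (hx.pt hy) (hξ₀ i)).sub
        (hQ.measurable_hessXY_g (hx.pt hy) (hζ i) hp)).const_smul (m : ℝ)⁻¹
  refine (Finset.measurable_fun_sum Finset.univ fun i _ => ?_).const_smul (m : ℝ)⁻¹
  have hl : ∀ ν, Measurable fun ω => P.outLocal i (α / τ i) (x ω) (y ω)
      ((m : ℝ)⁻¹ • ∑ i, (gradX (P.f i (ξ₀ ω i)) (pt (x ω) (y ω))
        - hessXY (P.g i (ζ ω i)) (pt (x ω) (y ω)) (p ω))) (ξ ω i) ν := by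
    intro ν
    induction ν with
    | zero => exact hx
    | succ ν ih =>
      exact ih.sub ((((hQ.measurable_gradX_f (ih.pt hy) (hξ i ν)).sub
        (hQ.measurable_gradX_f (hx.pt hy) (hξ i ν))).add hh).const_smul (α / τ i))
  exact hl _

end Measurability

variable {m d₁ d₂ : ℕ} {Ξ Ζ Ω : Type*} [MeasurableSpace Ξ] [MeasurableSpace Ζ]
  {mΩ : MeasurableSpace Ω} {Pr : Measure Ω} [IsProbabilityMeasure Pr]
  {P : FedProblem m d₁ d₂ Ξ Ζ} {lf0 lf1 lg1 lg2 mug vf vg1 vg2 : ℝ} {N : ℕ} {W : Ω → Draws m Ξ Ζ}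

/-- The history available after `t` inner rounds of outer round `k`. -/
def innerPast (m k t : ℕ) : Set (DrawIdx m) := drawsBefore m k ∪ innerDraws m k t

/-- The contraction of one inner round, iterated. -/
theorem innerIter_bound (hm : 0 < m) (hP : P.WellBehaved lf0 lf1 lg1 lg2 mug)
    (R : BilevelRegular P.outerAvg P.innerAvg lf0 lf1 lg1 lg2 mug)
    (hQ : P.StochasticSamples vf vg1 vg2) (hvg1 : 0 ≤ vg1) (hS : P.IsSampling Pr N W) {k : ℕ}
    {x : Ω → Vec d₁} {y : Ω → Vec d₂} (hx : Measurable[past W (drawsBefore m k)] x)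
    (hy : Measurable[past W (drawsBefore m k)] y)
    {β : ℝ} (hβ : 0 ≤ β) (hsmall : β * lg1 ≤ 1 / 2) (hsmall' : 18 * lg1 ^ 2 * β ≤ mug)
    (hβμ : β * mug ≤ 1) {τ : Fin m → ℕ} (hτ : ∀ i, 1 ≤ τ i)
    (he : MemLp (fun ω => y ω - P.yStar (x ω)) 2 Pr) (t : ℕ) :
    Measurable[past W (innerPast m k t)] (fun ω => P.innerIter τ β (x ω) (y ω) (W ω) k t) ∧
    MemLp (fun ω => P.innerIter τ β (x ω) (y ω) (W ω) k t - P.yStar (x ω)) 2 Pr ∧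
    ∫ ω, ‖P.innerIter τ β (x ω) (y ω) (W ω) k t - P.yStar (x ω)‖ ^ 2 ∂Pr
      ≤ (1 - β * mug) ^ t * ∫ ω, ‖y ω - P.yStar (x ω)‖ ^ 2 ∂Pr + 48 * t * β ^ 2 * vg1 := by
  have hμ := R.mug_pos
  induction t with
  | zero =>
    refine ⟨hy.mono (past_mono Set.subset_union_left) le_rfl, he, ?_⟩
    simp [innerIter]
  | succ t ih =>
    obtain ⟨h1, h2, h3⟩ := ih
    have hsub : innerPast m k t ⊆ innerPast m k (t + 1) :=
      Set.union_subset_union_right _ fun j ⟨t', ht', h⟩ => ⟨t', ht'.trans (Nat.lt_succ_self t), h⟩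
    have hx' := hx.mono (past_mono (W := W) (S' := innerPast m k t) Set.subset_union_left) le_rfl
    obtain ⟨h4, h5⟩ := fedInn_contraction hm hP R hQ hvg1 hS (S := innerPast m k t) (k := k)
      (t := t) (by simp [innerPast, drawsBefore, innerDraws, DrawIdx.round])
      (by simp [innerPast, drawsBefore, innerDraws, DrawIdx.round])
      hx' h1 hβ hsmall hsmall' hτ h2
    refine ⟨?_, h4, h5.trans ?_⟩
    · refine hQ.measurable_fedInn (hx'.mono (past_mono hsub) le_rfl)
        (h1.mono (past_mono hsub) le_rfl) (fun i => ?_) fun i ν => ?_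
      · exact (comap_measurable _).mono (sigma_le_past (j := .innerAnchor k t i)
          (Or.inr ⟨t, Nat.lt_succ_self t, i, Or.inl rfl⟩)) le_rfl
      · exact (comap_measurable _).mono (sigma_le_past (j := .innerLocal k t i ν)
          (Or.inr ⟨t, Nat.lt_succ_self t, i, Or.inr ⟨ν, rfl⟩⟩)) le_rfl
    · have h0 : 0 ≤ 1 - β * mug := by linarith
      have h6 : 0 ≤ 48 * t * β ^ 2 * vg1 := by positivity
      have h7 := mul_le_mul_of_nonneg_left h3 h0
      rw [pow_succ' (1 - β * mug) t]
      push_cast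
      nlinarith [mul_nonneg (mul_nonneg hβ hμ.le) h6]

/-- `T` contractions by `1 - s / T` shrink at least by the factor `1 - s / 2`. -/
theorem one_sub_div_pow_le {s : ℝ} (h0 : 0 ≤ s) (h1 : s ≤ 1) {T : ℕ} (hT : 1 ≤ T) :
    (1 - s / T) ^ T ≤ 1 - s / 2 := by
  have hT0 : (0 : ℝ) < T := by exact_mod_cast hT
  have hsT : s / T ≤ 1 := by
    rw [div_le_one hT0]
    exact h1.trans (by exact_mod_cast hT)
  have hsT0 : 0 ≤ s / T := by positivity
  have hb : 1 + s ≤ (1 + s / T) ^ T := by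
    have := one_add_mul_le_pow (a := s / T) (by linarith) T
    rwa [mul_div_cancel₀ _ hT0.ne'] at this
  have hprod : (1 - s / T) ^ T * (1 + s / T) ^ T ≤ 1 := by
    rw [← mul_pow]
    refine pow_le_one₀ (mul_nonneg (by linarith) (by linarith)) ?_
    nlinarith
  have hnn : 0 ≤ (1 - s / T) ^ T := pow_nonneg (by linarith) _
  have h2 : (1 - s / T) ^ T * (1 + s) ≤ 1 := (mul_le_mul_of_nonneg_left hb hnn).trans hprod
  have h3 : 1 ≤ (1 - s / 2) * (1 + s) := by nlinarith
  exact le_of_mul_le_mul_right (h2.trans h3) (by linarith)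

/-! ### Random client subsets and the random number of Neumann terms -/

/-- The weight `1 / |A|` of client `i` in the subset `A`, zero if `i ∉ A`. -/
def subsetWeight (i : Fin m) (A : Finset (Fin m)) : ℝ := if i ∈ A then (A.card : ℝ)⁻¹ else 0

theorem subsetWeight_nonneg (i : Fin m) (A : Finset (Fin m)) : 0 ≤ subsetWeight i A := by
  unfold subsetWeight; split_ifs <;> positivity

theorem sum_subsetWeight (A : Finset (Fin m)) :
    ∑ i, subsetWeight i A = if A = ∅ then 0 else 1 := by
  simp only [subsetWeight, Finset.sum_ite_mem, Finset.univ_inter, Finset.sum_const, nsmul_eq_mul]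
  split_ifs with h
  · simp [h]
  · exact mul_inv_cancel₀ (by simpa using h)

theorem sum_subsetWeight_smul {V : Type*} [AddCommGroup V] [Module ℝ V] (A : Finset (Fin m))
    (X : Fin m → V) : (A.card : ℝ)⁻¹ • ∑ i ∈ A, X i = ∑ i, subsetWeight i A • X i := by
  simp only [subsetWeight, ite_smul, zero_smul, Finset.sum_ite_mem, Finset.univ_inter,
    Finset.smul_sum]

namespace IsSampling

variable (hS : P.IsSampling Pr N W)
include hS

theorem integral_subset (k n : ℕ) (φ : Finset (Fin m) → ℝ) :
    ∫ ω, φ ((W ω).subset k n) ∂Pr = ∑ A, Pr.real {ω | (W ω).subset k n = A} * φ A := by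
  have e : (fun ω => φ ((W ω).subset k n))
      = fun ω => ∑ A, {ω | (W ω).subset k n = A}.indicator (fun _ => φ A) ω := by
    ext ω
    simp [Set.indicator_apply]
  rw [e, integral_finsetSum _ fun A _ =>
    (integrable_const _).indicator (hS.subset_meas k n A)]
  refine Finset.sum_congr rfl fun A _ => ?_
  rw [integral_indicator_const _ (hS.subset_meas k n A), smul_eq_mul]

theorem measurable_subset (k n : ℕ) (φ : Finset (Fin m) → ℝ) :
    Measurable[DrawIdx.sigma W (.subset k n)] fun ω => φ ((W ω).subset k n) := by
  intro s _
  exact ⟨φ ⁻¹' s, trivial, rfl⟩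

/-- Every client carries the same expected weight in the random subset. -/
theorem integral_subsetWeight (hm : 0 < m) (k n : ℕ) (i : Fin m) :
    ∫ ω, subsetWeight i ((W ω).subset k n) ∂Pr = (m : ℝ)⁻¹ := by
  have hsymm : ∀ i j, ∫ ω, subsetWeight i ((W ω).subset k n) ∂Pr
      = ∫ ω, subsetWeight j ((W ω).subset k n) ∂Pr := by
    intro i j
    rw [hS.integral_subset, hS.integral_subset]
    -- reindex the subsets by the transposition of `i` and `j`
    refine Fintype.sum_equiv (Equiv.finsetCongr (Equiv.swap i j)) _ _ fun A => ?_
    rw [Equiv.finsetCongr_apply,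
      hS.subset_unif k n A (A.map (Equiv.swap i j).toEmbedding) (by simp)]
    congr 1
    have : i ∈ A ↔ j ∈ A.map (Equiv.swap i j).toEmbedding := by
      simp [Finset.mem_map_equiv]
    simp only [subsetWeight, this, Finset.card_map]
  have hsum : ∑ i, ∫ ω, subsetWeight i ((W ω).subset k n) ∂Pr = 1 := by
    simp only [hS.integral_subset]
    rw [Finset.sum_comm]
    simp only [← Finset.mul_sum, sum_subsetWeight]
    have h1 := hS.integral_subset k n fun _ => 1
    simp only [integral_const, probReal_univ, smul_eq_mul, mul_one] at h1
    refine Eq.trans (Finset.sum_congr rfl fun A _ => ?_) h1.symm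
    by_cases hA : A = ∅
    · rw [hA, hS.subset_nonempty]; simp
    · simp [hA]
  have hm0 : (m : ℝ) ≠ 0 := by exact_mod_cast hm.ne'
  simp only [hsymm _ i, Finset.sum_const, Finset.card_univ, Fintype.card_fin, nsmul_eq_mul] at hsum
  exact eq_inv_of_mul_eq_one_right hsum

/-- The probabilities `1 / N` of the values below `N` add up to `1`. -/
theorem len_lt (hN : 1 ≤ N) (k : ℕ) : ∀ᵐ ω ∂Pr, (W ω).len k < N := by
  have hmeas : ∀ n, MeasurableSet {ω | (W ω).len k = n} := fun n =>
    hS.len_meas k (measurableSet_singleton n)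
  have hN0 : (N : ℝ) ≠ 0 := by positivity
  have hunion : {ω | (W ω).len k < N} = ⋃ n ∈ Finset.range N, {ω | (W ω).len k = n} := by
    ext ω; simp
  have h1 : Pr.real {ω | (W ω).len k < N} = 1 := by
    rw [hunion, measureReal_biUnion_finset (fun a _ b _ hab => Set.disjoint_left.2 fun ω ha hb =>
      hab (ha.symm.trans hb)) fun n _ => hmeas n]
    rw [Finset.sum_congr rfl fun n hn => hS.len_law k n (Finset.mem_range.1 hn)]
    simp [hN0]
  have h2 : MeasurableSet {ω | (W ω).len k < N} := by
    rw [hunion]; exact Finset.measurableSet_biUnion _ fun n _ => hmeas n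
  have h3 : Pr {ω | (W ω).len k < N} = 1 := by
    rw [measureReal_def] at h1
    exact (ENNReal.toReal_eq_one_iff _).1 h1
  exact (prob_compl_eq_zero_iff h2).2 h3

end IsSampling

end FedProblem

/-! ### Changes on null sets and added noise -/

section CongrAe

variable {Ω : Type*} {𝓕 : MeasurableSpace Ω} {mΩ : MeasurableSpace Ω} {Pr : Measure Ω}
  {V : Type*} [NormedAddCommGroup V] [InnerProductSpace ℝ V] [MeasurableSpace V]

theorem CondSized.congr_ae {c : ℝ} {X Y : Ω → V} (hX : CondSized Pr 𝓕 c X) (h : X =ᵐ[Pr] Y) :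
    CondSized Pr 𝓕 c Y := by
  intro θ hθ hθ2
  have e : (fun ω => θ ω • X ω) =ᵐ[Pr] fun ω => θ ω • Y ω := by
    filter_upwards [h] with ω hω
    rw [hω]
  have h2 := (hX θ hθ hθ2).1.ae_eq e
  refine ⟨h2, le_of_eq_of_le ?_ (hX θ hθ hθ2).2⟩
  rw [← toReal_eLpNorm h2.1, ← toReal_eLpNorm (hX θ hθ hθ2).1.1, eLpNorm_congr_ae e]

theorem SameCondMean.congr_ae {X X' Y : Ω → V} (hX : SameCondMean Pr 𝓕 X Y) (h : X =ᵐ[Pr] X') :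
    SameCondMean Pr 𝓕 X' Y := by
  intro U hU hU2
  rw [← hX U hU hU2]
  refine integral_congr_ae ?_
  filter_upwards [h] with ω hω
  rw [hω]

/-- Averages of vectors with known conditional means. -/
theorem SameCondMean.avg {ι : Type*} [Fintype ι] {r : ℝ} {X Y : ι → Ω → V}
    (h : ∀ i, SameCondMean Pr 𝓕 (X i) (Y i)) (hX : ∀ i, MemLp (X i) 2 Pr)
    (hY : ∀ i, MemLp (Y i) 2 Pr) :
    SameCondMean Pr 𝓕 (fun ω => r • ∑ i, X i ω) (fun ω => r • ∑ i, Y i ω) :=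
  (SameCondMean.sum h hX hY).const_smul r

/-- Adding a centred noise does not change conditional means. -/
theorem SameCondMean.add_noise {X Y n : Ω → V} (h : SameCondMean Pr 𝓕 X Y)
    (hn : SameCondMean Pr 𝓕 n fun _ => 0) (hX : MemLp X 2 Pr) (hY : MemLp Y 2 Pr)
    (hn2 : MemLp n 2 Pr) : SameCondMean Pr 𝓕 (fun ω => X ω + n ω) Y := by
  simpa using h.add hn hX hY hn2 MemLp.zero'

end CongrAe

namespace FedProblem

/-! ### The inverse-Hessian-gradient product -/

variable {m d₁ d₂ : ℕ} {Ξ Ζ Ω : Type*} [MeasurableSpace Ξ] [MeasurableSpace Ζ]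
  {mΩ : MeasurableSpace Ω} {Pr : Measure Ω} [IsProbabilityMeasure Pr]
  {P : FedProblem m d₁ d₂ Ξ Ζ} {lf0 lf1 lg1 lg2 mug vf vg1 vg2 : ℝ} {N : ℕ} {W : Ω → Draws m Ξ Ζ}

/-- The draws used for the vectors `p_0, …, p_n` in outer round `k`. -/
def ihgpDraws (m k n : ℕ) : Set (DrawIdx m) :=
  {j | (∃ i, j = .ihgpGrad k i) ∨ ∃ n' ≤ n, j = .subset k n' ∨ ∃ i, j = .ihgpHess k n' i}

section SubsetAverage

variable {V : Type*} [NormedAddCommGroup V] [InnerProductSpace ℝ V] [MeasurableSpace V]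
  [BorelSpace V] [SecondCountableTopology V]

/-- The average over a random client subset has the conditional mean of the full average. -/
theorem IsSampling.subset_average (hS : P.IsSampling Pr N W) (hm : 0 < m)
    {𝓕 : MeasurableSpace Ω} {S : Set (DrawIdx m)} {k n : ℕ} (h𝓕 : 𝓕 ≤ past W S)
    (hj : DrawIdx.subset k n ∉ S) {X : Fin m → Ω → V} (hX : ∀ i, Measurable[past W S] (X i))
    {c : ℝ} (hc : 0 ≤ c) (hXc : ∀ i, CondSized Pr 𝓕 c (X i)) :
    CondSized Pr 𝓕 c (fun ω => (((W ω).subset k n).card : ℝ)⁻¹ • ∑ i ∈ (W ω).subset k n, X i ω) ∧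
    SameCondMean Pr 𝓕
      (fun ω => (((W ω).subset k n).card : ℝ)⁻¹ • ∑ i ∈ (W ω).subset k n, X i ω)
      (fun ω => (m : ℝ)⁻¹ • ∑ i, X i ω) := by
  have hne : Nonempty (Fin m) := ⟨⟨0, hm⟩⟩
  have hcard : (Fintype.card (Fin m) : ℝ) = m := by simp
  have h0 : ∀ i ω, 0 ≤ subsetWeight i ((W ω).subset k n) := fun i ω => subsetWeight_nonneg _ _
  have h1 : ∀ ω, ∑ i, subsetWeight i ((W ω).subset k n) ≤ 1 := fun ω => by
    rw [sum_subsetWeight]; split_ifs <;> norm_num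
  have hw : ∀ i, Measurable[DrawIdx.sigma W (.subset k n)]
      fun ω => subsetWeight i ((W ω).subset k n) := fun i => hS.measurable_subset k n _
  have hwm : ∀ i, Measurable[mΩ] fun ω => subsetWeight i ((W ω).subset k n) := fun i =>
    (hw i).mono (hS.sigma_le _) le_rfl
  have hind : ∀ i, Indep (past W S) (MeasurableSpace.comap
      (fun ω => subsetWeight i ((W ω).subset k n)) inferInstance) Pr := fun i =>
    indep_of_indep_of_le_right (hS.indep_past hj) (hw i).comap_le
  have hmean : ∀ i, ∫ ω, subsetWeight i ((W ω).subset k n) ∂Pr = (Fintype.card (Fin m) : ℝ)⁻¹ :=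
    fun i => by rw [hcard]; exact hS.integral_subsetWeight hm k n i
  simp only [sum_subsetWeight_smul]
  refine ⟨condSized_random_average h0 h1 hwm h𝓕 (hS.past_le S) hind hmean hX hc hXc, ?_⟩
  rw [← hcard]
  exact sameCondMean_random_average h0 h1 hwm h𝓕 (hS.past_le S) hind hmean hX
    fun i => (hXc i).memLp

theorem IsSampling.measurable_subset_average (hS : P.IsSampling Pr N W) {S : Set (DrawIdx m)}
    {k n : ℕ} (hj : DrawIdx.subset k n ∈ S) {X : Fin m → Ω → V}
    (hX : ∀ i, Measurable[past W S] (X i)) :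
    Measurable[past W S]
      fun ω => (((W ω).subset k n).card : ℝ)⁻¹ • ∑ i ∈ (W ω).subset k n, X i ω := by
  simp only [sum_subsetWeight_smul]
  exact Finset.measurable_fun_sum Finset.univ fun i _ =>
    ((hS.measurable_subset k n _).mono (sigma_le_past hj) le_rfl).smul (hX i)

end SubsetAverage

theorem WellBehaved.blockY_innerAvg (hP : P.WellBehaved lf0 lf1 lg1 lg2 mug) (z : Pt d₁ d₂)
    (p : Vec d₂) : blockY P.innerAvg z p = (m : ℝ)⁻¹ • ∑ i, blockY (P.innerFun i) z p := by
  simp only [blockY_apply, hP.hess_innerAvg, smul_apply,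
    sum_apply, map_smul, map_sum]

theorem WellBehaved.blockXY_innerAvg (hP : P.WellBehaved lf0 lf1 lg1 lg2 mug) (z : Pt d₁ d₂)
    (p : Vec d₂) : blockXY P.innerAvg z p = (m : ℝ)⁻¹ • ∑ i, blockXY (P.innerFun i) z p := by
  simp only [blockXY_apply, hP.hess_innerAvg, smul_apply,
    sum_apply, map_smul, map_sum]

theorem WellBehaved.norm_blockY_le (hP : P.WellBehaved lf0 lf1 lg1 lg2 mug) (hlg1 : 0 ≤ lg1)
    (i : Fin m) (z : Pt d₁ d₂) (p : Vec d₂) : ‖blockY (P.innerFun i) z p‖ ≤ lg1 * ‖p‖ := by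
  rw [blockY_apply]
  refine (norm_prY_le _).trans ((ContinuousLinearMap.le_opNorm _ _).trans ?_)
  rw [norm_inY]
  gcongr
  exact hP.inner_hess_le hlg1 i z

theorem WellBehaved.norm_blockXY_le (hP : P.WellBehaved lf0 lf1 lg1 lg2 mug) (hlg1 : 0 ≤ lg1)
    (i : Fin m) (z : Pt d₁ d₂) (p : Vec d₂) : ‖blockXY (P.innerFun i) z p‖ ≤ lg1 * ‖p‖ := by
  rw [blockXY_apply]
  refine (norm_prX_le _).trans ((ContinuousLinearMap.le_opNorm _ _).trans ?_)
  rw [norm_inY]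
  gcongr
  exact hP.inner_hess_le hlg1 i z

theorem WellBehaved.continuous_hess_innerFun (hP : P.WellBehaved lf0 lf1 lg1 lg2 mug) (i : Fin m) :
    Continuous (hess (P.innerFun i)) :=
  continuous_of_norm_sub_le (hP.g_hess_lip i)

/-- The vector `p_n` of the inverse-Hessian-gradient product is conditionally bounded in mean
square, and its conditional mean is the `n`-th term of the Neumann series. -/
theorem fedIHGP_moments (hm : 0 < m) (hP : P.WellBehaved lf0 lf1 lg1 lg2 mug)
    (R : BilevelRegular P.outerAvg P.innerAvg lf0 lf1 lg1 lg2 mug)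
    (hQ : P.StochasticSamples vf vg1 vg2) (hS : P.IsSampling Pr N W) {k T : ℕ}
    {x : Ω → Vec d₁} {y : Ω → Vec d₂} (hx : Measurable[past W (innerPast m k T)] x)
    (hy : Measurable[past W (innerPast m k T)] y) (n : ℕ) :
    Measurable[past W (innerPast m k T ∪ ihgpDraws m k n)] (fun ω => P.fedIHGP lg1 N (x ω) (y ω)
      ((W ω).subset k) ((W ω).ihgpGrad k) ((W ω).ihgpHess k) n) ∧
    CondSized Pr (past W (innerPast m k T)) ((2 + √vg2 / lg1) ^ n * (N / lg1 * (lf0 + √vf)))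
      (fun ω => P.fedIHGP lg1 N (x ω) (y ω)
        ((W ω).subset k) ((W ω).ihgpGrad k) ((W ω).ihgpHess k) n) ∧
    SameCondMean Pr (past W (innerPast m k T)) (fun ω => P.fedIHGP lg1 N (x ω) (y ω)
        ((W ω).subset k) ((W ω).ihgpGrad k) ((W ω).ihgpHess k) n)
      (fun ω => (N / lg1 : ℝ) • ((1 - lg1⁻¹ • blockY P.innerAvg (pt (x ω) (y ω))) ^ n)
        (gradY P.outerAvg (pt (x ω) (y ω)))) := by
  have hl := R.lg1_pos
  have hf0 := R.lf0_nonneg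
  have hcard : (Fintype.card (Fin m) : ℝ) = m := by simp
  set S := innerPast m k T with hSdef
  have hz : Measurable[past W S] fun ω => pt (x ω) (y ω) := hx.pt hy
  have hle := hS.past_le S
  have hzm := hz.mono hle le_rfl
  induction n with
  | zero =>
    let S₁ : Set (DrawIdx m) := S ∪ {j | ∃ i, j = .ihgpGrad k i}
    have hSS : S ⊆ S₁ := Set.subset_union_left
    have hX : ∀ i, Measurable[past W S₁] fun ω =>
        gradY (P.f i ((W ω).ihgpGrad k i)) (pt (x ω) (y ω)) := fun i =>
      hQ.measurable_gradY_f (hz.mono (past_mono hSS) le_rfl)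
        ((comap_measurable _).mono (sigma_le_past (j := .ihgpGrad k i) (Or.inr ⟨i, rfl⟩)) le_rfl)
    let Y : Fin m → Ω → Vec d₂ := fun i ω => gradY (P.outerFun i) (pt (x ω) (y ω))
    let Nn : Fin m → Ω → Vec d₂ := fun i ω => prY (gradient (P.f i ((W ω).ihgpGrad k i))
      (pt (x ω) (y ω)) - gradient (P.outerFun i) (pt (x ω) (y ω)))
    have hYc : ∀ i, CondSized Pr (past W S) lf0 (Y i) := fun i =>
      CondSized.of_norm_le hle (prY.continuous.measurable.comp
        ((continuous_of_norm_sub_le (hP.f_grad_lip i)).measurable.comp hzm)).aestronglyMeasurable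
        hf0 fun ω => (norm_prY_le _).trans (hP.outer_grad_le hf0 i _)
    have hj : ∀ i, DrawIdx.ihgpGrad k i ∉ S := fun i => by
      simp [hSdef, innerPast, drawsBefore, innerDraws, DrawIdx.round]
    have hNc : ∀ i, CondSized Pr (past W S) (√vf) (Nn i) := fun i =>
      (hQ.oracle_gradF hP i).condSized hle (hS.ihgpGrad_meas k i) (hS.ihgpGrad_law k i)
        (hS.indep_past (hj i)) hz prY norm_prY_le
    have hN0 : ∀ i, SameCondMean Pr (past W S) (Nn i) fun _ => 0 := fun i =>
      (hQ.oracle_gradF hP i).sameCondMean hle (hS.ihgpGrad_meas k i) (hS.ihgpGrad_law k i)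
        (hS.indep_past (hj i)) hz prY norm_prY_le
    have hXe : ∀ i, (fun ω => gradY (P.f i ((W ω).ihgpGrad k i)) (pt (x ω) (y ω)))
        = fun ω => Y i ω + Nn i ω := fun i => by
      ext1 ω
      simp only [Y, Nn, map_sub, ← gradY_eq]
      abel
    have hXc : ∀ i, CondSized Pr (past W S) (lf0 + √vf)
        fun ω => gradY (P.f i ((W ω).ihgpGrad k i)) (pt (x ω) (y ω)) := fun i => by
      rw [hXe]; exact (hYc i).add (hNc i)
    have hX0 : ∀ i, SameCondMean Pr (past W S)
        (fun ω => gradY (P.f i ((W ω).ihgpGrad k i)) (pt (x ω) (y ω))) (Y i) := fun i => by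
      rw [hXe]
      exact (SameCondMean.refl _).add_noise (hN0 i) (hYc i).memLp (hYc i).memLp (hNc i).memLp
    obtain ⟨h1, h2⟩ := hS.subset_average hm (k := k) (n := 0) (past_mono hSS) (by
      simp [S₁, hSdef, innerPast, drawsBefore, innerDraws, DrawIdx.round]) hX (by positivity) hXc
    refine ⟨?_, ?_, ?_⟩
    · have h3 := hS.measurable_subset_average (S := S ∪ ihgpDraws m k 0) (k := k) (n := 0)
        (Or.inr (Or.inr ⟨0, le_rfl, Or.inl rfl⟩))
        fun i => (hX i).mono (past_mono ?_) le_rfl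
      · exact h3.const_smul (N / lg1 : ℝ)
      exact Set.union_subset_union_right _ fun j hj => Or.inl hj
    · have := h1.const_smul (N / lg1)
      rw [abs_of_nonneg (by positivity)] at this
      simpa only [pow_zero, one_mul, fedIHGP] using this
    · have h3 := (h2.trans (SameCondMean.avg (r := (m : ℝ)⁻¹) hX0 (fun i => (hXc i).memLp)
        fun i => (hYc i).memLp)).const_smul (N / lg1)
      simp only [Y, ← hP.gradY_outerAvg] at h3
      simpa only [pow_zero, one_apply_eq_self, fedIHGP] using h3
  | succ n ih =>
    obtain ⟨i1, i2, i3⟩ := ih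
    set p : Ω → Vec d₂ := fun ω => P.fedIHGP lg1 N (x ω) (y ω)
      ((W ω).subset k) ((W ω).ihgpGrad k) ((W ω).ihgpHess k) n with hp
    set c := (2 + √vg2 / lg1) ^ n * (N / lg1 * (lf0 + √vf)) with hc
    have hc0 : 0 ≤ c := by positivity
    let S₀ : Set (DrawIdx m) := S ∪ ihgpDraws m k n
    let S₁ : Set (DrawIdx m) := S₀ ∪ {j | ∃ i, j = .ihgpHess k (n + 1) i}
    have hS0 : S ⊆ S₀ := Set.subset_union_left
    have hS1 : S₀ ⊆ S₁ := Set.subset_union_left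
    have hpm := i1.mono (hS.past_le _) le_rfl
    have hX : ∀ i, Measurable[past W S₁] fun ω => p ω
        - lg1⁻¹ • hessY (P.g i ((W ω).ihgpHess k (n + 1) i)) (pt (x ω) (y ω)) (p ω) := fun i => by
      have hp1 := i1.mono (past_mono (W := W) hS1) le_rfl
      exact hp1.sub ((hQ.measurable_hessY_g (hz.mono (past_mono (hS0.trans hS1)) le_rfl)
        ((comap_measurable _).mono (sigma_le_past (j := .ihgpHess k (n + 1) i)
          (Or.inr ⟨i, rfl⟩)) le_rfl) hp1).const_smul lg1⁻¹)
    let Y : Fin m → Ω → Vec d₂ := fun i ω =>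
      p ω - lg1⁻¹ • blockY (P.innerFun i) (pt (x ω) (y ω)) (p ω)
    let Nn : Fin m → Ω → Vec d₂ := fun i ω =>
      prY ((hess (P.g i ((W ω).ihgpHess k (n + 1) i)) (pt (x ω) (y ω))
        - hess (P.innerFun i) (pt (x ω) (y ω))) (inY (p ω)))
    have hBc : ∀ i, CondSized Pr (past W S) (lg1 * c)
        fun ω => blockY (P.innerFun i) (pt (x ω) (y ω)) (p ω) := fun i => by
      refine i2.of_norm_le_mul hl.le hle ?_ fun ω => hP.norm_blockY_le hl.le i _ _
      have hcont : Continuous fun q : Pt d₁ d₂ × Vec d₂ => blockY (P.innerFun i) q.1 q.2 := by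
        simp only [blockY_apply]
        have := hP.continuous_hess_innerFun i
        fun_prop
      exact (hcont.measurable.comp (hzm.prodMk hpm)).aestronglyMeasurable
    have hYc : ∀ i, CondSized Pr (past W S) (2 * c) (Y i) := fun i => by
      refine (i2.sub ((hBc i).const_smul lg1⁻¹)).mono_const (le_of_eq ?_)
      rw [abs_of_pos (inv_pos.2 hl), inv_mul_cancel_left₀ hl.ne']
      ring
    have hj : ∀ i, DrawIdx.ihgpHess k (n + 1) i ∉ S₀ := fun i => by
      simp [S₀, hSdef, innerPast, drawsBefore, innerDraws, DrawIdx.round, ihgpDraws]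
    have hNc : ∀ i, CondSized Pr (past W S) (√vg2 * c) (Nn i) := fun i =>
      (hQ.oracle_hessG hP i).condSized_apply (past_mono hS0) (hS.past_le S₀)
        (hS.ihgpHess_meas k (n + 1) i) (hS.ihgpHess_law k (n + 1) i) (hS.indep_past (hj i))
        (hz.mono (past_mono hS0) le_rfl) i1 i2 prY norm_prY_le inY fun b => (norm_inY b).le
    have hN0 : ∀ i, SameCondMean Pr (past W S) (Nn i) fun _ => 0 := fun i =>
      (hQ.oracle_hessG hP i).sameCondMean_apply (past_mono hS0) (hS.past_le S₀)
        (hS.ihgpHess_meas k (n + 1) i) (hS.ihgpHess_law k (n + 1) i) (hS.indep_past (hj i))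
        (hz.mono (past_mono hS0) le_rfl) i1 i2.memLp prY norm_prY_le inY fun b => (norm_inY b).le
    have hXe : ∀ i, (fun ω => p ω
        - lg1⁻¹ • hessY (P.g i ((W ω).ihgpHess k (n + 1) i)) (pt (x ω) (y ω)) (p ω))
        = fun ω => Y i ω + (-lg1⁻¹) • Nn i ω := fun i => by
      ext1 ω
      simp only [Y, Nn, hessY_eq, blockY_apply, sub_apply, map_sub, smul_sub,
        neg_smul]
      abel
    have hn1 := fun i => (hNc i).const_smul (-lg1⁻¹)
    have hn2 : ∀ i, SameCondMean Pr (past W S) (fun ω => (-lg1⁻¹) • Nn i ω) fun _ => 0 :=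
      fun i => by simpa only [smul_zero] using (hN0 i).const_smul (-lg1⁻¹)
    have hXc : ∀ i, CondSized Pr (past W S) ((2 + √vg2 / lg1) * c) fun ω => p ω
        - lg1⁻¹ • hessY (P.g i ((W ω).ihgpHess k (n + 1) i)) (pt (x ω) (y ω)) (p ω) := fun i => by
      rw [hXe]
      refine ((hYc i).add (hn1 i)).mono_const (le_of_eq ?_)
      rw [abs_neg, abs_of_pos (inv_pos.2 hl)]
      ring
    have hX0 : ∀ i, SameCondMean Pr (past W S) (fun ω => p ω
        - lg1⁻¹ • hessY (P.g i ((W ω).ihgpHess k (n + 1) i)) (pt (x ω) (y ω)) (p ω)) (Y i) :=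
      fun i => by
        rw [hXe]
        exact (SameCondMean.refl _).add_noise (hn2 i) (hYc i).memLp (hYc i).memLp (hn1 i).memLp
    obtain ⟨h1, h2⟩ := hS.subset_average hm (k := k) (n := n + 1) (past_mono (hS0.trans hS1)) (by
      simp [S₁, S₀, hSdef, innerPast, drawsBefore, innerDraws, DrawIdx.round, ihgpDraws]) hX
      (by positivity) hXc
    refine ⟨?_, ?_, ?_⟩
    · refine (hS.measurable_subset_average (S := S ∪ ihgpDraws m k (n + 1))
        (Or.inr (Or.inr ⟨n + 1, le_rfl, Or.inl rfl⟩))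
        fun i => (hX i).mono (past_mono ?_) le_rfl)
      rintro j ((hj | hj | ⟨n', hn', hj⟩) | ⟨i, rfl⟩)
      · exact Or.inl hj
      · exact Or.inr (Or.inl hj)
      · exact Or.inr (Or.inr ⟨n', hn'.trans (Nat.le_succ n), hj⟩)
      · exact Or.inr (Or.inr ⟨n + 1, le_rfl, Or.inr ⟨i, rfl⟩⟩)
    · rw [pow_succ', mul_assoc]; exact h1
    · have h3 := h2.trans (SameCondMean.avg (r := (m : ℝ)⁻¹) hX0 (fun i => (hXc i).memLp)
        fun i => (hYc i).memLp)
      have hYavg : (fun ω => (m : ℝ)⁻¹ • ∑ i, Y i ω)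
          = fun ω => (1 - lg1⁻¹ • blockY P.innerAvg (pt (x ω) (y ω))) (p ω) := by
        ext1 ω
        simp only [Y, sub_apply, one_apply_eq_self,
          smul_apply, hP.blockY_innerAvg]
        rw [Finset.sum_sub_distrib, smul_sub, avg_const hm, ← Finset.smul_sum, smul_comm]
      rw [hYavg] at h3
      have h4 := i3.map hle (A := fun ω => 1 - lg1⁻¹ • blockY P.innerAvg (pt (x ω) (y ω)))
        (A' := fun ω v => (1 - lg1⁻¹ • blockY P.innerAvg (pt (x ω) (y ω))) v)
        (r := |1 - mug / lg1|) (abs_nonneg _)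
        (fun ω v w => by
          simp only [sub_apply, one_apply_eq_self,
            smul_apply, inner_sub_left, inner_sub_right, real_inner_smul_left,
            real_inner_smul_right]
          rw [R.blockY_symm, real_inner_comm w])
        (fun ω v => R.norm_one_sub_blockY_le _ v)
        (fun U hU => by
          exact hU.sub (((R.continuous_blockY.comp continuous_fst).clm_apply
            continuous_snd).measurable.comp (hz.prodMk hU) |>.const_smul lg1⁻¹))
      refine (h3.trans h4).trans ?_
      simp only [map_smul, pow_succ', mul_apply_eq_comp]
      exact SameCondMean.refl _

end FedProblem

namespace BilevelRegular

variable {d₁ d₂ : ℕ} {F G : Pt d₁ d₂ → ℝ} {lf0 lf1 lg1 lg2 mug : ℝ}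
  (R : BilevelRegular F G lf0 lf1 lg1 lg2 mug)
include R

theorem continuous_neumann_term (n : ℕ) :
    Continuous fun z => ((1 - lg1⁻¹ • blockY G z) ^ n) (gradY F z) :=
  ((continuous_const.sub (R.continuous_blockY.const_smul lg1⁻¹)).pow n).clm_apply
    (prY.continuous.comp R.continuous_gradF)

theorem continuous_neumannGrad (N : ℕ) : Continuous (neumannGrad F G lg1 N) :=
  (prX.continuous.comp R.continuous_gradF).sub (R.continuous_blockXY.clm_apply
    ((continuous_finsetSum _ fun n _ => R.continuous_neumann_term n).const_smul lg1⁻¹))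

theorem norm_neumannGrad_le (N : ℕ) (z : Pt d₁ d₂) : ‖neumannGrad F G lg1 N z‖
    ≤ lg1 / mug * lf0 * |1 - mug / lg1| ^ N + (lf0 + lg1 * (lf0 / mug)) := by
  have h := norm_add_le (neumannGrad F G lg1 N z - hypergrad F G z) (hypergrad F G z)
  rw [sub_add_cancel] at h
  exact h.trans (add_le_add (R.norm_neumannGrad_sub_le z N) (R.hypergrad_le z))

end BilevelRegular

namespace FedProblem

variable {m d₁ d₂ : ℕ} {Ξ Ζ Ω : Type*} [MeasurableSpace Ξ] [MeasurableSpace Ζ]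
  {mΩ : MeasurableSpace Ω} {Pr : Measure Ω} [IsProbabilityMeasure Pr]
  {P : FedProblem m d₁ d₂ Ξ Ζ} {lf0 lf1 lg1 lg2 mug vf vg1 vg2 : ℝ} {N : ℕ} {W : Ω → Draws m Ξ Ζ}

/-- The draws made before the outer optimizer starts in outer round `k`. -/
def outerPast (m k T : ℕ) : Set (DrawIdx m) :=
  innerPast m k T ∪ (⋃ n, ihgpDraws m k n) ∪ {.len k}

/-- A bound on the conditional root mean square of the output of the inverse-Hessian-gradient
product. -/
def ihgpSize (lf0 lg1 vf vg2 : ℝ) (N : ℕ) : ℝ :=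
  (2 + √vg2 / lg1) ^ N * (N / lg1 * (lf0 + √vf))

theorem ihgpSize_nonneg (hlf0 : 0 ≤ lf0) (hlg1 : 0 < lg1) : 0 ≤ ihgpSize lf0 lg1 vf vg2 N := by
  unfold ihgpSize; positivity

/-- The output of the inverse-Hessian-gradient product: the uniformly random stopping index turns
the terms of the Neumann series into its partial sum. -/
theorem fedIHGP_len_moments (hm : 0 < m) (hN : 1 ≤ N) (hP : P.WellBehaved lf0 lf1 lg1 lg2 mug)
    (R : BilevelRegular P.outerAvg P.innerAvg lf0 lf1 lg1 lg2 mug)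
    (hQ : P.StochasticSamples vf vg1 vg2) (hS : P.IsSampling Pr N W) {k T : ℕ}
    {x : Ω → Vec d₁} {y : Ω → Vec d₂} (hx : Measurable[past W (innerPast m k T)] x)
    (hy : Measurable[past W (innerPast m k T)] y) :
    Measurable[past W (outerPast m k T)] (fun ω => P.fedIHGP lg1 N (x ω) (y ω)
      ((W ω).subset k) ((W ω).ihgpGrad k) ((W ω).ihgpHess k) ((W ω).len k)) ∧
    CondSized Pr (past W (innerPast m k T)) (ihgpSize lf0 lg1 vf vg2 N)
      (fun ω => P.fedIHGP lg1 N (x ω) (y ω)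
        ((W ω).subset k) ((W ω).ihgpGrad k) ((W ω).ihgpHess k) ((W ω).len k)) ∧
    SameCondMean Pr (past W (innerPast m k T)) (fun ω => P.fedIHGP lg1 N (x ω) (y ω)
        ((W ω).subset k) ((W ω).ihgpGrad k) ((W ω).ihgpHess k) ((W ω).len k))
      (fun ω => lg1⁻¹ • ∑ n ∈ Finset.range N,
        ((1 - lg1⁻¹ • blockY P.innerAvg (pt (x ω) (y ω))) ^ n)
          (gradY P.outerAvg (pt (x ω) (y ω)))) := by
  have hl := R.lg1_pos
  have hf0 := R.lf0_nonneg
  have hne : Nonempty (Fin N) := ⟨⟨0, hN⟩⟩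
  have hcard : (Fintype.card (Fin N) : ℝ) = N := by simp
  have hN0 : (N : ℝ) ≠ 0 := by positivity
  have hmom := fun n => fedIHGP_moments hm hP R hQ hS hx hy n
  set p : ℕ → Ω → Vec d₂ := fun n ω => P.fedIHGP lg1 N (x ω) (y ω)
    ((W ω).subset k) ((W ω).ihgpGrad k) ((W ω).ihgpHess k) n with hp
  let S' : Set (DrawIdx m) := innerPast m k T ∪ ⋃ n, ihgpDraws m k n
  have hSS : innerPast m k T ⊆ S' := Set.subset_union_left
  have hpm : ∀ n, Measurable[past W S'] (p n) := fun n => (hmom n).1.mono (past_mono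
    (Set.union_subset_union_right _ (Set.subset_iUnion (fun n => ihgpDraws m k n) n))) le_rfl
  let w : Fin N → Ω → ℝ := fun n ω => if (W ω).len k = n then 1 else 0
  have hw : ∀ n, Measurable[DrawIdx.sigma W (.len k)] (w n) := by
    intro n s _
    exact ⟨{l | (if l = (n : ℕ) then (1 : ℝ) else 0) ∈ s}, trivial, rfl⟩
  have hwm : ∀ n, Measurable[mΩ] (w n) := fun n => (hw n).mono (hS.sigma_le _) le_rfl
  have h0 : ∀ n ω, 0 ≤ w n ω := fun n ω => by simp only [w]; split_ifs <;> norm_num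
  have h1 : ∀ ω, ∑ n, w n ω ≤ 1 := fun ω => by
    by_cases h : (W ω).len k < N
    · rw [Finset.sum_eq_single (⟨_, h⟩ : Fin N)]
      · simp [w]
      · intro b _ hb
        have : (W ω).len k ≠ b := fun e => hb (Fin.ext e.symm)
        simp [w, this]
      · simp
    · refine (Finset.sum_eq_zero fun n _ => ?_).trans_le zero_le_one
      have : (W ω).len k ≠ n := fun e => h (e ▸ n.2)
      simp [w, this]
  have hj : DrawIdx.len k ∉ S' := by
    simp [S', innerPast, drawsBefore, innerDraws, DrawIdx.round, ihgpDraws]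
  have hind : ∀ n, Indep (past W S') (MeasurableSpace.comap (w n) inferInstance) Pr := fun n =>
    indep_of_indep_of_le_right (hS.indep_past hj) (hw n).comap_le
  have hmean : ∀ n, ∫ ω, w n ω ∂Pr = (Fintype.card (Fin N) : ℝ)⁻¹ := fun n => by
    have e : w n = {ω | (W ω).len k = n}.indicator fun _ => 1 := by
      ext ω; simp [w, Set.indicator_apply]
    have hms : MeasurableSet {ω | (W ω).len k = n} :=
      hS.len_meas k (measurableSet_singleton (n : ℕ))
    rw [e, integral_indicator_const _ hms, hcard, hS.len_law k n n.2]
    simp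
  have hpc : ∀ n : Fin N, CondSized Pr (past W (innerPast m k T)) (ihgpSize lf0 lg1 vf vg2 N)
      (p n) := fun n => (hmom n).2.1.mono_const (by
    unfold ihgpSize
    gcongr
    · linarith [div_nonneg (Real.sqrt_nonneg vg2) hl.le]
    · exact n.2.le)
  have hae : (fun ω => ∑ n : Fin N, w n ω • p n ω) =ᵐ[Pr] fun ω => p ((W ω).len k) ω := by
    filter_upwards [hS.len_lt hN k] with ω h
    rw [Finset.sum_eq_single (⟨_, h⟩ : Fin N)]
    · simp [w]
    · intro b _ hb
      have : (W ω).len k ≠ b := fun e => hb (Fin.ext e.symm)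
      simp [w, this]
    · simp
  have hc0 : 0 ≤ ihgpSize lf0 lg1 vf vg2 N := ihgpSize_nonneg hf0 hl
  have hA := condSized_random_average h0 h1 hwm (past_mono hSS) (hS.past_le S') hind hmean
    (fun n => hpm n) hc0 hpc
  have hB := sameCondMean_random_average h0 h1 hwm (past_mono hSS) (hS.past_le S') hind hmean
    (fun n => hpm n) fun n => (hpc n).memLp
  refine ⟨?_, hA.congr_ae hae, (hB.congr_ae hae).trans ?_⟩
  · intro s hs
    have e : (fun ω => p ((W ω).len k) ω) ⁻¹' s = ⋃ n, {ω | (W ω).len k = n} ∩ p n ⁻¹' s := by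
      ext ω; simp
    have hsub : S' ⊆ outerPast m k T := Set.subset_union_left
    have hlen : ∀ n, MeasurableSet[past W (outerPast m k T)] {ω | (W ω).len k = n} := fun n =>
      sigma_le_past (W := W) (j := .len k) (Or.inr rfl) _ ⟨{n}, trivial, rfl⟩
    change MeasurableSet[past W (outerPast m k T)] ((fun ω => p ((W ω).len k) ω) ⁻¹' s)
    rw [e]
    exact MeasurableSet.iUnion fun n => (hlen n).inter (past_mono hsub _ (hpm n hs))
  · have hz : Measurable fun ω => pt (x ω) (y ω) := (hx.pt hy).mono (hS.past_le _) le_rfl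
    have hq : ∀ n : Fin N, MemLp (fun ω => (N / lg1 : ℝ) •
        ((1 - lg1⁻¹ • blockY P.innerAvg (pt (x ω) (y ω))) ^ (n : ℕ))
          (gradY P.outerAvg (pt (x ω) (y ω)))) 2 Pr := fun n => by
      refine MemLp.const_smul (c := (N / lg1 : ℝ)) (MemLp.of_bound
        ((R.continuous_neumann_term n).measurable.comp hz).aestronglyMeasurable
        (|1 - mug / lg1| ^ (n : ℕ) * lf0)
        (Filter.Eventually.of_forall fun ω => ?_))
      refine (R.norm_one_sub_blockY_pow_le _ _ _).trans ?_
      gcongr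
      exact R.gradY_le _
    refine (SameCondMean.avg (fun n : Fin N => (hmom n).2.2) (fun n => (hpc n).memLp) hq).trans ?_
    have e : ∀ ω, (Fintype.card (Fin N) : ℝ)⁻¹ • ∑ n : Fin N, (N / lg1 : ℝ) •
        ((1 - lg1⁻¹ • blockY P.innerAvg (pt (x ω) (y ω))) ^ (n : ℕ))
          (gradY P.outerAvg (pt (x ω) (y ω))) = lg1⁻¹ • ∑ n ∈ Finset.range N,
        ((1 - lg1⁻¹ • blockY P.innerAvg (pt (x ω) (y ω))) ^ n)
          (gradY P.outerAvg (pt (x ω) (y ω))) := fun ω => by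
      rw [Finset.sum_range, ← Finset.smul_sum, smul_smul, hcard]
      congr 1
      field_simp
    simp only [e]
    exact SameCondMean.refl _

/-! ### The outer optimizer -/

/-- A bound on the conditional root mean square of the global direction `h` of the outer
optimizer. -/
def globalSize (lf0 lg1 vf vg2 : ℝ) (N : ℕ) : ℝ :=
  lf0 + √vf + (lg1 + √vg2) * ihgpSize lf0 lg1 vf vg2 N

theorem globalSize_nonneg (hlf0 : 0 ≤ lf0) (hlg1 : 0 < lg1) :
    0 ≤ globalSize lf0 lg1 vf vg2 N := by
  have := ihgpSize_nonneg (vf := vf) (vg2 := vg2) (N := N) hlf0 hlg1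
  unfold globalSize; positivity

/-- The global direction of the outer optimizer has the truncated Neumann series as its
conditional mean. -/
theorem outer_direction_moments (hm : 0 < m) (hN : 1 ≤ N)
    (hP : P.WellBehaved lf0 lf1 lg1 lg2 mug)
    (R : BilevelRegular P.outerAvg P.innerAvg lf0 lf1 lg1 lg2 mug)
    (hQ : P.StochasticSamples vf vg1 vg2) (hS : P.IsSampling Pr N W) {k T : ℕ}
    {x : Ω → Vec d₁} {y : Ω → Vec d₂} (hx : Measurable[past W (innerPast m k T)] x)
    (hy : Measurable[past W (innerPast m k T)] y) {p : Ω → Vec d₂}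
    (hp : p = fun ω => P.fedIHGP lg1 N (x ω) (y ω)
      ((W ω).subset k) ((W ω).ihgpGrad k) ((W ω).ihgpHess k) ((W ω).len k)) :
    CondSized Pr (past W (innerPast m k T)) (globalSize lf0 lg1 vf vg2 N)
      (fun ω => (m : ℝ)⁻¹ • ∑ i, (gradX (P.f i ((W ω).outerAnchor k i)) (pt (x ω) (y ω))
        - hessXY (P.g i ((W ω).outerJac k i)) (pt (x ω) (y ω)) (p ω))) ∧
    SameCondMean Pr (past W (innerPast m k T))
      (fun ω => (m : ℝ)⁻¹ • ∑ i, (gradX (P.f i ((W ω).outerAnchor k i)) (pt (x ω) (y ω))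
        - hessXY (P.g i ((W ω).outerJac k i)) (pt (x ω) (y ω)) (p ω)))
      (fun ω => neumannGrad P.outerAvg P.innerAvg lg1 N (pt (x ω) (y ω))) := by
  have hl := R.lg1_pos
  have hf0 := R.lf0_nonneg
  have hne : Nonempty (Fin m) := ⟨⟨0, hm⟩⟩
  have hcard : (Fintype.card (Fin m) : ℝ) = m := by simp
  obtain ⟨hp1, hp2, hp3⟩ := fedIHGP_len_moments hm hN hP R hQ hS hx hy
  rw [← hp] at hp1 hp2 hp3
  set S := innerPast m k T with hSdef
  set S₁ := outerPast m k T with hS₁def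
  have hSS : S ⊆ S₁ := Set.subset_union_left.trans Set.subset_union_left
  have hz : Measurable[past W S] fun ω => pt (x ω) (y ω) := hx.pt hy
  have hle := hS.past_le S
  have hzm := hz.mono hle le_rfl
  have hpm := hp1.mono (hS.past_le _) le_rfl
  set c := ihgpSize lf0 lg1 vf vg2 N with hc
  let Y : Fin m → Ω → Vec d₁ := fun i ω => gradX (P.outerFun i) (pt (x ω) (y ω))
    - blockXY (P.innerFun i) (pt (x ω) (y ω)) (p ω)
  let nf : Fin m → Ω → Vec d₁ := fun i ω => prX (gradient (P.f i ((W ω).outerAnchor k i))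
    (pt (x ω) (y ω)) - gradient (P.outerFun i) (pt (x ω) (y ω)))
  let ng : Fin m → Ω → Vec d₁ := fun i ω =>
    prX ((hess (P.g i ((W ω).outerJac k i)) (pt (x ω) (y ω))
      - hess (P.innerFun i) (pt (x ω) (y ω))) (inY (p ω)))
  have hBm : ∀ i, Measurable fun ω => blockXY (P.innerFun i) (pt (x ω) (y ω)) (p ω) := fun i => by
    have hcont : Continuous fun q : Pt d₁ d₂ × Vec d₂ => hess (P.innerFun i) q.1 (inY q.2) :=
      ((hP.continuous_hess_innerFun i).comp continuous_fst).clm_apply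
        (inY.continuous.comp continuous_snd)
    exact prX.continuous.measurable.comp (hcont.measurable.comp (hzm.prodMk hpm))
  have hBc : ∀ i, CondSized Pr (past W S) (lg1 * c)
      fun ω => blockXY (P.innerFun i) (pt (x ω) (y ω)) (p ω) := fun i =>
    hp2.of_norm_le_mul hl.le hle (hBm i).aestronglyMeasurable fun ω =>
      hP.norm_blockXY_le hl.le i _ _
  have hFc : ∀ i, CondSized Pr (past W S) lf0
      fun ω => gradX (P.outerFun i) (pt (x ω) (y ω)) := fun i =>
    CondSized.of_norm_le hle (prX.continuous.measurable.comp
      ((continuous_of_norm_sub_le (hP.f_grad_lip i)).measurable.comp hzm)).aestronglyMeasurable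
      hf0 fun ω => (norm_prX_le _).trans (hP.outer_grad_le hf0 i _)
  have hYc : ∀ i, CondSized Pr (past W S) (lf0 + lg1 * c) (Y i) := fun i => (hFc i).sub (hBc i)
  have hjf : ∀ i, DrawIdx.outerAnchor k i ∉ S := fun i => by
    simp [hSdef, innerPast, drawsBefore, innerDraws, DrawIdx.round]
  have hjg : ∀ i, DrawIdx.outerJac k i ∉ S₁ := fun i => by
    simp [hS₁def, outerPast, innerPast, drawsBefore, innerDraws, DrawIdx.round, ihgpDraws]
  have hz1 := hz.mono (past_mono (W := W) hSS) le_rfl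
  have hfc : ∀ i, CondSized Pr (past W S) (√vf) (nf i) := fun i =>
    (hQ.oracle_gradF hP i).condSized hle (hS.outerAnchor_meas k i) (hS.outerAnchor_law k i)
      (hS.indep_past (hjf i)) hz prX norm_prX_le
  have hf1 : ∀ i, SameCondMean Pr (past W S) (nf i) fun _ => 0 := fun i =>
    (hQ.oracle_gradF hP i).sameCondMean hle (hS.outerAnchor_meas k i) (hS.outerAnchor_law k i)
      (hS.indep_past (hjf i)) hz prX norm_prX_le
  have hgc : ∀ i, CondSized Pr (past W S) (√vg2 * c) (ng i) := fun i =>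
    (hQ.oracle_hessG hP i).condSized_apply (past_mono hSS) (hS.past_le S₁)
      (hS.outerJac_meas k i) (hS.outerJac_law k i) (hS.indep_past (hjg i))
      hz1 hp1 hp2 prX norm_prX_le inY fun b => (norm_inY b).le
  have hg1 : ∀ i, SameCondMean Pr (past W S) (ng i) fun _ => 0 := fun i =>
    (hQ.oracle_hessG hP i).sameCondMean_apply (past_mono hSS) (hS.past_le S₁)
      (hS.outerJac_meas k i) (hS.outerJac_law k i) (hS.indep_past (hjg i))
      hz1 hp1 hp2.memLp prX norm_prX_le inY fun b => (norm_inY b).le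
  have hnc : ∀ i, CondSized Pr (past W S) (√vf + √vg2 * c) fun ω => nf i ω - ng i ω := fun i =>
    (hfc i).sub (hgc i)
  have hn0 : ∀ i, SameCondMean Pr (past W S) (fun ω => nf i ω - ng i ω) fun _ => 0 := fun i => by
    simpa only [sub_zero] using
      (hf1 i).sub (hg1 i) (hfc i).memLp (memLp_const 0) (hgc i).memLp (memLp_const 0)
  have hXe : ∀ i, (fun ω => gradX (P.f i ((W ω).outerAnchor k i)) (pt (x ω) (y ω))
      - hessXY (P.g i ((W ω).outerJac k i)) (pt (x ω) (y ω)) (p ω))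
      = fun ω => Y i ω + (nf i ω - ng i ω) := fun i => by
    ext1 ω
    simp only [Y, nf, ng, gradX_eq, hessXY_eq, blockXY_apply, sub_apply, map_sub]
    abel
  have hXc : ∀ i, CondSized Pr (past W S) (globalSize lf0 lg1 vf vg2 N)
      fun ω => gradX (P.f i ((W ω).outerAnchor k i)) (pt (x ω) (y ω))
      - hessXY (P.g i ((W ω).outerJac k i)) (pt (x ω) (y ω)) (p ω) := fun i => by
    rw [hXe]
    refine ((hYc i).add (hnc i)).mono_const (le_of_eq ?_)
    rw [globalSize]
    ring
  have hX0 : ∀ i, SameCondMean Pr (past W S)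
      (fun ω => gradX (P.f i ((W ω).outerAnchor k i)) (pt (x ω) (y ω))
        - hessXY (P.g i ((W ω).outerJac k i)) (pt (x ω) (y ω)) (p ω)) (Y i) := fun i => by
    rw [hXe]
    exact (SameCondMean.refl _).add_noise (hn0 i) (hYc i).memLp (hYc i).memLp (hnc i).memLp
  refine ⟨?_, ?_⟩
  · rw [← hcard]; exact CondSized.avg hXc
  · have h3 := SameCondMean.avg (r := (m : ℝ)⁻¹) hX0 (fun i => (hXc i).memLp)
      fun i => (hYc i).memLp
    have hYavg : (fun ω => (m : ℝ)⁻¹ • ∑ i, Y i ω)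
        = fun ω => gradX P.outerAvg (pt (x ω) (y ω))
          - blockXY P.innerAvg (pt (x ω) (y ω)) (p ω) := by
      ext1 ω
      simp only [Y, hP.gradX_outerAvg, hP.blockXY_innerAvg]
      rw [Finset.sum_sub_distrib, smul_sub]
    rw [hYavg] at h3
    have h4 := hp3.map hle (A := fun ω => blockXY P.innerAvg (pt (x ω) (y ω)))
      (A' := fun ω v => blockYX P.innerAvg (pt (x ω) (y ω)) v) hl.le
      (fun ω v w => by rw [real_inner_comm, R.blockXY_adjoint])
      (fun ω v => R.blockYX_le _ v)
      (fun U hU => by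
        have hcont : Continuous fun q : Pt d₁ d₂ × Vec d₁ => hess P.innerAvg q.1 (inX q.2) :=
          (R.continuous_hess.comp continuous_fst).clm_apply (inX.continuous.comp continuous_snd)
        exact prY.continuous.measurable.comp (hcont.measurable.comp (hz.prodMk hU)))
    have hFm : MemLp (fun ω => gradX P.outerAvg (pt (x ω) (y ω))) 2 Pr :=
      MemLp.of_bound (prX.continuous.measurable.comp
        (R.continuous_gradF.measurable.comp hzm)).aestronglyMeasurable lf0
        (Filter.Eventually.of_forall fun ω => R.gradX_le _)
    have hNm : MemLp (fun ω => neumannGrad P.outerAvg P.innerAvg lg1 N (pt (x ω) (y ω))) 2 Pr :=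
      MemLp.of_bound ((R.continuous_neumannGrad N).measurable.comp hzm).aestronglyMeasurable _
        (Filter.Eventually.of_forall fun ω => R.norm_neumannGrad_le N _)
    have hBm : MemLp (fun ω => blockXY P.innerAvg (pt (x ω) (y ω)) (p ω)) 2 Pr := by
      have h5 : MemLp (fun ω => (m : ℝ)⁻¹ • ∑ i, Y i ω) 2 Pr := memLp_avg fun i => (hYc i).memLp
      rw [hYavg] at h5
      refine (hFm.sub h5).ae_eq (Filter.Eventually.of_forall fun ω => ?_)
      simp only [Pi.sub_apply, sub_sub_cancel]
    have hMm := hFm.sub hNm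
    refine h3.trans ?_
    have h6 := (SameCondMean.refl (𝓕 := past W S) (Pr := Pr)
      fun ω => gradX P.outerAvg (pt (x ω) (y ω))).sub h4 hFm hFm hBm (by
        refine hMm.ae_eq (Filter.Eventually.of_forall fun ω => ?_)
        simp only [Pi.sub_apply, neumannGrad, sub_sub_cancel])
    exact h6

/-- A bound on the conditional root mean square of the total increment of the outer optimizer per
unit stepsize. -/
def incrementSize (lf0 lg1 vf vg2 : ℝ) (N : ℕ) : ℝ := 2 * globalSize lf0 lg1 vf vg2 N + 4 * √vf

/-- The outer optimizer moves by `-α H`, where `H` is conditionally bounded in mean square, and its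
conditional mean is the truncated Neumann series up to a drift of order `α`. -/
theorem fedOut_direction (hm : 0 < m) (hN : 1 ≤ N) (hP : P.WellBehaved lf0 lf1 lg1 lg2 mug)
    (R : BilevelRegular P.outerAvg P.innerAvg lf0 lf1 lg1 lg2 mug)
    (hQ : P.StochasticSamples vf vg1 vg2) (hS : P.IsSampling Pr N W) {k T : ℕ}
    {x : Ω → Vec d₁} {y : Ω → Vec d₂} (hx : Measurable[past W (innerPast m k T)] x)
    (hy : Measurable[past W (innerPast m k T)] y) {p : Ω → Vec d₂}
    (hp : p = fun ω => P.fedIHGP lg1 N (x ω) (y ω)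
      ((W ω).subset k) ((W ω).ihgpGrad k) ((W ω).ihgpHess k) ((W ω).len k))
    {α : ℝ} (hα : 0 ≤ α) (hsmall : α * lf1 ≤ 1 / 2) {τ : Fin m → ℕ} (hτ : ∀ i, 1 ≤ τ i) :
    Measurable[past W (drawsBefore m (k + 1))] (fun ω => P.fedOut τ α (x ω) (y ω) (p ω)
      ((W ω).outerAnchor k) ((W ω).outerJac k) ((W ω).outerLocal k)) ∧
    ∃ H d : Ω → Vec d₁, (∀ ω, P.fedOut τ α (x ω) (y ω) (p ω)
      ((W ω).outerAnchor k) ((W ω).outerJac k) ((W ω).outerLocal k) = x ω - α • H ω) ∧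
      CondSized Pr (past W (innerPast m k T)) (incrementSize lf0 lg1 vf vg2 N) H ∧
      MemLp d 2 Pr ∧ lpNorm d 2 Pr ≤ α * (lf1 * incrementSize lf0 lg1 vf vg2 N) ∧
      SameCondMean Pr (past W (innerPast m k T)) H
        (fun ω => neumannGrad P.outerAvg P.innerAvg lg1 N (pt (x ω) (y ω)) + d ω) := by
  have hl := R.lg1_pos
  have hf0 := R.lf0_nonneg
  have hf1 := R.lf1_pos
  obtain ⟨hp1, -, -⟩ := fedIHGP_len_moments hm hN hP R hQ hS hx hy
  obtain ⟨hh1, hh2⟩ := outer_direction_moments hm hN hP R hQ hS hx hy hp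
  rw [← hp] at hp1
  set S := innerPast m k T with hSdef
  set h : Ω → Vec d₁ := fun ω => (m : ℝ)⁻¹ • ∑ i,
    (gradX (P.f i ((W ω).outerAnchor k i)) (pt (x ω) (y ω))
      - hessXY (P.g i ((W ω).outerJac k i)) (pt (x ω) (y ω)) (p ω)) with hh
  set c := globalSize lf0 lg1 vf vg2 N with hc
  have hc0 : 0 ≤ c := globalSize_nonneg hf0 hl
  have hle := hS.past_le S
  let S₁ : Set (DrawIdx m) := outerPast m k T ∪
    {j | ∃ i, j = .outerAnchor k i ∨ j = .outerJac k i}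
  let S₂ : Fin m → ℕ → Set (DrawIdx m) := fun i ν => S₁ ∪ {j | ∃ ν' < ν, j = .outerLocal k i ν'}
  have hS0 : outerPast m k T ⊆ S₁ := Set.subset_union_left
  have hSS : S ⊆ S₁ := (Set.subset_union_left.trans Set.subset_union_left).trans hS0
  have hz1 : Measurable[past W S₁] fun ω => pt (x ω) (y ω) :=
    (hx.pt hy).mono (past_mono hSS) le_rfl
  have hhm : Measurable[past W S₁] h :=
    (Finset.measurable_fun_sum Finset.univ fun i _ =>
      (hQ.measurable_gradX_f hz1 ((comap_measurable _).mono (sigma_le_past (j := .outerAnchor k i)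
        (Or.inr ⟨i, Or.inl rfl⟩)) le_rfl)).sub
      (hQ.measurable_hessXY_g hz1 ((comap_measurable _).mono (sigma_le_past (j := .outerJac k i)
        (Or.inr ⟨i, Or.inr rfl⟩)) le_rfl) (hp1.mono (past_mono hS0) le_rfl))).const_smul (m : ℝ)⁻¹
  obtain ⟨n, d, hnd, hn, hn0, hd⟩ := averaged_local_updates (Pr := Pr) hm (𝓕₀ := past W S₁)
    (𝓕 := fun i ν => past W (S₂ i ν)) (fun i => by simp [S₂])
    (fun i ν ν' h => past_mono (Set.union_subset_union_right _ fun j ⟨ν'', h1, h2⟩ =>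
      ⟨ν'', h1.trans_le h, h2⟩)) (fun i ν => hS.past_le _) (hQ.oracle_gradF hP) hP.f_grad_lip
    hf1.le (Z := fun i ν ω => (W ω).outerLocal k i ν)
    (fun i ν => (comap_measurable _).mono (sigma_le_past (j := .outerLocal k i ν)
      (Or.inr ⟨ν, Nat.lt_succ_self ν, rfl⟩)) le_rfl)
    (fun i ν => hS.outerLocal_law k i ν)
    (fun i ν => hS.indep_past (j := .outerLocal k i ν) (by
      simp [S₂, S₁, outerPast, innerPast, drawsBefore, innerDraws, DrawIdx.round, ihgpDraws]))
    prX norm_prX_le inX norm_inX (base := fun ω => inY (y ω))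
    ((inY.continuous.measurable.comp hy).mono (past_mono hSS) le_rfl)
    (u := fun i ν ω => P.outLocal i (α / τ i) (x ω) (y ω) (h ω) ((W ω).outerLocal k i) ν)
    (u₀ := x) (h := h) (fun i => rfl) (hx.mono (past_mono hSS) le_rfl) hhm hα hτ
    (fun i ν ω => by simp only [add_comm (inY (y ω)), ← pt_eq]; rfl) hsmall
  have hdc : CondSized Pr (past W S) (2 * lf1 * α * (2 * √vf + c)) d := fun θ hθ hθ2 => by
    obtain ⟨a1, a2⟩ := hh1 θ hθ hθ2
    obtain ⟨b1, b2⟩ := hd θ (hθ.mono (past_mono hSS) le_rfl) hθ2 a1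
    refine ⟨b1, b2.trans ?_⟩
    rw [mul_assoc (2 * lf1 * α), add_mul]
    gcongr
  have hnS := hn.mono_sigma (past_mono (W := W) hSS)
  have hhn := hh1.add hnS
  refine ⟨?_, fun ω => h ω + n ω + d ω, d, hnd, ?_, hdc.memLp, hdc.lpNorm_le.trans_eq ?_, ?_⟩
  · have hbig : S₁ ⊆ drawsBefore m (k + 1) := by
      rintro j ((((hj | ⟨t', -, i, rfl | ⟨ν, rfl⟩⟩) | hj) | rfl) | ⟨i, rfl | rfl⟩)
      · exact Nat.lt_succ_of_lt hj
      all_goals try exact Nat.lt_succ_self k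
      obtain ⟨-, ⟨n, rfl⟩, ⟨i, rfl⟩ | ⟨n', -, rfl | ⟨i, rfl⟩⟩⟩ := hj <;>
        exact Nat.lt_succ_self k
    have hb := past_mono (W := W) hbig
    have hS' := past_mono (W := W) (hSS.trans hbig)
    exact hQ.measurable_fedOut (hx.mono hS' le_rfl) (hy.mono hS' le_rfl)
      (hp1.mono (past_mono (hS0.trans hbig)) le_rfl)
      (fun i => (comap_measurable _).mono (sigma_le_past (j := .outerAnchor k i)
        (Nat.lt_succ_self k)) le_rfl)
      (fun i => (comap_measurable _).mono (sigma_le_past (j := .outerJac k i)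
        (Nat.lt_succ_self k)) le_rfl)
      (fun i ν => (comap_measurable _).mono (sigma_le_past (j := .outerLocal k i ν)
        (Nat.lt_succ_self k)) le_rfl)
  · refine (hhn.add hdc).mono_const ?_
    have h1 : 2 * lf1 * α * (2 * √vf + c) ≤ 1 * (2 * √vf + c) := by
      gcongr
      linarith
    rw [incrementSize]
    linarith
  · rw [incrementSize]
    ring
  · have hmean := hh2.add_noise (hn0.mono_sigma (past_mono (W := W) hSS)) hh1.memLp
      (MemLp.of_bound ((R.continuous_neumannGrad N).measurable.comp
        ((hx.pt hy).mono hle le_rfl)).aestronglyMeasurable _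
        (Filter.Eventually.of_forall fun ω => R.norm_neumannGrad_le N _)) hnS.memLp
    exact hmean.add (SameCondMean.refl d) hhn.memLp
      (MemLp.of_bound ((R.continuous_neumannGrad N).measurable.comp
        ((hx.pt hy).mono hle le_rfl)).aestronglyMeasurable _
        (Filter.Eventually.of_forall fun ω => R.norm_neumannGrad_le N _)) hdc.memLp hdc.memLp

end FedProblem

/-! ### Descent and tracking for one outer step -/

namespace BilevelRegular

variable {d₁ d₂ : ℕ} {F G : Pt d₁ d₂ → ℝ} {lf0 lf1 lg1 lg2 mug : ℝ}
  (R : BilevelRegular F G lf0 lf1 lg1 lg2 mug) {ys : Vec d₁ → Vec d₂}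
  (hys : ∀ x, gradY G (pt x (ys x)) = 0)
  {Ω : Type*} {𝓕 : MeasurableSpace Ω} {mΩ : MeasurableSpace Ω} {Pr : Measure Ω}
  [IsProbabilityMeasure Pr]
include R

theorem norm_neumannGrad_sub_gradient_le (N : ℕ) (x : Vec d₁) (y : Vec d₂) :
    ‖neumannGrad F G lg1 N (pt x y) - hypergrad F G (pt x (ys x))‖
      ≤ |lf0 / lf1 * neumannBias lf1 lg1 mug N|
        + lipHyper lf0 lf1 lg1 lg2 mug * ‖y - ys x‖ := by
  have h := norm_add_le (neumannGrad F G lg1 N (pt x y) - hypergrad F G (pt x y))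
    (hypergrad F G (pt x y) - hypergrad F G (pt x (ys x)))
  rw [sub_add_sub_cancel] at h
  refine h.trans (add_le_add ?_ (R.norm_hypergrad_sub_gradient_le x y))
  refine abs_le_of_sq_le_sq' ?_ (abs_nonneg _) |>.2
  rw [sq_abs]
  exact R.norm_neumannGrad_sub_sq_le _ N

include hys

theorem continuous_graph_star : Continuous fun x => (pt x (ys x) : Pt d₁ d₂) :=
  continuous_pt.comp (continuous_id.prodMk (R.continuous_star hys))

theorem continuous_derivStar : Continuous (derivStar G ys) :=
  ((R.continuous_invBlockY.comp (R.continuous_graph_star hys)).clm_comp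
    (R.continuous_blockYX.comp (R.continuous_graph_star hys))).neg

theorem continuous_adjoint_derivStar : Continuous fun p : Vec d₁ × Vec d₂ =>
    ContinuousLinearMap.adjoint (derivStar G ys p.1) p.2 := by
  have h : Continuous (ContinuousLinearMap.adjoint (𝕜 := ℝ) (E := Vec d₁) (F := Vec d₂)) :=
    LinearIsometryEquiv.continuous _
  have h2 : Continuous fun p : Vec d₁ × Vec d₂ =>
      ContinuousLinearMap.adjoint (derivStar G ys p.1) :=
    (h.comp (R.continuous_derivStar hys)).comp continuous_fst
  exact h2.clm_apply continuous_snd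

theorem memLp_hypergrad_star {x : Ω → Vec d₁} (hx : Measurable x) :
    MemLp (fun ω => hypergrad F G (pt (x ω) (ys (x ω)))) 2 Pr :=
  MemLp.of_bound ((R.continuous_hypergrad.comp
    (R.continuous_graph_star hys)).measurable.comp hx).aestronglyMeasurable _
    (Filter.Eventually.of_forall fun _ => R.hypergrad_le _)

theorem integrable_obj {x : Ω → Vec d₁} (hx : Measurable x) (hx2 : MemLp x 2 Pr) :
    Integrable (fun ω => F (pt (x ω) (ys (x ω)))) Pr := by
  have h1 : Integrable (fun ω => (lf0 + lg1 * (lf0 / mug)) * ‖x ω - 0‖ + |F (pt 0 (ys 0))|) Pr := by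
    simp only [sub_zero]
    exact ((hx2.integrable one_le_two).norm.const_mul _).add (integrable_const _)
  have hc : Continuous fun x => F (pt x (ys x)) :=
    continuous_iff_continuousAt.2 fun x => (R.hasGradientAt_obj hys x).continuousAt
  refine h1.mono' (hc.measurable.comp hx).aestronglyMeasurable
    (Filter.Eventually.of_forall fun ω => ?_)
  have h2 := R.obj_lip hys (x ω) 0
  rw [Real.norm_eq_abs]
  have h3 := abs_add_le (F (pt (x ω) (ys (x ω))) - F (pt 0 (ys 0))) (F (pt 0 (ys 0)))
  rw [sub_add_cancel] at h3
  linarith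

variable {x : Ω → Vec d₁} {y : Ω → Vec d₂} {H d : Ω → Vec d₁} {α M δ : ℝ} {N : ℕ}

/-- Descent of the expected objective in one outer step. The first-order term only sees the
conditional mean of the increment `H`, which differs from the gradient by the Neumann bias, by the
distance of `y` to `y*(x)` and by the drift `d`. -/
theorem integral_obj_step_le (h𝓕 : 𝓕 ≤ mΩ) (hx : Measurable[𝓕] x) (hy : Measurable[𝓕] y)
    (hx2 : MemLp x 2 Pr) (he : MemLp (fun ω => y ω - ys (x ω)) 2 Pr) (hHm : Measurable[mΩ] H)
    (hH : CondSized Pr 𝓕 M H) (hd : MemLp d 2 Pr) (hdn : lpNorm d 2 Pr ≤ α * δ)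
    (hmean : SameCondMean Pr 𝓕 H fun ω => neumannGrad F G lg1 N (pt (x ω) (y ω)) + d ω)
    (hα : 0 ≤ α) :
    ∫ ω, F (pt (x ω - α • H ω) (ys (x ω - α • H ω))) ∂Pr
      ≤ ∫ ω, F (pt (x ω) (ys (x ω))) ∂Pr
        - α * (1 / 2 * ∫ ω, ‖hypergrad F G (pt (x ω) (ys (x ω)))‖ ^ 2 ∂Pr
          - (lf0 / lf1 * neumannBias lf1 lg1 mug N) ^ 2
          - lipHyper lf0 lf1 lg1 lg2 mug ^ 2 * ∫ ω, ‖y ω - ys (x ω)‖ ^ 2 ∂Pr)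
        + α ^ 2 * ((lf0 + lg1 * (lf0 / mug)) * δ
          + lipHyper lf0 lf1 lg1 lg2 mug * (1 + lg1 / mug) * M ^ 2) := by
  have hl := R.lg1_pos
  have hμ := R.mug_pos
  have hf0 := R.lf0_nonneg
  have hΦ0 := R.lipHyper_nonneg
  set LΦ := lipHyper lf0 lf1 lg1 lg2 mug with hLΦ
  set b := lf0 / lf1 * neumannBias lf1 lg1 mug N with hb
  set Bf := lf0 + lg1 * (lf0 / mug) with hBf
  have hBf0 : 0 ≤ Bf := by positivity
  set g : Ω → Vec d₁ := fun ω => hypergrad F G (pt (x ω) (ys (x ω))) with hg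
  set q : Ω → Vec d₁ := fun ω => neumannGrad F G lg1 N (pt (x ω) (y ω)) with hq
  have hxm := hx.mono h𝓕 le_rfl
  have hym := hy.mono h𝓕 le_rfl
  have hgm : Measurable[𝓕] g :=
    (R.continuous_hypergrad.comp (R.continuous_graph_star hys)).measurable.comp hx
  have hg2 : MemLp g 2 Pr := R.memLp_hypergrad_star hys hxm
  have hq2 : MemLp q 2 Pr :=
    MemLp.of_bound ((R.continuous_neumannGrad N).measurable.comp (hxm.pt hym)).aestronglyMeasurable
      _ (Filter.Eventually.of_forall fun ω => R.norm_neumannGrad_le N _)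
  have hH2 := hH.memLp
  have hx'2 : MemLp (fun ω => x ω - α • H ω) 2 Pr := hx2.sub (hH2.const_smul α)
  have hx'm : Measurable[mΩ] fun ω => x ω - α • H ω := hxm.sub (hHm.const_smul α)
  have hI := R.integrable_obj hys hxm hx2
  have hI' := R.integrable_obj hys hx'm hx'2
  have hstep : ∀ ω, F (pt (x ω - α • H ω) (ys (x ω - α • H ω))) ≤ F (pt (x ω) (ys (x ω)))
      - α * ⟪g ω, H ω⟫ + LΦ * (1 + lg1 / mug) * α ^ 2 * ‖H ω‖ ^ 2 := fun ω => by
    have h := R.obj_le hys (x ω) (x ω - α • H ω)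
    rw [sub_sub_cancel_left, inner_neg_right, real_inner_smul_right, norm_neg, norm_smul, mul_pow,
      Real.norm_eq_abs, sq_abs] at h
    linarith
  have hgH := integrable_inner hg2 hH2
  have h1 : ∫ ω, F (pt (x ω - α • H ω) (ys (x ω - α • H ω))) ∂Pr
      ≤ ∫ ω, F (pt (x ω) (ys (x ω))) ∂Pr - α * ∫ ω, ⟪g ω, H ω⟫ ∂Pr
        + LΦ * (1 + lg1 / mug) * α ^ 2 * ∫ ω, ‖H ω‖ ^ 2 ∂Pr := by
    have i1 : Integrable (fun ω => F (pt (x ω) (ys (x ω))) - α * ⟪g ω, H ω⟫) Pr :=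
      hI.sub (hgH.const_mul α)
    have i2 : Integrable (fun ω => LΦ * (1 + lg1 / mug) * α ^ 2 * ‖H ω‖ ^ 2) Pr :=
      hH2.integrable_norm_sq.const_mul _
    refine (integral_mono hI' (i1.add i2) hstep).trans_eq ?_
    rw [integral_add' i1 i2, integral_sub hI (hgH.const_mul α), integral_const_mul,
      integral_const_mul]
  have h2 : ∫ ω, ⟪g ω, H ω⟫ ∂Pr = ∫ ω, ⟪g ω, q ω⟫ ∂Pr + ∫ ω, ⟪g ω, d ω⟫ ∂Pr := by
    rw [hmean g hgm hg2, ← integral_add (integrable_inner hg2 hq2) (integrable_inner hg2 hd)]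
    simp only [inner_add_right, hq]
  have hgq : ∀ ω, 1 / 2 * ‖g ω‖ ^ 2 - b ^ 2 - LΦ ^ 2 * ‖y ω - ys (x ω)‖ ^ 2 ≤ ⟪g ω, q ω⟫ := by
    intro ω
    have h3 : ‖q ω - g ω‖ ≤ |b| + LΦ * ‖y ω - ys (x ω)‖ :=
      R.norm_neumannGrad_sub_gradient_le N (x ω) (y ω)
    have h4 : ‖q ω - g ω‖ ^ 2 ≤ (|b| + LΦ * ‖y ω - ys (x ω)‖) ^ 2 :=
      pow_le_pow_left₀ (norm_nonneg _) h3 2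
    have h5 := norm_sub_sq_real (q ω) (g ω)
    rw [real_inner_comm] at h5
    rw [← sq_abs b]
    nlinarith [sq_nonneg (|b| - LΦ * ‖y ω - ys (x ω)‖), sq_nonneg ‖q ω‖]
  have h3 : 1 / 2 * ∫ ω, ‖g ω‖ ^ 2 ∂Pr - b ^ 2 - LΦ ^ 2 * ∫ ω, ‖y ω - ys (x ω)‖ ^ 2 ∂Pr
      ≤ ∫ ω, ⟪g ω, q ω⟫ ∂Pr := by
    have i1 : Integrable (fun ω => 1 / 2 * ‖g ω‖ ^ 2) Pr := hg2.integrable_norm_sq.const_mul _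
    have i2 : Integrable (fun ω => 1 / 2 * ‖g ω‖ ^ 2 - b ^ 2) Pr := i1.sub (integrable_const _)
    have i3 : Integrable (fun ω => LΦ ^ 2 * ‖y ω - ys (x ω)‖ ^ 2) Pr :=
      he.integrable_norm_sq.const_mul _
    refine le_of_eq_of_le ?_ (integral_mono (i2.sub i3) (integrable_inner hg2 hq2) hgq)
    rw [integral_sub' i2 i3, integral_sub i1 (integrable_const _), integral_const_mul,
      integral_const_mul]
    simp
  have h4 : -(Bf * (α * δ)) ≤ ∫ ω, ⟪g ω, d ω⟫ ∂Pr := by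
    have h5 := (abs_le.1 (abs_integral_inner_le hg2 hd)).1
    have h6 : lpNorm g 2 Pr ≤ Bf :=
      (CondSized.of_norm_le (𝓕 := 𝓕) h𝓕 hg2.1 hBf0 fun ω => R.hypergrad_le _).lpNorm_le
    have h7 := mul_le_mul h6 hdn lpNorm_nonneg hBf0
    linarith
  have h5 : ∫ ω, ‖H ω‖ ^ 2 ∂Pr ≤ M ^ 2 := by
    rw [← lpNorm_two_sq hH2]
    exact pow_le_pow_left₀ lpNorm_nonneg hH.lpNorm_le 2
  have h6 := mul_le_mul_of_nonneg_left (add_le_add h3 h4) hα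
  have h7 : LΦ * (1 + lg1 / mug) * α ^ 2 * ∫ ω, ‖H ω‖ ^ 2 ∂Pr
      ≤ LΦ * (1 + lg1 / mug) * α ^ 2 * M ^ 2 := by gcongr
  rw [h2] at h1
  linarith

set_option maxHeartbeats 800000 in
/-- Growth of the expected squared distance to `y*` when `x` makes one outer step. The cross term is
expanded to second order: its linear part pairs `H` with the `𝓕`-measurable vector `y*'(x)ᵀ e`,
where `e = y - y*(x)`, and so again only involves the conditional mean of `H`. -/
theorem integral_tracking_step_le (h𝓕 : 𝓕 ≤ mΩ) (hx : Measurable[𝓕] x) (hy : Measurable[𝓕] y)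
    (he : MemLp (fun ω => y ω - ys (x ω)) 2 Pr) (hHm : Measurable[mΩ] H)
    (hH : CondSized Pr 𝓕 M H) (hd : MemLp d 2 Pr) (hdn : lpNorm d 2 Pr ≤ α * δ)
    (hmean : SameCondMean Pr 𝓕 H fun ω => neumannGrad F G lg1 N (pt (x ω) (y ω)) + d ω)
    (hα : 0 ≤ α) (hα1 : α ≤ 1) :
    MemLp (fun ω => y ω - ys (x ω - α • H ω)) 2 Pr ∧
    ∫ ω, ‖y ω - ys (x ω - α • H ω)‖ ^ 2 ∂Pr
      ≤ (1 + α * (6 * (lg1 / mug) ^ 2 + 2 * (lg1 / mug) * lipHyper lf0 lf1 lg1 lg2 mug + 1))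
          * ∫ ω, ‖y ω - ys (x ω)‖ ^ 2 ∂Pr
        + α * (1 / 4 * ∫ ω, ‖hypergrad F G (pt (x ω) (ys (x ω)))‖ ^ 2 ∂Pr
          + (lf0 / lf1 * neumannBias lf1 lg1 mug N) ^ 2)
        + α ^ 2 * (δ ^ 2 + quadStar lg1 lg2 mug ^ 2 * M ^ 4 + (lg1 / mug) ^ 2 * M ^ 2) := by
  have hl := R.lg1_pos
  have hμ := R.mug_pos
  have hl2 := R.lg2_nonneg
  have hΦ0 := R.lipHyper_nonneg
  set LΦ := lipHyper lf0 lf1 lg1 lg2 mug with hLΦ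
  set b := lf0 / lf1 * neumannBias lf1 lg1 mug N with hb
  set Ly := lg1 / mug with hLy
  have hLy0 : 0 ≤ Ly := by positivity
  set LR := quadStar lg1 lg2 mug with hLR
  have hLR0 : 0 ≤ LR := by rw [hLR, quadStar]; positivity
  set g : Ω → Vec d₁ := fun ω => hypergrad F G (pt (x ω) (ys (x ω))) with hg
  set q : Ω → Vec d₁ := fun ω => neumannGrad F G lg1 N (pt (x ω) (y ω)) with hq
  set e : Ω → Vec d₂ := fun ω => y ω - ys (x ω) with he_def
  set U : Ω → Vec d₁ := fun ω => ContinuousLinearMap.adjoint (derivStar G ys (x ω)) (e ω) with hU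
  have hxm := hx.mono h𝓕 le_rfl
  have hym := hy.mono h𝓕 le_rfl
  have hsc := R.continuous_star hys
  have hem : Measurable[𝓕] e := hy.sub (hsc.measurable.comp hx)
  have hUm : Measurable[𝓕] U := by
    have h1 := (R.continuous_adjoint_derivStar hys).measurable
    have h2 := hx.prodMk hem
    have h3 := h1.comp h2
    exact h3
  have hUe : ∀ ω, ‖U ω‖ ≤ Ly * ‖e ω‖ := fun ω => by
    refine (ContinuousLinearMap.le_opNorm _ _).trans ?_
    rw [LinearIsometryEquiv.norm_map]
    gcongr
    exact ContinuousLinearMap.opNorm_le_bound _ hLy0 fun v => R.derivStar_le (ys := ys) _ v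
  have hUe' : ∀ ω, ‖U ω‖ ≤ ‖Ly • e ω‖ := fun ω => by
    rw [norm_smul, Real.norm_of_nonneg hLy0]; exact hUe ω
  have hU2 : MemLp U 2 Pr := (he.const_smul Ly).mono
    (hUm.mono h𝓕 le_rfl).aestronglyMeasurable (Filter.Eventually.of_forall hUe')
  have hg2 : MemLp g 2 Pr := R.memLp_hypergrad_star hys hxm
  have hq2 : MemLp q 2 Pr :=
    MemLp.of_bound ((R.continuous_neumannGrad N).measurable.comp (hxm.pt hym)).aestronglyMeasurable
      _ (Filter.Eventually.of_forall fun ω => R.norm_neumannGrad_le N _)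
  have hH2 := hH.memLp
  -- the weight `√‖e‖` turns `E[‖e‖ ‖H‖²]` into a conditional second moment
  set θ : Ω → ℝ := fun ω => √‖e ω‖ with hθ
  have hθsq : ∀ ω, ‖θ ω‖ ^ 2 = ‖e ω‖ := fun ω => by
    rw [Real.norm_eq_abs, sq_abs]; exact Real.sq_sqrt (norm_nonneg _)
  have hθm : Measurable[𝓕] θ := (Real.continuous_sqrt.comp continuous_norm).measurable.comp hem
  have hθ2 : MemLp θ 2 Pr := by
    rw [memLp_two_iff_integrable_sq_norm (hθm.mono h𝓕 le_rfl).aestronglyMeasurable]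
    simp only [hθsq]
    exact (he.integrable one_le_two).norm
  obtain ⟨hθH, hθHn⟩ := hH θ hθm hθ2
  have hθHsq : ∀ ω, ‖θ ω • H ω‖ ^ 2 = ‖e ω‖ * ‖H ω‖ ^ 2 := fun ω => by
    rw [norm_smul, mul_pow, hθsq]
  have heH : ∫ ω, ‖e ω‖ * ‖H ω‖ ^ 2 ∂Pr ≤ M ^ 2 * ∫ ω, ‖e ω‖ ∂Pr := by
    simp only [← hθHsq]
    rw [← lpNorm_two_sq hθH]
    refine (pow_le_pow_left₀ lpNorm_nonneg hθHn 2).trans_eq ?_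
    rw [mul_pow, lpNorm_two_sq hθ2]
    simp only [hθsq]
  have hIeH : Integrable (fun ω => ‖e ω‖ * ‖H ω‖ ^ 2) Pr := by
    simpa only [hθHsq] using hθH.integrable_norm_sq
  have hs2 : MemLp (fun ω => ys (x ω - α • H ω) - ys (x ω)) 2 Pr := by
    refine ((hH2.const_smul (Ly * α))).mono ((hsc.measurable.comp
      (hxm.sub (hHm.const_smul α))).sub (hsc.measurable.comp hxm)).aestronglyMeasurable
      (Filter.Eventually.of_forall fun ω => ?_)
    have h := R.star_lip hys (x ω - α • H ω) (x ω)
    rw [sub_sub_cancel_left, norm_neg, norm_smul, ← mul_assoc] at h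
    rw [Pi.smul_apply, norm_smul, norm_mul, Real.norm_of_nonneg hLy0]
    exact h
  have hsplit : ∀ ω, y ω - ys (x ω - α • H ω) = e ω - (ys (x ω - α • H ω) - ys (x ω)) := fun ω => by
    simp only [he_def]; abel
  have hmem : MemLp (fun ω => y ω - ys (x ω - α • H ω)) 2 Pr := by
    simp only [hsplit]
    exact he.sub hs2
  refine ⟨hmem, ?_⟩
  have hstep : ∀ ω, ‖y ω - ys (x ω - α • H ω)‖ ^ 2 ≤ ‖e ω‖ ^ 2 + 2 * α * ⟪U ω, H ω⟫
      + 2 * LR * α ^ 2 * (‖e ω‖ * ‖H ω‖ ^ 2) + Ly ^ 2 * α ^ 2 * ‖H ω‖ ^ 2 := fun ω => by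
    rw [hsplit, norm_sub_sq_real]
    have h1 := R.star_lip hys (x ω - α • H ω) (x ω)
    have h2 := R.star_quad hys (x ω) (x ω - α • H ω)
    rw [sub_sub_cancel_left, norm_neg, norm_smul, Real.norm_of_nonneg hα] at h1 h2
    set D := ys (x ω - α • H ω) - ys (x ω) with hD
    set r := D - derivStar G ys (x ω) (-(α • H ω)) with hr
    have h3 : ‖D‖ ^ 2 ≤ (Ly * (α * ‖H ω‖)) ^ 2 := pow_le_pow_left₀ (norm_nonneg _) h1 2
    have h4 : ⟪e ω, D⟫ = -(α * ⟪U ω, H ω⟫) + ⟪e ω, r⟫ := by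
      have : D = derivStar G ys (x ω) (-(α • H ω)) + r := by rw [hr]; abel
      rw [this, inner_add_right, map_neg, map_smul, inner_neg_right, real_inner_smul_right, hU]
      simp only
      rw [ContinuousLinearMap.adjoint_inner_left]
    have h5 : -(‖e ω‖ * (LR * (α * ‖H ω‖) ^ 2)) ≤ ⟪e ω, r⟫ := by
      have h6 := (abs_le.1 (abs_real_inner_le_norm (e ω) r)).1
      have h7 : ‖e ω‖ * ‖r‖ ≤ ‖e ω‖ * (LR * (α * ‖H ω‖) ^ 2) := by gcongr
      linarith
    rw [h4]
    nlinarith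
  have hUH := integrable_inner hU2 hH2
  have h1 : ∫ ω, ‖y ω - ys (x ω - α • H ω)‖ ^ 2 ∂Pr ≤ ∫ ω, ‖e ω‖ ^ 2 ∂Pr
      + 2 * α * ∫ ω, ⟪U ω, H ω⟫ ∂Pr + 2 * LR * α ^ 2 * ∫ ω, ‖e ω‖ * ‖H ω‖ ^ 2 ∂Pr
      + Ly ^ 2 * α ^ 2 * ∫ ω, ‖H ω‖ ^ 2 ∂Pr := by
    have i0 := he.integrable_norm_sq
    have i1 : Integrable (fun ω => 2 * α * ⟪U ω, H ω⟫) Pr := hUH.const_mul _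
    have i2 : Integrable (fun ω => 2 * LR * α ^ 2 * (‖e ω‖ * ‖H ω‖ ^ 2)) Pr := hIeH.const_mul _
    have i3 : Integrable (fun ω => Ly ^ 2 * α ^ 2 * ‖H ω‖ ^ 2) Pr :=
      hH2.integrable_norm_sq.const_mul _
    refine (integral_mono hmem.integrable_norm_sq (((i0.add i1).add i2).add i3) hstep).trans_eq ?_
    rw [integral_add' ((i0.add i1).add i2) i3, integral_add' (i0.add i1) i2, integral_add' i0 i1,
      integral_const_mul, integral_const_mul, integral_const_mul]
  have h2 : ∫ ω, ⟪U ω, H ω⟫ ∂Pr = ∫ ω, ⟪U ω, q ω⟫ ∂Pr + ∫ ω, ⟪U ω, d ω⟫ ∂Pr := by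
    rw [hmean U hUm hU2, ← integral_add (integrable_inner hU2 hq2) (integrable_inner hU2 hd)]
    simp only [inner_add_right, hq]
  set E := ∫ ω, ‖e ω‖ ^ 2 ∂Pr with hE
  have hUq : ∀ ω, 2 * ⟪U ω, q ω⟫ ≤ 1 / 4 * ‖g ω‖ ^ 2 + b ^ 2
      + (5 * Ly ^ 2 + 2 * Ly * LΦ) * ‖e ω‖ ^ 2 := fun ω => by
    have a1 : ‖q ω - g ω‖ ≤ |b| + LΦ * ‖e ω‖ := R.norm_neumannGrad_sub_gradient_le N (x ω) (y ω)
    have a2 : ‖q ω‖ ≤ ‖g ω‖ + (|b| + LΦ * ‖e ω‖) := by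
      have := norm_add_le (q ω - g ω) (g ω)
      rw [sub_add_cancel] at this
      linarith
    have a3 : ⟪U ω, q ω⟫ ≤ Ly * ‖e ω‖ * (‖g ω‖ + (|b| + LΦ * ‖e ω‖)) :=
      (real_inner_le_norm _ _).trans (mul_le_mul (hUe ω) a2 (norm_nonneg _) (by positivity))
    rw [← sq_abs b]
    nlinarith [sq_nonneg (1 / 2 * ‖g ω‖ - 2 * (Ly * ‖e ω‖)), sq_nonneg (|b| - Ly * ‖e ω‖)]
  have h3 : 2 * ∫ ω, ⟪U ω, q ω⟫ ∂Pr ≤ 1 / 4 * ∫ ω, ‖g ω‖ ^ 2 ∂Pr + b ^ 2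
      + (5 * Ly ^ 2 + 2 * Ly * LΦ) * E := by
    have i1 : Integrable (fun ω => 1 / 4 * ‖g ω‖ ^ 2) Pr := hg2.integrable_norm_sq.const_mul _
    have i2 : Integrable (fun ω => 1 / 4 * ‖g ω‖ ^ 2 + b ^ 2) Pr := i1.add (integrable_const _)
    have i3 : Integrable (fun ω => (5 * Ly ^ 2 + 2 * Ly * LΦ) * ‖e ω‖ ^ 2) Pr :=
      he.integrable_norm_sq.const_mul _
    rw [← integral_const_mul]
    refine (integral_mono ((integrable_inner hU2 hq2).const_mul 2) (i2.add i3) hUq).trans_eq ?_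
    rw [integral_add' i2 i3, integral_add i1 (integrable_const _), integral_const_mul,
      integral_const_mul]
    simp [hE]
  have hlpe : lpNorm e 2 Pr ^ 2 = E := lpNorm_two_sq he
  have hlp0 : 0 ≤ lpNorm e 2 Pr := lpNorm_nonneg
  have hE0 : 0 ≤ E := hlpe ▸ sq_nonneg _
  have h4 : 2 * ∫ ω, ⟪U ω, d ω⟫ ∂Pr ≤ Ly ^ 2 * E + α * δ ^ 2 := by
    have a1 := (abs_le.1 (abs_integral_inner_le hU2 hd)).2
    have a2 : lpNorm U 2 Pr ≤ Ly * lpNorm e 2 Pr := by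
      refine (lpNorm_two_mono (he.const_smul Ly) hUe').trans_eq ((lpNorm_two_smul Ly e).trans ?_)
      rw [abs_of_nonneg hLy0]
    have a3 := mul_le_mul a2 hdn lpNorm_nonneg (by positivity)
    have a4 : 0 ≤ α * (Ly * lpNorm e 2 Pr - δ) ^ 2 := by positivity
    have a5 : 0 ≤ (1 - α) * (Ly * lpNorm e 2 Pr) ^ 2 :=
      mul_nonneg (by linarith) (sq_nonneg _)
    rw [← hlpe]
    nlinarith
  have h5 : ∫ ω, ‖H ω‖ ^ 2 ∂Pr ≤ M ^ 2 := by
    rw [← lpNorm_two_sq hH2]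
    exact pow_le_pow_left₀ lpNorm_nonneg hH.lpNorm_le 2
  have h6 : 2 * LR * M ^ 2 * ∫ ω, ‖e ω‖ ∂Pr ≤ E + LR ^ 2 * M ^ 4 := by
    rw [← integral_const_mul]
    have i1 : Integrable (fun ω => ‖e ω‖ ^ 2 + LR ^ 2 * M ^ 4) Pr :=
      he.integrable_norm_sq.add (integrable_const _)
    refine (integral_mono ((he.integrable one_le_two).norm.const_mul _) i1 fun ω => ?_).trans_eq ?_
    · change 2 * LR * M ^ 2 * ‖e ω‖ ≤ ‖e ω‖ ^ 2 + LR ^ 2 * M ^ 4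
      have h := two_mul_le_add_sq ‖e ω‖ (LR * M ^ 2)
      have h4 : (LR * M ^ 2) ^ 2 = LR ^ 2 * M ^ 4 := by ring
      rw [h4] at h
      linarith
    · rw [integral_add he.integrable_norm_sq (integrable_const _)]
      simp [hE]
  have b1 : 2 * LR * α ^ 2 * ∫ ω, ‖e ω‖ * ‖H ω‖ ^ 2 ∂Pr
      ≤ 2 * LR * α ^ 2 * (M ^ 2 * ∫ ω, ‖e ω‖ ∂Pr) := by gcongr
  have b2 : Ly ^ 2 * α ^ 2 * ∫ ω, ‖H ω‖ ^ 2 ∂Pr ≤ Ly ^ 2 * α ^ 2 * M ^ 2 := by gcongr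
  have b3 := mul_le_mul_of_nonneg_left h6 (sq_nonneg α)
  have b4 := mul_le_mul_of_nonneg_left (add_le_add h3 h4) hα
  have b5 : α ^ 2 * E ≤ α * E := by
    rw [sq]
    exact mul_le_mul_of_nonneg_right (mul_le_of_le_one_left hα hα1) hE0
  rw [h2] at h1
  linarith

end BilevelRegular

/-! ### The potential over the rounds -/

/-- The coefficient, per unit outer stepsize, with which the squared distance to `y*` feeds into the
potential: `lipHyper ^ 2` from the descent of the objective, the rest from the movement of `y*`. -/
def couplingRate (lf0 lf1 lg1 lg2 mug : ℝ) : ℝ :=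
  lipHyper lf0 lf1 lg1 lg2 mug ^ 2 + 6 * (lg1 / mug) ^ 2
    + 2 * (lg1 / mug) * lipHyper lf0 lf1 lg1 lg2 mug + 1

/-- The ratio of the total inner stepsize of a round to the outer stepsize `α`. It is chosen such
that the inner rounds together contract the squared distance to `y*` by `1 - couplingRate * α`,
which compensates the factor `1 + couplingRate * α` of the outer step. -/
def innerRatio (lf0 lf1 lg1 lg2 mug : ℝ) : ℝ := 2 * couplingRate lf0 lf1 lg1 lg2 mug / mug

/-- The noise added to the potential in one round, per squared outer stepsize; `M` bounds the outer
increments. -/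
def roundNoise (lf0 lf1 lg1 lg2 mug vg1 M : ℝ) : ℝ :=
  (lf0 + lg1 * (lf0 / mug)) * (lf1 * M)
    + lipHyper lf0 lf1 lg1 lg2 mug * (1 + lg1 / mug) * M ^ 2
    + ((lf1 * M) ^ 2 + quadStar lg1 lg2 mug ^ 2 * M ^ 4 + (lg1 / mug) ^ 2 * M ^ 2)
    + 96 * innerRatio lf0 lf1 lg1 lg2 mug ^ 2 * vg1

theorem couplingRate_pos {lf0 lf1 lg1 lg2 mug : ℝ} (hlf0 : 0 ≤ lf0) (hlf1 : 0 < lf1)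
    (hlg1 : 0 < lg1) (hlg2 : 0 ≤ lg2) (hmug : 0 < mug) : 0 < couplingRate lf0 lf1 lg1 lg2 mug := by
  unfold couplingRate lipHyper; positivity

theorem innerRatio_pos {lf0 lf1 lg1 lg2 mug : ℝ} (hlf0 : 0 ≤ lf0) (hlf1 : 0 < lf1)
    (hlg1 : 0 < lg1) (hlg2 : 0 ≤ lg2) (hmug : 0 < mug) : 0 < innerRatio lf0 lf1 lg1 lg2 mug := by
  have := couplingRate_pos hlf0 hlf1 hlg1 hlg2 hmug
  unfold innerRatio; positivity

theorem roundNoise_nonneg {lf0 lf1 lg1 lg2 mug vg1 M : ℝ} (hlf0 : 0 ≤ lf0) (hlf1 : 0 < lf1)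
    (hlg1 : 0 < lg1) (hlg2 : 0 ≤ lg2) (hmug : 0 < mug) (hvg1 : 0 ≤ vg1) (hM : 0 ≤ M) :
    0 ≤ roundNoise lf0 lf1 lg1 lg2 mug vg1 M := by
  unfold roundNoise lipHyper; positivity

namespace FedProblem

variable {m d₁ d₂ : ℕ} {Ξ Ζ Ω : Type*} [MeasurableSpace Ξ] [MeasurableSpace Ζ]
  {mΩ : MeasurableSpace Ω} {Pr : Measure Ω} [IsProbabilityMeasure Pr]
  {P : FedProblem m d₁ d₂ Ξ Ζ} {lf0 lf1 lg1 lg2 mug vf vg1 vg2 : ℝ} {N : ℕ} {W : Ω → Draws m Ξ Ζ}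

/-- The conditions on the outer stepsize `α` under which the potential decreases. -/
structure SmallStep (lf0 lf1 lg1 lg2 mug α : ℝ) : Prop where
  pos : 0 < α
  le_one : α ≤ 1
  outer : α * lf1 ≤ 1 / 2
  coupling : 2 * couplingRate lf0 lf1 lg1 lg2 mug * α ≤ 1
  inner : innerRatio lf0 lf1 lg1 lg2 mug * α * lg1 ≤ 1 / 2
  contraction : 18 * lg1 ^ 2 * (innerRatio lf0 lf1 lg1 lg2 mug * α) ≤ mug

/-- One outer round decreases the potential `E f(x) + E ‖y - y*(x)‖²` by a multiple of the squared
gradient norm, up to bias and noise. -/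
theorem round_potential (hm : 0 < m) (hN : 1 ≤ N) (hP : P.WellBehaved lf0 lf1 lg1 lg2 mug)
    (R : BilevelRegular P.outerAvg P.innerAvg lf0 lf1 lg1 lg2 mug)
    (hQ : P.StochasticSamples vf vg1 vg2) (hvg1 : 0 ≤ vg1) (hS : P.IsSampling Pr N W)
    {k T : ℕ} (hT : 1 ≤ T) {x : Ω → Vec d₁} {y : Ω → Vec d₂}
    (hx : Measurable[past W (drawsBefore m k)] x) (hy : Measurable[past W (drawsBefore m k)] y)
    (hx2 : MemLp x 2 Pr) (he : MemLp (fun ω => y ω - P.yStar (x ω)) 2 Pr)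
    {α β : ℝ} (hα : SmallStep lf0 lf1 lg1 lg2 mug α)
    (hβ : β = innerRatio lf0 lf1 lg1 lg2 mug * α / T) {τ : Fin m → ℕ} (hτ : ∀ i, 1 ≤ τ i)
    {x' : Ω → Vec d₁} {y' p : Ω → Vec d₂}
    (hy' : y' = fun ω => P.innerIter τ β (x ω) (y ω) (W ω) k T)
    (hp : p = fun ω => P.fedIHGP lg1 N (x ω) (y' ω)
      ((W ω).subset k) ((W ω).ihgpGrad k) ((W ω).ihgpHess k) ((W ω).len k))
    (hx' : x' = fun ω => P.fedOut τ α (x ω) (y' ω) (p ω)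
      ((W ω).outerAnchor k) ((W ω).outerJac k) ((W ω).outerLocal k)) :
    Measurable[past W (drawsBefore m (k + 1))] x' ∧
    Measurable[past W (drawsBefore m (k + 1))] y' ∧
    MemLp x' 2 Pr ∧ MemLp (fun ω => y' ω - P.yStar (x' ω)) 2 Pr ∧
    ∫ ω, P.obj (x' ω) ∂Pr + ∫ ω, ‖y' ω - P.yStar (x' ω)‖ ^ 2 ∂Pr
      ≤ ∫ ω, P.obj (x ω) ∂Pr + ∫ ω, ‖y ω - P.yStar (x ω)‖ ^ 2 ∂Pr
        - α / 4 * ∫ ω, ‖gradient P.obj (x ω)‖ ^ 2 ∂Pr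
        + 2 * α * (lf0 / lf1 * neumannBias lf1 lg1 mug N) ^ 2
        + α ^ 2 * roundNoise lf0 lf1 lg1 lg2 mug vg1 (incrementSize lf0 lg1 vf vg2 N) := by
  have hl := R.lg1_pos
  have hμ := R.mug_pos
  have hys := gradY_yStar R
  have hα0 := hα.pos
  have hQ0 := couplingRate_pos R.lf0_nonneg R.lf1_pos hl R.lg2_nonneg hμ
  have hr0 := innerRatio_pos R.lf0_nonneg R.lf1_pos hl R.lg2_nonneg hμ
  have hrμ : innerRatio lf0 lf1 lg1 lg2 mug * mug = 2 * couplingRate lf0 lf1 lg1 lg2 mug := by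
    rw [innerRatio]; field_simp
  set Q := couplingRate lf0 lf1 lg1 lg2 mug with hQdef
  set r := innerRatio lf0 lf1 lg1 lg2 mug with hrdef
  set M := incrementSize lf0 lg1 vf vg2 N with hM
  have hT0 : (0 : ℝ) < T := by exact_mod_cast hT
  have hT1 : (1 : ℝ) ≤ T := by exact_mod_cast hT
  have hβ0 : 0 ≤ β := by rw [hβ]; positivity
  have hβr : β ≤ r * α := by rw [hβ]; exact div_le_self (by positivity) hT1
  have hβμ : β * mug = 2 * Q * α / T := by rw [hβ, ← hrμ]; ring
  obtain ⟨h1, h2, h3⟩ := innerIter_bound hm hP R hQ hvg1 hS hx hy hβ0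
    (le_trans (by gcongr) hα.inner) (le_trans (by gcongr) hα.contraction)
    (by
      rw [hβμ]
      exact (div_le_self (by positivity) hT1).trans hα.coupling) hτ he T
  simp only [← congrFun hy'] at h1 h2 h3
  have hxS := hx.mono (past_mono (W := W) (S' := innerPast m k T) Set.subset_union_left) le_rfl
  obtain ⟨hm', H, d, hH, hHc, hd, hdn, hmean⟩ := fedOut_direction hm hN hP R hQ hS hxS h1 hp
    hα0.le hα.outer hτ
  rw [← hx'] at hm'
  simp only [← congrFun hx'] at hH
  have hle := hS.past_le (innerPast m k T)
  have hHm : Measurable[mΩ] H := by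
    have e : H = fun ω => α⁻¹ • (x ω - x' ω) := by
      ext1 ω
      rw [hH, sub_sub_cancel, inv_smul_smul₀ hα0.ne']
    rw [e]
    exact ((hx.mono (hS.past_le _) le_rfl).sub (hm'.mono (hS.past_le _) le_rfl)).const_smul α⁻¹
  have hdes := R.integral_obj_step_le hys hle hxS h1 hx2 h2 hHm hHc hd hdn hmean hα0.le
  obtain ⟨htr1, htr2⟩ := R.integral_tracking_step_le hys hle hxS h1 h2 hHm hHc hd hdn hmean
    hα0.le hα.le_one
  simp only [← hH] at hdes htr1 htr2
  have hx'2 : MemLp x' 2 Pr := by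
    rw [show x' = fun ω => x ω - α • H ω from funext hH]
    exact hx2.sub (hHc.memLp.const_smul α)
  have hobj : P.obj = fun x => P.outerAvg (pt x (P.yStar x)) := rfl
  refine ⟨hm', h1.mono (past_mono ?_) le_rfl, hx'2, htr1, ?_⟩
  · rintro j (hj | ⟨t', -, i, rfl | ⟨ν, rfl⟩⟩)
    · exact Nat.lt_succ_of_lt hj
    all_goals exact Nat.lt_succ_self k
  · simp only [hobj, R.gradient_obj hys]
    set D := ∫ ω, ‖y ω - P.yStar (x ω)‖ ^ 2 ∂Pr with hD
    set D' := ∫ ω, ‖y' ω - P.yStar (x ω)‖ ^ 2 ∂Pr with hD'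
    have hD0 : 0 ≤ D := integral_nonneg fun ω => sq_nonneg _
    have hcontr : (1 - β * mug) ^ T ≤ 1 - Q * α := by
      rw [hβμ]
      refine (one_sub_div_pow_le (by positivity) hα.coupling hT).trans_eq (by ring)
    have hnoise : 48 * T * β ^ 2 * vg1 ≤ 48 * r ^ 2 * α ^ 2 * vg1 := by
      have : T * β ^ 2 ≤ r ^ 2 * α ^ 2 := by
        rw [hβ, div_pow, mul_div_assoc', div_le_iff₀ (by positivity), mul_pow, sq (T : ℝ)]
        have : 0 ≤ r ^ 2 * α ^ 2 := by positivity
        nlinarith [mul_nonneg this (mul_nonneg hT0.le (sub_nonneg.2 hT1))]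
      calc _ = 48 * (T * β ^ 2) * vg1 := by ring
        _ ≤ 48 * (r ^ 2 * α ^ 2) * vg1 := by gcongr
        _ = _ := by ring
    have hD'le : D' ≤ (1 - Q * α) * D + 48 * r ^ 2 * α ^ 2 * vg1 :=
      h3.trans (add_le_add (mul_le_mul_of_nonneg_right hcontr hD0) hnoise)
    have hQα : 0 ≤ Q * α := by positivity
    have hc0 : 0 ≤ 48 * r ^ 2 * α ^ 2 * vg1 := by positivity
    -- the contraction of the inner rounds absorbs the coupling of the outer step
    have hkey : (1 + Q * α) * D' ≤ D + 96 * r ^ 2 * α ^ 2 * vg1 := by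
      refine (mul_le_mul_of_nonneg_left hD'le (by positivity)).trans ?_
      have a1 : 0 ≤ (Q * α) ^ 2 * D := by positivity
      have a2 : 0 ≤ (1 - Q * α) * (48 * r ^ 2 * α ^ 2 * vg1) :=
        mul_nonneg (by linarith [hα.coupling]) hc0
      linarith
    rw [roundNoise, ← hrdef]
    rw [hQdef, couplingRate] at hkey
    linarith

end FedProblem

/-! ### Telescoping -/

namespace FedProblem

variable {m d₁ d₂ : ℕ} {Ξ Ζ Ω : Type*} [MeasurableSpace Ξ] [MeasurableSpace Ζ]
  {mΩ : MeasurableSpace Ω} {Pr : Measure Ω} [IsProbabilityMeasure Pr]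
  {P : FedProblem m d₁ d₂ Ξ Ζ} {lf0 lf1 lg1 lg2 mug vf vg1 vg2 : ℝ} {N : ℕ} {W : Ω → Draws m Ξ Ζ}

/-- The one-round inequality, summed over the rounds before `k`. -/
theorem fedNest_potential (hm : 0 < m) (hN : 1 ≤ N) (hP : P.WellBehaved lf0 lf1 lg1 lg2 mug)
    (R : BilevelRegular P.outerAvg P.innerAvg lf0 lf1 lg1 lg2 mug)
    (hQ : P.StochasticSamples vf vg1 vg2) (hvg1 : 0 ≤ vg1) (hS : P.IsSampling Pr N W)
    {T : ℕ} (hT : 1 ≤ T) {α β : ℝ} (hα : SmallStep lf0 lf1 lg1 lg2 mug α)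
    (hβ : β = innerRatio lf0 lf1 lg1 lg2 mug * α / T) {τ : Fin m → ℕ} (hτ : ∀ i, 1 ≤ τ i)
    (x₀ : Vec d₁) (y₀ : Vec d₂) {xs : ℕ → Ω → Vec d₁} {ys : ℕ → Ω → Vec d₂}
    (hxs : xs = fun k ω => (P.fedNest lg1 N T τ (fun _ => α) (fun _ => β) x₀ y₀ (W ω) k).1)
    (hys : ys = fun k ω => (P.fedNest lg1 N T τ (fun _ => α) (fun _ => β) x₀ y₀ (W ω) k).2)
    (k : ℕ) :
    Measurable[past W (drawsBefore m k)] (xs k) ∧ Measurable[past W (drawsBefore m k)] (ys k) ∧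
    MemLp (xs k) 2 Pr ∧ MemLp (fun ω => ys k ω - P.yStar (xs k ω)) 2 Pr ∧
    ∫ ω, P.obj (xs k ω) ∂Pr + ∫ ω, ‖ys k ω - P.yStar (xs k ω)‖ ^ 2 ∂Pr
        + α / 4 * ∑ j ∈ Finset.range k, ∫ ω, ‖gradient P.obj (xs j ω)‖ ^ 2 ∂Pr
      ≤ P.obj x₀ + ‖y₀ - P.yStar x₀‖ ^ 2
        + k * (2 * α * (lf0 / lf1 * neumannBias lf1 lg1 mug N) ^ 2
          + α ^ 2 * roundNoise lf0 lf1 lg1 lg2 mug vg1 (incrementSize lf0 lg1 vf vg2 N)) := by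
  induction k with
  | zero =>
    have hx0 : xs 0 = fun _ => x₀ := by rw [hxs]; rfl
    have hy0 : ys 0 = fun _ => y₀ := by rw [hys]; rfl
    rw [hx0, hy0]
    refine ⟨measurable_const, measurable_const, memLp_const _, memLp_const _, ?_⟩
    simp
  | succ k ih =>
    obtain ⟨h1, h2, h3, h4, h5⟩ := ih
    obtain ⟨g1, g2, g3, g4, g5⟩ := round_potential hm hN hP R hQ hvg1 hS hT h1 h2 h3 h4 hα hβ hτ
      (y' := ys (k + 1)) (x' := xs (k + 1)) (by rw [hxs, hys]; rfl) rfl (by rw [hxs, hys]; rfl)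
    refine ⟨g1, g2, g3, g4, ?_⟩
    rw [Finset.sum_range_succ]
    push_cast
    linarith

/-- The average squared gradient norm along the iterates for a fixed small stepsize. -/
theorem average_gradient_le (hm : 0 < m) (hN : 1 ≤ N) (hP : P.WellBehaved lf0 lf1 lg1 lg2 mug)
    (R : BilevelRegular P.outerAvg P.innerAvg lf0 lf1 lg1 lg2 mug)
    (hQ : P.StochasticSamples vf vg1 vg2) (hvg1 : 0 ≤ vg1) (hS : P.IsSampling Pr N W)
    {T : ℕ} (hT : 1 ≤ T) {α β : ℝ} (hα : SmallStep lf0 lf1 lg1 lg2 mug α)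
    (hβ : β = innerRatio lf0 lf1 lg1 lg2 mug * α / T) {τ : Fin m → ℕ} (hτ : ∀ i, 1 ≤ τ i)
    {x₀ : Vec d₁} {y₀ : Vec d₂} {Δ : ℝ} (hΔ : ∀ x, P.obj x₀ - P.obj x ≤ Δ)
    (hΔ' : ‖y₀ - P.yStar x₀‖ ^ 2 ≤ Δ) {xs : ℕ → Ω → Vec d₁}
    (hxs : xs = fun k ω => (P.fedNest lg1 N T τ (fun _ => α) (fun _ => β) x₀ y₀ (W ω) k).1) :
    (∀ k, Integrable (fun ω => ‖gradient P.obj (xs k ω)‖ ^ 2) Pr) ∧ ∀ K : ℕ, 1 ≤ K →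
    (1 / (K : ℝ)) * ∑ k ∈ Finset.Icc 1 K, ∫ ω, ‖gradient P.obj (xs k ω)‖ ^ 2 ∂Pr
      ≤ 8 * Δ / (α * K) + 16 * (lf0 / lf1 * neumannBias lf1 lg1 mug N) ^ 2
        + 8 * α * roundNoise lf0 lf1 lg1 lg2 mug vg1 (incrementSize lf0 lg1 vf vg2 N) := by
  have hstar := gradY_yStar R
  have hpot := fedNest_potential hm hN hP R hQ hvg1 hS hT hα hβ hτ x₀ y₀ hxs rfl
  have hobj : P.obj = fun x => P.outerAvg (pt x (P.yStar x)) := rfl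
  have hxm : ∀ k, Measurable[mΩ] (xs k) := fun k => (hpot k).1.mono (hS.past_le _) le_rfl
  refine ⟨fun k => ?_, fun K hK => ?_⟩
  · rw [hobj]
    simp only [R.gradient_obj hstar]
    exact (R.memLp_hypergrad_star hstar (hxm k)).integrable_norm_sq
  · obtain ⟨-, -, h3, h4, h5⟩ := hpot (K + 1)
    have hα0 := hα.pos
    have hK0 : (0 : ℝ) < K := by exact_mod_cast hK
    have hK1 : (1 : ℝ) ≤ K := by exact_mod_cast hK
    set c := 2 * α * (lf0 / lf1 * neumannBias lf1 lg1 mug N) ^ 2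
      + α ^ 2 * roundNoise lf0 lf1 lg1 lg2 mug vg1 (incrementSize lf0 lg1 vf vg2 N) with hc
    have hM : 0 ≤ incrementSize lf0 lg1 vf vg2 N := by
      have := globalSize_nonneg (vf := vf) (vg2 := vg2) (N := N) R.lf0_nonneg R.lg1_pos
      unfold incrementSize; positivity
    have hc0 : 0 ≤ c := by
      have := roundNoise_nonneg R.lf0_nonneg R.lf1_pos R.lg1_pos R.lg2_nonneg R.mug_pos hvg1 hM
      positivity
    have hlow : P.obj x₀ - Δ ≤ ∫ ω, P.obj (xs (K + 1) ω) ∂Pr := by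
      have hi : Integrable (fun ω => P.obj (xs (K + 1) ω)) Pr :=
        R.integrable_obj hstar (hxm (K + 1)) h3
      have h := integral_mono (integrable_const (P.obj x₀ - Δ)) hi fun ω => by
        have := hΔ (xs (K + 1) ω)
        change P.obj x₀ - Δ ≤ P.obj (xs (K + 1) ω)
        linarith
      simpa using h
    have hsq : 0 ≤ ∫ ω, ‖(P.fedNest lg1 N T τ (fun _ => α) (fun _ => β) x₀ y₀ (W ω) (K + 1)).2
        - P.yStar (xs (K + 1) ω)‖ ^ 2 ∂Pr := integral_nonneg fun ω => sq_nonneg _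
    -- the average runs over `1, …, K`, so the telescoping includes round `K` itself
    have hsub : ∑ k ∈ Finset.Icc 1 K, ∫ ω, ‖gradient P.obj (xs k ω)‖ ^ 2 ∂Pr
        ≤ ∑ k ∈ Finset.range (K + 1), ∫ ω, ‖gradient P.obj (xs k ω)‖ ^ 2 ∂Pr := by
      refine Finset.sum_le_sum_of_subset_of_nonneg (fun k hk => ?_) fun k _ _ =>
        integral_nonneg fun ω => sq_nonneg _
      rw [Finset.mem_range]
      exact Nat.lt_succ_of_le (Finset.mem_Icc.1 hk).2
    set S := ∑ k ∈ Finset.Icc 1 K, ∫ ω, ‖gradient P.obj (xs k ω)‖ ^ 2 ∂Pr with hSdef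
    have hcK : ((K + 1 : ℕ) : ℝ) * c ≤ 2 * K * c := by
      push_cast
      gcongr
      linarith
    have hmain : α / 4 * S ≤ 2 * Δ + 2 * K * c := by
      have := mul_le_mul_of_nonneg_left hsub (by positivity : 0 ≤ α / 4)
      linarith
    have hfin : S ≤ K * (8 * Δ / (α * K) + 16 * (lf0 / lf1 * neumannBias lf1 lg1 mug N) ^ 2
        + 8 * α * roundNoise lf0 lf1 lg1 lg2 mug vg1 (incrementSize lf0 lg1 vf vg2 N)) := by
      refine le_of_mul_le_mul_left (hmain.trans_eq ?_) (by positivity : 0 < α / 4)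
      rw [hc]
      field_simp
      ring
    rw [one_div, inv_mul_le_iff₀ hK0]
    exact hfin

/-- The stepsize conditions hold for all stepsizes up to a bound that depends only on the
smoothness and convexity constants. -/
theorem smallStep_of_le (hlf0 : 0 ≤ lf0) (hlf1 : 0 < lf1) (hlg1 : 0 < lg1) (hlg2 : 0 ≤ lg2)
    (hmug : 0 < mug) {α : ℝ} (h0 : 0 < α) (h1 : α ≤ min 1 (1 / (2 * lf1)))
    (h2 : α ≤ 1 / (2 * couplingRate lf0 lf1 lg1 lg2 mug))
    (h3 : α ≤ min (1 / (2 * (innerRatio lf0 lf1 lg1 lg2 mug * lg1)))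
      (mug / (18 * lg1 ^ 2 * innerRatio lf0 lf1 lg1 lg2 mug))) :
    SmallStep lf0 lf1 lg1 lg2 mug α := by
  have hQ := couplingRate_pos hlf0 hlf1 hlg1 hlg2 hmug
  have hr := innerRatio_pos hlf0 hlf1 hlg1 hlg2 hmug
  have h1b := h1.trans (min_le_right _ _)
  have h3a := h3.trans (min_le_left _ _)
  have h3b := h3.trans (min_le_right _ _)
  rw [le_div_iff₀ (by positivity)] at h1b h2 h3a h3b
  exact ⟨h0, h1.trans (min_le_left _ _), by linarith, by linarith, by linarith, by linarith⟩

end FedProblem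

/-- The reciprocal of a minimum of two positive numbers is at most the sum of the reciprocals. -/
theorem one_div_min_le {a b : ℝ} (ha : 0 < a) (hb : 0 < b) : 1 / min a b ≤ 1 / a + 1 / b := by
  have h1 : 0 < 1 / a := by positivity
  have h2 : 0 < 1 / b := by positivity
  rcases min_choice a b with h | h <;> rw [h] <;> linarith

end

theorem theorem1
    (lf0 lf1 lg1 lg2 mug : ℝ) (hlf0 : 0 ≤ lf0) (hlf1 : 0 < lf1) (hlg1 : 0 < lg1)
    (hlg2 : 0 ≤ lg2) (hmug : 0 < mug) :
    -- the stepsize constants and the factor of the bias depend on the constants above only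
    ∃ a₁ a₂ a₃ bbar Cb : ℝ, 0 < a₁ ∧ 0 < a₂ ∧ 0 < a₃ ∧ 0 < bbar ∧ 0 < Cb ∧
    ∀ (vf vg1 vg2 : ℝ), 0 ≤ vf → 0 ≤ vg1 → 0 ≤ vg2 → 0 < max vg1 (max vg2 vf) →
    ∀ (a : ℝ), 0 < a → ∀ (N : ℕ), 1 ≤ N → ∀ (Δ : ℝ),
    ∃ C : ℝ, 0 < C ∧
    ∀ (T : ℕ), 1 ≤ T →
    ∀ (m d₁ d₂ : ℕ), 0 < m →
    ∀ (Ξ Ζ : Type*) [MeasurableSpace Ξ] [MeasurableSpace Ζ] (P : FedProblem m d₁ d₂ Ξ Ζ),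
    P.WellBehaved lf0 lf1 lg1 lg2 mug →
    P.StochasticSamples vf vg1 vg2 →
    ∀ (τ : Fin m → ℕ), (∀ i, 1 ≤ τ i) →
    ∀ (x₀ : Vec d₁) (y₀ : Vec d₂),
    (∀ x, P.obj x₀ - P.obj x ≤ Δ) → ‖y₀ - P.yStar x₀‖ ^ 2 ≤ Δ →
    ∀ (Ω : Type*) [MeasurableSpace Ω] (Pr : Measure Ω) [IsProbabilityMeasure Pr]
      (W : Ω → Draws m Ξ Ζ), P.IsSampling Pr N W →
    ∀ (K : ℕ), 1 ≤ K →
    let α : ℝ := outerStep a₁ a₂ a₃ a K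
    let β : ℝ := bbar * α / T
    let xs : ℕ → Ω → Vec d₁ := fun k ω =>
      (P.fedNest lg1 N T τ (fun _ => α) (fun _ => β) x₀ y₀ (W ω) k).1
    Differentiable ℝ P.obj ∧
    (∀ k, Integrable (fun ω => ‖gradient P.obj (xs k ω)‖ ^ 2) Pr) ∧
    (1 / (K : ℝ)) * ∑ k ∈ Finset.Icc 1 K, ∫ ω, ‖gradient P.obj (xs k ω)‖ ^ 2 ∂Pr ≤
      C * (a * max vg1 (max vg2 vf) / Real.sqrt K + 1 / (min a₁ (min a₂ a₃) * K))
        + Cb * neumannBias lf1 lg1 mug N ^ 2 := by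
  have hQ0 := couplingRate_pos hlf0 hlf1 hlg1 hlg2 hmug
  have hr0 := innerRatio_pos hlf0 hlf1 hlg1 hlg2 hmug
  set Q := couplingRate lf0 lf1 lg1 lg2 mug with hQdef
  set r := innerRatio lf0 lf1 lg1 lg2 mug with hrdef
  set a₁ : ℝ := min 1 (1 / (2 * lf1)) with ha₁
  set a₂ : ℝ := 1 / (2 * Q) with ha₂
  set a₃ : ℝ := min (1 / (2 * (r * lg1))) (mug / (18 * lg1 ^ 2 * r)) with ha₃
  have ha₁0 : 0 < a₁ := by positivity
  have ha₂0 : 0 < a₂ := by positivity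
  have ha₃0 : 0 < a₃ := by positivity
  refine ⟨a₁, a₂, a₃, r, 16 * (lf0 / lf1) ^ 2 + 1, ha₁0, ha₂0, ha₃0, hr0, by positivity, ?_⟩
  intro vf vg1 vg2 hvf hvg1 hvg2 hσ a ha N hN Δ
  set σ := max vg1 (max vg2 vf) with hσdef
  set A := roundNoise lf0 lf1 lg1 lg2 mug vg1 (FedProblem.incrementSize lf0 lg1 vf vg2 N) with hA
  have hA0 : 0 ≤ A := by
    refine roundNoise_nonneg hlf0 hlf1 hlg1 hlg2 hmug hvg1 ?_
    have := FedProblem.globalSize_nonneg (vf := vf) (vg2 := vg2) (N := N) hlf0 hlg1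
    unfold FedProblem.incrementSize
    positivity
  -- division by `σ > 0` puts the noise and the initial gap into the first term of the rate
  refine ⟨8 * |Δ| + (8 * |Δ| / a ^ 2 + 8 * A) / σ + 1, by positivity, ?_⟩
  intro T hT m d₁ d₂ hm Ξ Ζ _ _ P hP hQ τ hτ x₀ y₀ hΔ hΔ' Ω _ Pr _ W hS K hK α β xs
  have R := hP.bilevelRegular hm hlf0 hlf1 hlg1 hlg2 hmug
  have hK0 : (0 : ℝ) < K := by exact_mod_cast hK
  have hsK : 0 < √(K : ℝ) := Real.sqrt_pos.2 hK0
  have hsKK : √(K : ℝ) * √(K : ℝ) = K := Real.mul_self_sqrt hK0.le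
  set ab := min a₁ (min a₂ a₃) with hab
  have hab0 : 0 < ab := lt_min ha₁0 (lt_min ha₂0 ha₃0)
  have hα0 : 0 < α := lt_min hab0 (by positivity)
  have hαab : α ≤ ab := min_le_left _ _
  have hαK : α ≤ a / √(K : ℝ) := min_le_right _ _
  have hα : FedProblem.SmallStep lf0 lf1 lg1 lg2 mug α :=
    FedProblem.smallStep_of_le hlf0 hlf1 hlg1 hlg2 hmug hα0 (hαab.trans (min_le_left _ _))
      (hαab.trans ((min_le_right _ _).trans (min_le_left _ _)))
      (hαab.trans ((min_le_right _ _).trans (min_le_right _ _)))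
  obtain ⟨hint, havg⟩ := FedProblem.average_gradient_le hm hN hP R hQ hvg1 hS hT hα
    (β := β) rfl hτ hΔ hΔ' (xs := xs) rfl
  refine ⟨fun x => (R.hasGradientAt_obj (FedProblem.gradY_yStar R) x).differentiableAt, hint,
    (havg K hK).trans ?_⟩
  rw [← hA]
  set b := neumannBias lf1 lg1 mug N with hb
  -- `1 / α ≤ 1 / ᾱ + √K / a` splits the initial gap between the two terms of the rate
  have hinv : 1 / α ≤ 1 / ab + √(K : ℝ) / a := by
    have := one_div_min_le hab0 (div_pos ha hsK)
    rwa [one_div_div] at this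
  have h1 : 8 * Δ / (α * K) ≤ 8 * |Δ| * (1 / (ab * K)) + 8 * |Δ| / a ^ 2 * (a / √(K : ℝ)) := by
    calc 8 * Δ / (α * K) = 8 * Δ / K * (1 / α) := by field_simp
      _ ≤ 8 * |Δ| / K * (1 / ab + √(K : ℝ) / a) := by
          gcongr
          exact le_abs_self Δ
      _ = 8 * |Δ| * (1 / (ab * K)) + 8 * |Δ| * √(K : ℝ) / (a * (√(K : ℝ) * √(K : ℝ))) := by
          rw [hsKK]; field_simp
      _ = _ := by field_simp
  have h2 : 8 * α * A ≤ 8 * A * (a / √(K : ℝ)) := by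
    calc 8 * α * A = 8 * A * α := by ring
      _ ≤ _ := by gcongr
  have h3 : (8 * |Δ| / a ^ 2 + 8 * A) * (a / √(K : ℝ))
      = (8 * |Δ| / a ^ 2 + 8 * A) / σ * (a * σ / √(K : ℝ)) := by field_simp
  have h4 : 0 ≤ (8 * |Δ| / a ^ 2 + 8 * A) / σ := by positivity
  have h5 : 0 ≤ a * σ / √(K : ℝ) := by positivity
  have h6 : 0 ≤ 1 / (ab * K) := by positivity
  have h7 : 0 ≤ 8 * |Δ| := by positivity
  have h8 : 16 * (lf0 / lf1 * b) ^ 2 ≤ (16 * (lf0 / lf1) ^ 2 + 1) * b ^ 2 := by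
    nlinarith [sq_nonneg b]
  have h9 := mul_nonneg h4 h6
  have h10 := mul_nonneg h7 h5
  linarith
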